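/- Let $n\ge 2$, $b>0$, $\Omega=\mathbb{R}^{n-1}\times(0,b)$, $\Sigma_0=\mathbb{R}^{n-1}\times\{0\}$, and let $\mathbb{F}\in\{\mathbb{R},\mathbb{C}\}$. Let $${}_{\tan}H^1(\Omega;\mathbb{F}^n)=\{u\in H^1(\Omega;\mathbb{F}^n): u_n|_{\Sigma_0}=0\}$$ with the $H^1$ norm, where $u_n|_{\Sigma_0}$ is the trace, and let $({}_{\tan}H^1(\Omega;\mathbb{F}^n))^{\overline{*}}$ be the space of its bounded antilinear functionals (bounded linear functionals if $\mathbb{F}=\mathbb{R}$). Write $\mathbb{D}u=\nabla u+(\nabla u)^T$. Let $\mu>0$, $\alpha>0$, $\gamma\in\mathbb{R}$, and let $\beta\in\mathbb{R}^{n\times n}$ be positive definite in the sense that $\beta w\cdot w>0$ for all $w\in\mathbb{R}^n\setminus\{0\}$ ($\beta$ need not be symmetric). For $u\in{}_{\tan}H^1(\Omega;\mathbb{F}^n)$ and $p\in L^2(\Omega;\mathbb{F})$ define $\mathfrak{L}_{\alpha,\beta,\gamma}(u,p)\in({}_{\tan}H^1(\Omega;\mathbb{F}^n))^{\overline{*}}$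 by $$\langle\mathfrak{L}_{\alpha,\beta,\gamma}(u,p),v\rangle=\int_\Omega\Big(\frac{\mu}{2}\,\mathbb{D}u:\mathbb{D}\overline{v}-p\,\operatorname{div}\overline{v}-\gamma\,\partial_1u\cdot\overline{v}\Big)+\frac1\alpha\int_{\Sigma_0}\beta u\cdot\overline{v},\qquad v\in{}_{\tan}H^1(\Omega;\mathbb{F}^n).$$ Then the map $$\chi_{\alpha,\beta,\gamma}(u,p)=(\mathfrak{L}_{\alpha,\beta,\gamma}(u,p),\operatorname{div}u)$$ is well defined and is an isomorphism (a bounded $\mathbb{F}$-linear bijection with bounded inverse) from ${}_{\tan}H^1(\Omega;\mathbb{F}^n)\times L^2(\Omega;\mathbb{F})$ onto $({}_{\tan}H^1(\Omega;\mathbb{F}^n))^{\overline{*}}\times L^2(\Omega;\mathbb{F})$. -/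

import Mathlib

open MeasureTheory Set Filter Topology
open scoped ContDiff ENNReal ComplexConjugate

namespace SlipStokes

/-- The horizontal space `ℝ^d`, where `d = n - 1`. -/
abbrev Hor (d : ℕ) : Type := EuclideanSpace ℝ (Fin d)

/-- The space `ℝⁿ = ℝ^d × ℝ` with `n = d + 1`; its points are `x = (x', xₙ)`, and its measure is
Lebesgue measure. -/
abbrev Space (d : ℕ) : Type := Hor d × ℝ

/-- The standard basis of `ℝⁿ`: `e₁, …, e_d` span the horizontal space, and the last vector is
`eₙ = (0, 1)`. -/
noncomputable def basisVec (d : ℕ) (i : Fin (d + 1)) : Space d :=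
  Fin.lastCases (motive := fun _ => Space d) (0, 1) (fun j => (EuclideanSpace.single j 1, 0)) i

/-- The strip `Ω = ℝ^d × (0, b)`. -/
def strip (d : ℕ) (b : ℝ) : Set (Space d) := {x | 0 < x.2 ∧ x.2 < b}

/-- Lebesgue measure on the strip. -/
noncomputable abbrev stripMeasure (d : ℕ) (b : ℝ) : Measure (Space d) :=
  volume.restrict (strip d b)

/-- `L²(Ω; 𝕜)`. -/
abbrev L2 (𝕜 : Type*) [RCLike 𝕜] (d : ℕ) (b : ℝ) : Type _ := Lp 𝕜 2 (stripMeasure d b)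

/-- `L²(Σ₀; 𝕜)`, where `Σ₀ = ℝ^d × {0}` is identified with `ℝ^d`. -/
abbrev BdryL2 (𝕜 : Type*) [RCLike 𝕜] (d : ℕ) : Type _ := Lp 𝕜 2 (volume : Measure (Hor d))

/-- `g` is the weak partial derivative `∂ᵢ f` in `Ω`:
`∫_Ω f ∂ᵢφ = - ∫_Ω g φ` for every test function `φ ∈ C_c^∞(Ω)`. -/
def IsWeakPartial {𝕜 : Type*} [RCLike 𝕜] (d : ℕ) (b : ℝ) (i : Fin (d + 1))
    (f g : Space d → 𝕜) : Prop :=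
  ∀ φ : Space d → ℝ, ContDiff ℝ ∞ φ → HasCompactSupport φ → tsupport φ ⊆ strip d b →
    ∫ x in strip d b, fderiv ℝ φ x (basisVec d i) • f x = - ∫ x in strip d b, φ x • g x

section

variable {𝕜 : Type*} [RCLike 𝕜] {d : ℕ} {b : ℝ}

theorem integrable_smul_L2 (f : L2 𝕜 d b) {φ : Space d → ℝ} (hφ : Continuous φ)
    (hc : HasCompactSupport φ) : Integrable (fun x => φ x • f x) (stripMeasure d b) :=
  ((Lp.memLp f).locallyIntegrable (by norm_num)).integrable_smul_left_of_hasCompactSupport hφ hc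

theorem continuous_partial {φ : Space d → ℝ} (hφ : ContDiff ℝ ∞ φ) (v : Space d) :
    Continuous fun x => fderiv ℝ φ x v :=
  (hφ.continuous_fderiv (by simp)).clm_apply continuous_const

theorem compact_partial {φ : Space d → ℝ} (hc : HasCompactSupport φ) (v : Space d) :
    HasCompactSupport fun x => fderiv ℝ φ x v :=
  hc.fderiv_apply (𝕜 := ℝ) v

end

/-- The Sobolev space `H¹(Ω; 𝕜)`.  An element is a function `w.fst ∈ L²(Ω)` together with its weak
gradient `w.snd = (∂₁ w, …, ∂ₙ w)`, which lies in `L²(Ω)ⁿ` and is determined by `w.fst`.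
The norm is the usual one, `‖w‖² = ‖w.fst‖² + ∑ᵢ ‖∂ᵢ w‖²`. -/
noncomputable def H1 (𝕜 : Type*) [RCLike 𝕜] (d : ℕ) (b : ℝ) :
    Submodule 𝕜 (WithLp 2 (L2 𝕜 d b × PiLp 2 (fun _ : Fin (d + 1) => L2 𝕜 d b))) where
  carrier := {w | ∀ i, IsWeakPartial d b i w.fst (w.snd i)}
  zero_mem' := by
    intro i φ hφ hc hs
    have h0 := Lp.coeFn_zero 𝕜 2 (stripMeasure d b)
    have e1 : ∫ x in strip d b, fderiv ℝ φ x (basisVec d i) • (0 : L2 𝕜 d b) x = 0 :=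
      integral_eq_zero_of_ae (by filter_upwards [h0] with x hx; rw [hx]; simp)
    have e2 : ∫ x in strip d b, φ x • (0 : L2 𝕜 d b) x = 0 :=
      integral_eq_zero_of_ae (by filter_upwards [h0] with x hx; rw [hx]; simp)
    change ∫ x in strip d b, fderiv ℝ φ x (basisVec d i) • (0 : L2 𝕜 d b) x
      = - ∫ x in strip d b, φ x • (0 : L2 𝕜 d b) x
    rw [e1, e2, neg_zero]
  add_mem' := by
    intro v w hv hw i φ hφ hc hs
    have h1 := integrable_smul_L2 v.fst (continuous_partial hφ (basisVec d i)) (compact_partial hc _)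
    have h2 := integrable_smul_L2 w.fst (continuous_partial hφ (basisVec d i)) (compact_partial hc _)
    have h3 := integrable_smul_L2 (v.snd i) hφ.continuous hc
    have h4 := integrable_smul_L2 (w.snd i) hφ.continuous hc
    have e1 : ∫ x in strip d b, fderiv ℝ φ x (basisVec d i) • (v.fst + w.fst : L2 𝕜 d b) x
        = (∫ x in strip d b, fderiv ℝ φ x (basisVec d i) • v.fst x)
          + ∫ x in strip d b, fderiv ℝ φ x (basisVec d i) • w.fst x := by
      rw [← integral_add h1 h2]
      refine integral_congr_ae ?_
      filter_upwards [Lp.coeFn_add v.fst w.fst] with x hx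
      rw [hx, Pi.add_apply, smul_add]
    have e2 : ∫ x in strip d b, φ x • (v.snd i + w.snd i : L2 𝕜 d b) x
        = (∫ x in strip d b, φ x • v.snd i x) + ∫ x in strip d b, φ x • w.snd i x := by
      rw [← integral_add h3 h4]
      refine integral_congr_ae ?_
      filter_upwards [Lp.coeFn_add (v.snd i) (w.snd i)] with x hx
      rw [hx, Pi.add_apply, smul_add]
    change ∫ x in strip d b, fderiv ℝ φ x (basisVec d i) • (v.fst + w.fst : L2 𝕜 d b) x
      = - ∫ x in strip d b, φ x • (v.snd i + w.snd i : L2 𝕜 d b) x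
    rw [e1, e2, hv i φ hφ hc hs, hw i φ hφ hc hs, neg_add]
  smul_mem' := by
    intro c w hw i φ hφ hc hs
    have e1 : ∫ x in strip d b, fderiv ℝ φ x (basisVec d i) • (c • w.fst : L2 𝕜 d b) x
        = c * ∫ x in strip d b, fderiv ℝ φ x (basisVec d i) • w.fst x := by
      rw [← integral_const_mul]
      refine integral_congr_ae ?_
      filter_upwards [Lp.coeFn_smul c w.fst] with x hx
      simp [hx]
    have e2 : ∫ x in strip d b, φ x • (c • w.snd i : L2 𝕜 d b) x
        = c * ∫ x in strip d b, φ x • w.snd i x := by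
      rw [← integral_const_mul]
      refine integral_congr_ae ?_
      filter_upwards [Lp.coeFn_smul c (w.snd i)] with x hx
      simp [hx]
    change ∫ x in strip d b, fderiv ℝ φ x (basisVec d i) • (c • w.fst : L2 𝕜 d b) x
      = - ∫ x in strip d b, φ x • (c • w.snd i : L2 𝕜 d b) x
    rw [e1, e2, hw i φ hφ hc hs, mul_neg]

/-- `g ∈ L²(Σ₀)` is the trace on `Σ₀` of `w ∈ H¹(Ω)`, in the sense of the integration by parts
formula `∫_Ω (w ∂ₙφ + φ ∂ₙw) = - ∫_{Σ₀} g φ` for every `φ ∈ C_c^∞(ℝⁿ)` vanishing near `Σ_b` and above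
it. -/
def IsTrace {𝕜 : Type*} [RCLike 𝕜] {d : ℕ} {b : ℝ} (w : H1 𝕜 d b) (g : BdryL2 𝕜 d) : Prop :=
  ∀ φ : Space d → ℝ, ContDiff ℝ ∞ φ → HasCompactSupport φ → tsupport φ ⊆ {x | x.2 < b} →
    ∫ x in strip d b, (fderiv ℝ φ x (basisVec d (Fin.last d)) • w.1.fst x
        + φ x • w.1.snd (Fin.last d) x)
      = - ∫ y : Hor d, φ (y, 0) • g y

section

variable {𝕜 : Type*} [RCLike 𝕜] {d : ℕ} {b : ℝ}

theorem basisVec_last : basisVec d (Fin.last d) = (0, 1) := by simp [basisVec]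

theorem basisVec_castSucc (j : Fin d) :
    basisVec d j.castSucc = (EuclideanSpace.single j 1, 0) := by simp [basisVec]

theorem stripMeasure_eq : stripMeasure d b
    = (volume : Measure (Hor d)).prod ((volume : Measure ℝ).restrict (Ioo 0 b)) := by
  have : strip d b = univ ×ˢ Ioo 0 b := by ext x; simp [strip]
  rw [stripMeasure, this, Measure.volume_eq_prod, ← Measure.prod_restrict, Measure.restrict_univ]

theorem memLp_lift (h : BdryL2 𝕜 d) : MemLp (fun x : Space d => h x.1) 2 (stripMeasure d b) := by
  rw [stripMeasure_eq]; exact (Lp.memLp h).comp_fst _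

theorem lift_ae {p : Hor d → Prop} (hp : ∀ᵐ y, p y) : ∀ᵐ x ∂(stripMeasure d b), p x.1 := by
  rw [stripMeasure_eq]
  exact Measure.quasiMeasurePreserving_fst.ae hp

/-- The extension of a function on `Σ₀` to `Ω` that does not depend on `xₙ`. -/
noncomputable def lift (b : ℝ) : BdryL2 𝕜 d →ₗ[𝕜] L2 𝕜 d b where
  toFun h := (memLp_lift h).toLp _
  map_add' f g := by
    rw [← MemLp.toLp_add, MemLp.toLp_eq_toLp_iff]
    filter_upwards [lift_ae (b := b) (Lp.coeFn_add f g)] with x hx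
    simpa using hx
  map_smul' c f := by
    rw [RingHom.id_apply, ← MemLp.toLp_const_smul, MemLp.toLp_eq_toLp_iff]
    filter_upwards [lift_ae (b := b) (Lp.coeFn_smul c f)] with x hx
    simpa using hx

theorem norm_lift_le (h : BdryL2 𝕜 d) :
    ‖lift b h‖ ≤ (volume (Ioo (0 : ℝ) b) ^ (1 / (2 : ℝ≥0∞).toReal)).toReal * ‖h‖ := by
  have e : eLpNorm (fun x : Space d => h x.1) 2 (stripMeasure d b)
      = volume (Ioo (0 : ℝ) b) ^ (1 / (2 : ℝ≥0∞).toReal) * eLpNorm h 2 volume := by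
    have hm : Measure.map Prod.fst (stripMeasure d b)
        = volume (Ioo (0 : ℝ) b) • (volume : Measure (Hor d)) := by
      rw [stripMeasure_eq, Measure.map_fst_prod]; simp
    have hs : AEStronglyMeasurable h (Measure.map Prod.fst (stripMeasure d b)) := by
      rw [hm]; exact (Lp.aestronglyMeasurable h).smul_measure _
    have := eLpNorm_map_measure (p := 2) hs (measurable_fst.aemeasurable)
    rw [hm] at this
    rw [← Function.comp_def (fun y => h y) Prod.fst, ← this,
      eLpNorm_smul_measure_of_ne_top (by simp)]
    simp
  change ‖(memLp_lift h).toLp _‖ ≤ _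
  rw [Lp.norm_toLp, e, ENNReal.toReal_mul, Lp.norm_def]

/-- A smooth cutoff in the vertical variable: `1` for `t ≤ b / 3` and `0` for `2 b / 3 ≤ t`. -/
noncomputable def cut (b t : ℝ) : ℝ := Real.smoothTransition (2 - 3 * t / b)

theorem cut_contDiff : ContDiff ℝ ∞ (cut b) :=
  Real.smoothTransition.contDiff.comp (by fun_prop)

theorem cut_zero : cut b 0 = 1 := Real.smoothTransition.one_of_one_le (by norm_num)

theorem cut_eq_zero (hb : 0 < b) {t : ℝ} (ht : 2 * b / 3 ≤ t) : cut b t = 0 := by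
  refine Real.smoothTransition.zero_of_nonpos ?_
  have : 2 ≤ 3 * t / b := by rw [le_div_iff₀ hb]; linarith
  linarith

theorem smoothTransition_deriv_bound :
    ∃ C : ℝ, 0 ≤ C ∧ ∀ t : ℝ, |deriv Real.smoothTransition t| ≤ C := by
  have hc : Continuous (deriv Real.smoothTransition) :=
    (Real.smoothTransition.contDiff (n := ⊤)).continuous_deriv (by simp)
  have hs : HasCompactSupport (deriv Real.smoothTransition) := by
    refine HasCompactSupport.of_support_subset_isCompact (isCompact_Icc (a := (0 : ℝ)) (b := 1)) ?_
    intro t ht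
    by_contra hn
    apply ht
    rw [mem_Icc, not_and_or, not_le, not_le] at hn
    rcases hn with h | h
    · have : Real.smoothTransition =ᶠ[𝓝 t] fun _ => (0 : ℝ) := by
        filter_upwards [Iio_mem_nhds h] with s hs
        exact Real.smoothTransition.zero_of_nonpos (le_of_lt hs)
      rw [this.deriv_eq]; simp
    · have : Real.smoothTransition =ᶠ[𝓝 t] fun _ => (1 : ℝ) := by
        filter_upwards [Ioi_mem_nhds h] with s hs
        exact Real.smoothTransition.one_of_one_le (le_of_lt hs)
      rw [this.deriv_eq]; simp
  obtain ⟨C, hC⟩ := hc.bounded_above_of_compact_support hs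
  exact ⟨C, (norm_nonneg _).trans (hC 0), hC⟩

theorem vertical_hasDerivAt {ψ : Space d → ℝ} (hψ : ContDiff ℝ ∞ ψ) (y : Hor d) (t : ℝ) :
    HasDerivAt (fun s => ψ (y, s)) (fderiv ℝ ψ (y, t) (basisVec d (Fin.last d))) t := by
  rw [basisVec_last]
  have h1 : HasFDerivAt ψ (fderiv ℝ ψ (y, t)) (y, t) :=
    ((hψ.differentiable (by simp)) (y, t)).hasFDerivAt
  have h2 : HasDerivAt (fun s : ℝ => ((y, s) : Space d)) (0, 1) t :=
    (hasDerivAt_const t y).prodMk (hasDerivAt_id t)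
  exact h1.comp_hasDerivAt t h2

/-- Integration by parts in the vertical direction against functions that vanish on `Σ₀` and near
`Σ_b`. -/
theorem integral_vertical_eq_zero (hb : 0 < b) (w : H1 𝕜 d b) {ψ : Space d → ℝ}
    (hψ : ContDiff ℝ ∞ ψ) (h0 : ∀ y, ψ (y, 0) = 0) {K : Set (Hor d)} (hK : IsCompact K)
    (hψK : ∀ x : Space d, x.1 ∉ K → ψ x = 0) {c : ℝ} (hc : c < b)
    (hψc : ∀ x : Space d, c < x.2 → ψ x = 0) :
    ∫ x in strip d b, (fderiv ℝ ψ x (basisVec d (Fin.last d)) • w.1.fst x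
        + ψ x • w.1.snd (Fin.last d) x) = 0 := by
  set e := basisVec d (Fin.last d) with he
  set S := Real.smoothTransition with hS
  obtain ⟨C, hC0, hC⟩ := smoothTransition_deriv_bound
  have hQ : IsCompact (K ×ˢ Icc (0 : ℝ) b) := hK.prod isCompact_Icc
  obtain ⟨M, hM⟩ := hQ.exists_bound_of_continuousOn (continuous_partial hψ e).continuousOn
  set M' := max M 0 with hM'
  have hM0 : 0 ≤ M' := le_max_right _ _
  have hdψ : ∀ x : Space d, x ∈ strip d b → x.1 ∈ K → |fderiv ℝ ψ x e| ≤ M' := fun x hx hxK =>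
    (hM x ⟨hxK, hx.1.le, hx.2.le⟩).trans (le_max_left _ _)
  have hψb : ∀ x : Space d, x ∈ strip d b → x.1 ∈ K → |ψ x| ≤ M' * x.2 := by
    intro x hx hxK
    have := (convex_Icc (0 : ℝ) b).norm_image_sub_le_of_norm_hasDerivWithin_le
      (f := fun s => ψ (x.1, s)) (f' := fun s => fderiv ℝ ψ (x.1, s) e) (C := M')
      (fun s _ => (vertical_hasDerivAt hψ x.1 s).hasDerivWithinAt)
      (fun s hs => (hM (x.1, s) ⟨hxK, hs⟩).trans (le_max_left _ _))
      (left_mem_Icc.2 hb.le) (⟨hx.1.le, hx.2.le⟩ : x.2 ∈ Icc 0 b)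
    simpa [h0, abs_of_pos hx.1] using this
  have hdψK : ∀ x : Space d, x.1 ∉ K → fderiv ℝ ψ x e = 0 := by
    intro x hx
    have : ψ =ᶠ[𝓝 x] fun _ => (0 : ℝ) := by
      have ho : IsOpen {z : Space d | z.1 ∉ K} := (hK.isClosed.isOpen_compl).preimage continuous_fst
      filter_upwards [ho.mem_nhds hx] with z hz using hψK z hz
    rw [this.fderiv_eq]; simp
  let a : ℕ → Space d → ℝ := fun k x => S ((k + 1) * x.2 - 1)
  let a' : ℕ → Space d → ℝ := fun k x => (k + 1) * deriv S ((k + 1) * x.2 - 1)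
  have hSd : ContDiff ℝ ∞ S := Real.smoothTransition.contDiff
  have had : ∀ k, ContDiff ℝ ∞ (a k) := fun k => hSd.comp (by fun_prop)
  have hφd : ∀ k, ContDiff ℝ ∞ fun x => a k x * ψ x := fun k => (had k).mul hψ
  have hder : ∀ k x, fderiv ℝ (fun x => a k x * ψ x) x e
      = a' k x * ψ x + a k x * fderiv ℝ ψ x e := by
    rintro k ⟨y, t⟩
    have h1 := vertical_hasDerivAt (hφd k) y t
    have h2 : HasDerivAt (fun s => a k (y, s)) (a' k (y, t)) t := by
      have hs : HasDerivAt S (deriv S ((k + 1) * t - 1)) ((k + 1) * t - 1) :=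
        ((hSd.differentiable (by simp)) _).hasDerivAt
      have hl : HasDerivAt (fun s : ℝ => (k + 1) * s - 1) ((k : ℝ) + 1) t := by
        simpa using ((hasDerivAt_id t).const_mul ((k : ℝ) + 1)).sub_const 1
      have := hs.comp t hl
      rw [mul_comm] at this
      exact this
    exact h1.unique (h2.mul (vertical_hasDerivAt hψ y t))
  have hsub : ∀ k, tsupport (fun x => a k x * ψ x) ⊆ K ×ˢ Icc (1 / ((k : ℝ) + 1)) c := by
    intro k
    refine closure_minimal ?_ (hK.isClosed.prod isClosed_Icc)
    intro x hx
    have hx1 : a k x ≠ 0 := left_ne_zero_of_mul hx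
    have hx2 : ψ x ≠ 0 := right_ne_zero_of_mul hx
    refine ⟨by_contra fun h => hx2 (hψK x h), ?_, not_lt.1 fun h => hx2 (hψc x h)⟩
    by_contra h
    apply hx1
    refine Real.smoothTransition.zero_of_nonpos ?_
    have hk : (0 : ℝ) < k + 1 := by positivity
    rw [not_le, lt_div_iff₀ hk] at h
    linarith
  have hcomp : ∀ k, HasCompactSupport fun x => a k x * ψ x := fun k =>
    (hK.prod isCompact_Icc).of_isClosed_subset (isClosed_tsupport _) (hsub k)
  have hstrip : ∀ k, tsupport (fun x => a k x * ψ x) ⊆ strip d b := by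
    intro k x hx
    have := hsub k hx
    have hk : (0 : ℝ) < 1 / ((k : ℝ) + 1) := by positivity
    exact ⟨hk.trans_le this.2.1, this.2.2.trans_lt hc⟩
  let F : ℕ → Space d → 𝕜 := fun k x =>
    fderiv ℝ (fun x => a k x * ψ x) x e • w.1.fst x + (a k x * ψ x) • w.1.snd (Fin.last d) x
  have hF0 : ∀ k, ∫ x in strip d b, F k x = 0 := by
    intro k
    have i1 := integrable_smul_L2 w.1.fst (continuous_partial (hφd k) e) (compact_partial (hcomp k) e)
    have i2 := integrable_smul_L2 (w.1.snd (Fin.last d)) (hφd k).continuous (hcomp k)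
    rw [integral_add i1 i2, w.2 (Fin.last d) _ (hφd k) (hcomp k) (hstrip k), neg_add_cancel]
  let Q := K ×ˢ Icc (0 : ℝ) b
  let G : Space d → ℝ := Q.indicator fun x =>
    (C * M' * 2 + M') * ‖w.1.fst x‖ + (M' * b) * ‖w.1.snd (Fin.last d) x‖
  have hG : Integrable G (stripMeasure d b) := by
    rw [integrable_indicator_iff hQ.measurableSet]
    have j : ∀ f : L2 𝕜 d b, IntegrableOn (fun x => ‖f x‖) Q (stripMeasure d b) := fun f =>
      (((Lp.memLp f).locallyIntegrable (by norm_num)).integrableOn_isCompact hQ).norm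
    exact ((j _).const_mul _).add ((j _).const_mul _)
  have hmeas : MeasurableSet (strip d b) :=
    (measurableSet_lt measurable_const measurable_snd).inter
      (measurableSet_lt measurable_snd measurable_const)
  have hlim : Tendsto (fun k => ∫ x in strip d b, F k x) atTop
      (𝓝 (∫ x in strip d b, (fderiv ℝ ψ x e • w.1.fst x + ψ x • w.1.snd (Fin.last d) x))) := by
    refine tendsto_integral_of_dominated_convergence G ?_ hG ?_ ?_
    · intro k
      exact ((integrable_smul_L2 w.1.fst (continuous_partial (hφd k) e)
        (compact_partial (hcomp k) e)).add (integrable_smul_L2 (w.1.snd (Fin.last d))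
          (hφd k).continuous (hcomp k))).aestronglyMeasurable
    · intro k
      filter_upwards [ae_restrict_mem hmeas] with x hx
      by_cases hxK : x.1 ∈ K
      · have hxQ : x ∈ Q := ⟨hxK, hx.1.le, hx.2.le⟩
        have ha1 : |a k x| ≤ 1 := by
          rw [abs_of_nonneg (Real.smoothTransition.nonneg _)]; exact Real.smoothTransition.le_one _
        have hk : (0 : ℝ) < k + 1 := by positivity
        have ha2 : |a' k x * ψ x| ≤ C * M' * 2 := by
          by_cases hbig : 1 < (k + 1) * x.2 - 1
          · have : S =ᶠ[𝓝 ((k + 1) * x.2 - 1)] fun _ => (1 : ℝ) := by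
              filter_upwards [Ioi_mem_nhds hbig] with s hs
              exact Real.smoothTransition.one_of_one_le (le_of_lt hs)
            have hz : a' k x = 0 := by
              change (k + 1) * deriv S ((k + 1) * x.2 - 1) = 0
              rw [this.deriv_eq]; simp
            rw [hz]; simp; positivity
          · have h2 : (k + 1) * x.2 ≤ 2 := by linarith
            calc |a' k x * ψ x| = (k + 1) * |deriv S ((k + 1) * x.2 - 1)| * |ψ x| := by
                  rw [abs_mul]; congr 1
                  change |(k + 1) * deriv S ((k + 1) * x.2 - 1)| = _
                  rw [abs_mul, abs_of_pos hk]
              _ ≤ (k + 1) * C * (M' * x.2) := by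
                  gcongr
                  · exact hC _
                  · exact hψb x hx hxK
              _ = C * M' * ((k + 1) * x.2) := by ring
              _ ≤ C * M' * 2 := by gcongr
        have h1 : |fderiv ℝ (fun x => a k x * ψ x) x e| ≤ C * M' * 2 + M' := by
          rw [hder]
          refine (abs_add_le _ _).trans (add_le_add ha2 ?_)
          rw [abs_mul]
          calc |a k x| * |fderiv ℝ ψ x e| ≤ 1 * M' :=
                mul_le_mul ha1 (hdψ x hx hxK) (abs_nonneg _) zero_le_one
            _ = M' := one_mul _
        have h2 : |a k x * ψ x| ≤ M' * b := by
          rw [abs_mul]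
          calc |a k x| * |ψ x| ≤ 1 * (M' * b) :=
                mul_le_mul ha1 ((hψb x hx hxK).trans (by gcongr; exact hx.2.le))
                  (abs_nonneg _) zero_le_one
            _ = M' * b := one_mul _
        change ‖F k x‖ ≤ Q.indicator _ x
        rw [indicator_of_mem hxQ]
        refine (norm_add_le _ _).trans ?_
        rw [norm_smul, norm_smul, Real.norm_eq_abs, Real.norm_eq_abs]
        gcongr
      · have hz : F k x = 0 := by
          change fderiv ℝ (fun x => a k x * ψ x) x e • w.1.fst x
            + (a k x * ψ x) • w.1.snd (Fin.last d) x = 0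
          rw [hder, hψK x hxK, hdψK x hxK]; simp
        rw [hz, norm_zero]
        exact indicator_nonneg (fun _ _ => by positivity) x
    · filter_upwards [ae_restrict_mem hmeas] with x hx
      refine tendsto_const_nhds.congr' ?_
      obtain ⟨N, hN⟩ := exists_nat_gt (2 / x.2)
      filter_upwards [eventually_ge_atTop N] with k hkN
      have hbig : 1 < ((k : ℝ) + 1) * x.2 - 1 := by
        rw [div_lt_iff₀ hx.1] at hN
        have : (N : ℝ) ≤ k := by exact_mod_cast hkN
        nlinarith [hx.1]
      have h1 : a k x = 1 := Real.smoothTransition.one_of_one_le hbig.le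
      have h2 : a' k x = 0 := by
        have : S =ᶠ[𝓝 ((k + 1) * x.2 - 1)] fun _ => (1 : ℝ) := by
          filter_upwards [Ioi_mem_nhds hbig] with s hs
          exact Real.smoothTransition.one_of_one_le (le_of_lt hs)
        change (k + 1) * deriv S ((k + 1) * x.2 - 1) = 0
        rw [this.deriv_eq]; simp
      change _ = fderiv ℝ (fun x => a k x * ψ x) x e • w.1.fst x
            + (a k x * ψ x) • w.1.snd (Fin.last d) x
      rw [hder, h1, h2]; simp
  simp only [hF0] at hlim
  exact (tendsto_nhds_unique hlim tendsto_const_nhds)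

theorem bottom_compact {φ : Space d → ℝ} (hc : HasCompactSupport φ) :
    HasCompactSupport fun y : Hor d => φ (y, 0) := by
  refine HasCompactSupport.of_support_subset_isCompact (IsCompact.image hc continuous_fst) ?_
  intro y hy
  exact ⟨(y, 0), subset_tsupport _ hy, rfl⟩

theorem exists_isTrace (hb : 0 < b) (w : H1 𝕜 d b) : ∃ g, IsTrace w g := by
  have hcd : Continuous (deriv (cut b)) := (cut_contDiff (b := b)).continuous_deriv (by simp)
  have hcc : Continuous (cut b) := (cut_contDiff (b := b)).continuous
  obtain ⟨C, hC⟩ := (isCompact_Icc (a := (0 : ℝ)) (b := b)).exists_bound_of_continuousOn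
    hcd.continuousOn
  have hmeas : MeasurableSet (strip d b) :=
    (measurableSet_lt measurable_const measurable_snd).inter
      (measurableSet_lt measurable_snd measurable_const)
  have m1 : MemLp (fun x : Space d => deriv (cut b) x.2 • w.1.fst x) 2 (stripMeasure d b) := by
    refine (Lp.memLp w.1.fst).of_le_mul (c := C) ?_ ?_
    · exact (hcd.comp continuous_snd).aestronglyMeasurable.smul (Lp.aestronglyMeasurable _)
    · filter_upwards [ae_restrict_mem hmeas] with x hx
      rw [norm_smul]
      gcongr
      exact hC _ ⟨hx.1.le, hx.2.le⟩
  have m2 : MemLp (fun x : Space d => cut b x.2 • w.1.snd (Fin.last d) x) 2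
      (stripMeasure d b) := by
    refine (Lp.memLp (w.1.snd (Fin.last d))).of_le_mul (c := 1) ?_ ?_
    · exact (hcc.comp continuous_snd).aestronglyMeasurable.smul (Lp.aestronglyMeasurable _)
    · refine Eventually.of_forall fun x => ?_
      rw [norm_smul]
      gcongr
      rw [Real.norm_eq_abs, cut, abs_of_nonneg (Real.smoothTransition.nonneg _)]
      exact Real.smoothTransition.le_one _
  let V : Space d → 𝕜 := fun x =>
    deriv (cut b) x.2 • w.1.fst x + cut b x.2 • w.1.snd (Fin.last d) x
  have mV : MemLp V 2 (stripMeasure d b) := m1.add m2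
  let J : BdryL2 𝕜 d →L[𝕜] L2 𝕜 d b := (lift b).mkContinuous _ norm_lift_le
  refine ⟨- ContinuousLinearMap.adjoint J (mV.toLp V), ?_⟩
  intro φ hφ hc hs
  have hφ0 : ContDiff ℝ ∞ fun y : Hor d => φ (y, 0) := hφ.comp (by fun_prop)
  have mh : MemLp (fun y : Hor d => ((φ (y, 0) : ℝ) : 𝕜)) 2 volume := by
    refine Continuous.memLp_of_hasCompactSupport (RCLike.continuous_ofReal.comp hφ0.continuous) ?_
    exact (bottom_compact hc).comp_left (g := ((↑) : ℝ → 𝕜)) (by simp)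
  -- the boundary integral as an integral over the strip
  have key : ∫ y : Hor d, φ (y, 0) • (ContinuousLinearMap.adjoint J (mV.toLp V)) y
      = ∫ x in strip d b, φ (x.1, 0) • V x := by
    have h1 : inner 𝕜 (mh.toLp _) (ContinuousLinearMap.adjoint J (mV.toLp V))
        = inner 𝕜 (J (mh.toLp _)) (mV.toLp V) := ContinuousLinearMap.adjoint_inner_right _ _ _
    rw [L2.inner_def, L2.inner_def] at h1
    have e1 : ∫ y : Hor d, φ (y, 0) • (ContinuousLinearMap.adjoint J (mV.toLp V)) y
        = ∫ y, inner 𝕜 (mh.toLp _ y) ((ContinuousLinearMap.adjoint J (mV.toLp V)) y) := by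
      refine integral_congr_ae ?_
      filter_upwards [mh.coeFn_toLp] with y hy
      rw [hy, RCLike.inner_apply, RCLike.conj_ofReal, RCLike.real_smul_eq_coe_mul, mul_comm]
    have e2 : ∫ x in strip d b, φ (x.1, 0) • V x
        = ∫ x in strip d b, inner 𝕜 (J (mh.toLp _) x) (mV.toLp V x) := by
      refine integral_congr_ae ?_
      filter_upwards [mV.coeFn_toLp, (memLp_lift (b := b) (mh.toLp _)).coeFn_toLp,
        lift_ae (b := b) mh.coeFn_toLp] with x hx1 hx2 hx3
      have hx4 : J (mh.toLp _) x = ((φ (x.1, 0) : ℝ) : 𝕜) := hx2.trans hx3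
      rw [hx1, hx4, RCLike.inner_apply, RCLike.conj_ofReal, RCLike.real_smul_eq_coe_mul, mul_comm]
    rw [e1, e2, h1]
  have hneg : ∫ y : Hor d, φ (y, 0) • (- ContinuousLinearMap.adjoint J (mV.toLp V) : BdryL2 𝕜 d) y
      = - ∫ y : Hor d, φ (y, 0) • (ContinuousLinearMap.adjoint J (mV.toLp V)) y := by
    rw [← integral_neg]
    refine integral_congr_ae ?_
    filter_upwards [Lp.coeFn_neg (ContinuousLinearMap.adjoint J (mV.toLp V))] with y hy
    rw [hy, Pi.neg_apply, smul_neg]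
  rw [hneg, neg_neg, key]
  -- the difference is an integral to which vertical integration by parts applies
  let ψ : Space d → ℝ := fun x => φ x - cut b x.2 * φ (x.1, 0)
  have hφ1 : ContDiff ℝ ∞ fun x : Space d => φ (x.1, 0) := hφ.comp (by fun_prop)
  have hψ : ContDiff ℝ ∞ ψ := hφ.sub ((cut_contDiff.comp contDiff_snd).mul hφ1)
  have hK : IsCompact (Prod.fst '' tsupport φ) := IsCompact.image hc continuous_fst
  have hout : ∀ y : Hor d, y ∉ Prod.fst '' tsupport φ → ∀ t, φ (y, t) = 0 := fun y hy t =>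
    image_eq_zero_of_notMem_tsupport fun h => hy ⟨(y, t), h, rfl⟩
  obtain ⟨c, hcb, hcφ⟩ : ∃ c < b, ∀ x : Space d, c < x.2 → φ x = 0 := by
    rcases (tsupport φ).eq_empty_or_nonempty with hE | hne
    · exact ⟨0, hb, fun x _ => image_eq_zero_of_notMem_tsupport (by simp [hE])⟩
    · obtain ⟨z, hz, hmax⟩ := IsCompact.exists_isMaxOn hc hne continuous_snd.continuousOn
      exact ⟨z.2, hs hz, fun x hx => image_eq_zero_of_notMem_tsupport fun h =>
        absurd hx (not_lt.2 (hmax h))⟩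
  have hzero := integral_vertical_eq_zero hb w hψ (by intro y; simp [ψ, cut_zero]) hK
    (by
      intro x hx
      have h1 := hout x.1 hx x.2
      have h2 := hout x.1 hx 0
      simp only [ψ]
      rw [h2, show φ x = 0 from h1]; simp)
    (c := max c (2 * b / 3)) (max_lt hcb (by linarith))
    (by
      intro x hx
      simp only [ψ]
      rw [hcφ x ((le_max_left _ _).trans_lt hx),
        cut_eq_zero hb ((le_max_right _ _).trans hx.le)]; simp)
  have hder : ∀ x : Space d, fderiv ℝ ψ x (basisVec d (Fin.last d))
      = fderiv ℝ φ x (basisVec d (Fin.last d)) - deriv (cut b) x.2 * φ (x.1, 0) := by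
    rintro ⟨y, t⟩
    have h1 := vertical_hasDerivAt hψ y t
    have h2 : HasDerivAt (cut b) (deriv (cut b) t) t :=
      ((cut_contDiff.differentiable (by simp)) t).hasDerivAt
    exact h1.unique ((vertical_hasDerivAt hφ y t).sub (h2.mul_const (φ (y, 0))))
  have i1 : Integrable (fun x => fderiv ℝ φ x (basisVec d (Fin.last d)) • w.1.fst x
      + φ x • w.1.snd (Fin.last d) x) (stripMeasure d b) :=
    (integrable_smul_L2 w.1.fst (continuous_partial hφ _) (compact_partial hc _)).add
      (integrable_smul_L2 (w.1.snd (Fin.last d)) hφ.continuous hc)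
  have i2 : Integrable (fun x => φ (x.1, 0) • V x) (stripMeasure d b) := by
    have m3 := memLp_lift (b := b) (mh.toLp _)
    have := m3.integrable_mul mV
    refine this.congr ?_
    filter_upwards [lift_ae (b := b) mh.coeFn_toLp] with x hx
    rw [Pi.mul_apply, hx, RCLike.real_smul_eq_coe_mul]
  rw [← sub_eq_zero, ← integral_sub i1 i2, ← hzero]
  refine integral_congr_ae (Eventually.of_forall fun x => ?_)
  simp only [hder, ψ, V, RCLike.real_smul_eq_coe_mul, RCLike.ofReal_sub, RCLike.ofReal_mul]
  ring

theorem IsTrace.unique (hb : 0 < b) {w : H1 𝕜 d b} {g h : BdryL2 𝕜 d} (hg : IsTrace w g)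
    (hh : IsTrace w h) : g = h := by
  refine Lp.ext ?_
  refine ae_eq_of_integral_contDiff_smul_eq ((Lp.memLp g).locallyIntegrable (by norm_num))
    ((Lp.memLp h).locallyIntegrable (by norm_num)) ?_
  intro η hη hηc
  let χ : ContDiffBump (0 : ℝ) := ⟨b / 3, b / 2, by positivity, by linarith⟩
  let φ : Space d → ℝ := fun x => η x.1 * χ x.2
  have hφ : ContDiff ℝ ∞ φ := (hη.comp contDiff_fst).mul (χ.contDiff.comp contDiff_snd)
  have hsub : tsupport φ ⊆ tsupport η ×ˢ Metric.closedBall 0 (b / 2) := by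
    refine closure_minimal ?_ ((isClosed_tsupport _).prod Metric.isClosed_closedBall)
    intro x hx
    refine ⟨subset_tsupport _ (left_ne_zero_of_mul hx), ?_⟩
    have : x.2 ∈ Function.support χ := right_ne_zero_of_mul hx
    rw [χ.support_eq] at this
    exact Metric.ball_subset_closedBall this
  have hφc : HasCompactSupport φ :=
    (IsCompact.prod hηc (isCompact_closedBall 0 (b / 2))).of_isClosed_subset
      (isClosed_tsupport _) hsub
  have hφs : tsupport φ ⊆ {x | x.2 < b} := by
    intro x hx
    have := (hsub hx).2
    rw [mem_closedBall_zero_iff, Real.norm_eq_abs, abs_le] at this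
    change x.2 < b
    linarith [this.2]
  have hφ0 : ∀ y : Hor d, φ (y, 0) = η y := fun y => by
    have : χ (0 : ℝ) = 1 := χ.one_of_mem_closedBall (Metric.mem_closedBall_self χ.rIn_pos.le)
    simp [φ, this]
  have e := (hg φ hφ hφc hφs).symm.trans (hh φ hφ hφc hφs)
  simpa only [hφ0, neg_inj] using e

end

/-- The trace `w|_{Σ₀} ∈ L²(Σ₀)` of `w ∈ H¹(Ω)`. -/
noncomputable def trace {𝕜 : Type*} [RCLike 𝕜] {d : ℕ} {b : ℝ} (hb : 0 < b) (w : H1 𝕜 d b) :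
    BdryL2 𝕜 d :=
  (exists_isTrace hb w).choose

section

variable {𝕜 : Type*} [RCLike 𝕜] {d : ℕ} {b : ℝ}

theorem trace_spec (hb : 0 < b) (w : H1 𝕜 d b) : IsTrace w (trace hb w) :=
  (exists_isTrace hb w).choose_spec

theorem trace_add (hb : 0 < b) (v w : H1 𝕜 d b) :
    trace hb (v + w) = trace hb v + trace hb w := by
  refine (trace_spec hb (v + w)).unique hb ?_
  intro φ hφ hc hs
  have i : ∀ w : H1 𝕜 d b, Integrable (fun x => fderiv ℝ φ x (basisVec d (Fin.last d)) • w.1.fst x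
      + φ x • w.1.snd (Fin.last d) x) (stripMeasure d b) := fun w =>
    (integrable_smul_L2 w.1.fst (continuous_partial hφ _) (compact_partial hc _)).add
      (integrable_smul_L2 (w.1.snd (Fin.last d)) hφ.continuous hc)
  have hφ0 : Continuous fun y : Hor d => φ (y, 0) := hφ.continuous.comp (by fun_prop)
  have j : ∀ g : BdryL2 𝕜 d, Integrable (fun y : Hor d => φ (y, 0) • g y) volume := fun g =>
    ((Lp.memLp g).locallyIntegrable (by norm_num)).integrable_smul_left_of_hasCompactSupport
      hφ0 (bottom_compact hc)
  have e1 : ∫ y : Hor d, φ (y, 0) • (trace hb v + trace hb w : BdryL2 𝕜 d) y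
      = (∫ y : Hor d, φ (y, 0) • trace hb v y) + ∫ y : Hor d, φ (y, 0) • trace hb w y := by
    rw [← integral_add (j _) (j _)]
    refine integral_congr_ae ?_
    filter_upwards [Lp.coeFn_add (trace hb v) (trace hb w)] with y hy
    rw [hy, Pi.add_apply, smul_add]
  rw [e1, neg_add, ← trace_spec hb v φ hφ hc hs, ← trace_spec hb w φ hφ hc hs,
    ← integral_add (i v) (i w)]
  refine integral_congr_ae ?_
  filter_upwards [Lp.coeFn_add v.1.fst w.1.fst,
    Lp.coeFn_add (v.1.snd (Fin.last d)) (w.1.snd (Fin.last d))] with x h1 h2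
  change fderiv ℝ φ x (basisVec d (Fin.last d)) • (v.1.fst + w.1.fst : L2 𝕜 d b) x
    + φ x • (v.1.snd (Fin.last d) + w.1.snd (Fin.last d) : L2 𝕜 d b) x = _
  rw [h1, h2, Pi.add_apply, Pi.add_apply, smul_add, smul_add]
  abel

theorem trace_smul (hb : 0 < b) (c : 𝕜) (w : H1 𝕜 d b) :
    trace hb (c • w) = c • trace hb w := by
  refine (trace_spec hb (c • w)).unique hb ?_
  intro φ hφ hc hs
  have e1 : ∫ y : Hor d, φ (y, 0) • (c • trace hb w : BdryL2 𝕜 d) y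
      = c * ∫ y : Hor d, φ (y, 0) • trace hb w y := by
    rw [← integral_const_mul]
    refine integral_congr_ae ?_
    filter_upwards [Lp.coeFn_smul c (trace hb w)] with y hy
    rw [hy, Pi.smul_apply, smul_eq_mul, mul_smul_comm]
  rw [e1, ← mul_neg, ← trace_spec hb w φ hφ hc hs, ← integral_const_mul]
  refine integral_congr_ae ?_
  filter_upwards [Lp.coeFn_smul c w.1.fst, Lp.coeFn_smul c (w.1.snd (Fin.last d))] with x h1 h2
  change fderiv ℝ φ x (basisVec d (Fin.last d)) • (c • w.1.fst : L2 𝕜 d b) x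
    + φ x • (c • w.1.snd (Fin.last d) : L2 𝕜 d b) x = _
  rw [h1, h2, Pi.smul_apply, Pi.smul_apply, smul_eq_mul, smul_eq_mul]
  simp only [RCLike.real_smul_eq_coe_mul]
  ring

end

/-- `H¹(Ω; 𝕜ⁿ)`, with the norm `‖u‖² = ∑ᵢ ‖uᵢ‖²_{H¹}`. -/
abbrev VecH1 (𝕜 : Type*) [RCLike 𝕜] (d : ℕ) (b : ℝ) : Type _ :=
  PiLp 2 (fun _ : Fin (d + 1) => H1 𝕜 d b)

/-- The space `{u ∈ H¹(Ω; 𝕜ⁿ) : uₙ = 0 on Σ₀}`, with the `H¹` norm. -/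
noncomputable def TanH1 (𝕜 : Type*) [RCLike 𝕜] (d : ℕ) {b : ℝ} (hb : 0 < b) :
    Submodule 𝕜 (VecH1 𝕜 d b) where
  carrier := {u | trace hb (u (Fin.last d)) = 0}
  zero_mem' := by
    have := trace_smul hb (0 : 𝕜) (0 : H1 𝕜 d b)
    rw [zero_smul, zero_smul] at this
    exact this
  add_mem' := by
    intro u v hu hv
    change trace hb (u (Fin.last d) + v (Fin.last d)) = 0
    rw [trace_add, show trace hb (u (Fin.last d)) = 0 from hu,
      show trace hb (v (Fin.last d)) = 0 from hv, add_zero]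
  smul_mem' := by
    intro c u hu
    change trace hb (c • u (Fin.last d)) = 0
    rw [trace_smul, show trace hb (u (Fin.last d)) = 0 from hu, smul_zero]

section

variable {𝕜 : Type*} [RCLike 𝕜] {d : ℕ} {b : ℝ}

/-- The component `uᵢ ∈ L²(Ω)`. -/
noncomputable def component (u : VecH1 𝕜 d b) (i : Fin (d + 1)) : L2 𝕜 d b := (u i).1.fst

/-- The weak derivative `∂ⱼ uᵢ ∈ L²(Ω)`. -/
noncomputable def partialDeriv (j : Fin (d + 1)) (u : VecH1 𝕜 d b) (i : Fin (d + 1)) : L2 𝕜 d b :=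
  (u i).1.snd j

/-- The divergence `div u = ∑ᵢ ∂ᵢ uᵢ`. -/
noncomputable def divergence (u : VecH1 𝕜 d b) : L2 𝕜 d b := ∑ i, partialDeriv i u i

/-- The entries of the symmetrized gradient `𝔻u = ∇u + (∇u)ᵀ`. -/
noncomputable def symGrad (u : VecH1 𝕜 d b) (i j : Fin (d + 1)) : L2 𝕜 d b :=
  partialDeriv j u i + partialDeriv i u j

/-- The weak form of the `γ`-Stokes operator with slip boundary condition,
`⟨𝔏(u, p), v⟩ = ∫_Ω (μ/2 𝔻u : 𝔻v̄ - p div v̄ - γ ∂₁u · v̄) + (1/α) ∫_{Σ₀} βu · v̄`. -/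
noncomputable def weakStokes (hb : 0 < b) (μ α γ : ℝ) (β : Matrix (Fin (d + 1)) (Fin (d + 1)) ℝ)
    (u : VecH1 𝕜 d b) (p : L2 𝕜 d b) (v : VecH1 𝕜 d b) : 𝕜 :=
  (∫ x in strip d b,
    (((μ / 2 : ℝ) : 𝕜) * ∑ i, ∑ j, symGrad u i j x * conj (symGrad v i j x)
      - p x * conj (divergence v x)
      - (γ : 𝕜) * ∑ i, partialDeriv 0 u i x * conj (component v i x)))
  + ((1 / α : ℝ) : 𝕜) * ∫ y : Hor d,
      ∑ i, (∑ j, (β i j : 𝕜) * trace hb (u j) y) * conj (trace hb (v i) y)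

end

end SlipStokes

/-! After Riesz representation the map is the saddle point operator `(u, p) ↦ (A u - B* p, B u)` on
the Hilbert space of tangential fields times `L²(Ω)`, where `A` represents the form without pressure
and `B` is the divergence. If `Re⟨u, A u⟩ ≥ c‖u‖²` and `B` is onto, then the Schur complement `B A⁻¹
B*` is coercive too, and elimination of `u` solves the system uniquely (`bijective_saddle`); the
open mapping theorem bounds the inverse. So two facts are needed: coercivity
(`exists_coercive_stokes`) and surjectivity of the divergence (`exists_divergence_eq`).

Coercivity. The `γ` term has vanishing real part, because `∂₁` is horizontal and hence skew on `H¹`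
of the strip. The boundary term dominates the traces, since `β` is real and positive definite. What
remains is Korn's inequality (`korn`). Among horizontal indices, `∫ ∂ⱼuᵢ ∂ᵢuⱼ = ∫ ∂ᵢuᵢ ∂ⱼuⱼ` makes
the mixed terms sum to `‖∑ᵢ ∂ᵢuᵢ‖² ≥ 0` (`korn_horizontal`). The entry `∂ₙuₙ` is half a diagonal
entry of `𝔻u`. For the pair `∂ₙuᵢ`, `∂ᵢuₙ` only the sum is controlled, and the integral of the
product has to be estimated by exchanging derivatives. The weight `b - t` removes the boundary term
on top, and `uₙ = 0` the one at the bottom (`korn_bottom`). The weight `t` removes the bottom; on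
top no condition is available, so the field is compared with Nitsche's extension across the top,
folded back to the strip by `t ↦ (b + t) / 2` (`korn_top`). The two weights add up to `b`. Function
values follow from a Poincaré inequality involving the trace (`Vert.norm_le`).

Surjectivity. Given `f`, solve `Δw = f` with `∂ₙw = 0` on `Σ₀` and `w = 0` on top, and take `u =
∇w`. Horizontal difference quotients give all second derivatives but `∂ₙ∂ₙw`, which the equation
supplies; the natural boundary condition is exactly tangentiality of `u`.

Second derivatives of `H¹` functions do not exist, so every exchange of derivatives passes through
horizontal difference quotients. Green's formulas are proved for test functions and extended by
closure: `vert_mem` places `(w, ∂ₙw, w|_{Σ₀})` in the closure of the corresponding triples of test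
functions, without mollification. -/

namespace SlipStokes

/-! ### Test functions and their pairings with `L²`. -/

/-- Real test functions on `ℝⁿ`: smooth functions with compact support. -/
structure TestFn (d : ℕ) where
  toFun : Space d → ℝ
  contDiff : ContDiff ℝ ∞ toFun
  compact : HasCompactSupport toFun

namespace TestFn

variable {d : ℕ}

instance : CoeFun (TestFn d) (fun _ => Space d → ℝ) := ⟨TestFn.toFun⟩

theorem continuous (φ : TestFn d) : Continuous φ := φ.contDiff.continuous

theorem hasFDerivAt (φ : TestFn d) (x : Space d) : HasFDerivAt φ (fderiv ℝ φ x) x :=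
  ((φ.contDiff.differentiable (by simp)) x).hasFDerivAt

/-- The directional derivative of a test function. -/
noncomputable def dirDeriv (φ : TestFn d) (v : Space d) : TestFn d where
  toFun x := fderiv ℝ φ x v
  contDiff := (φ.contDiff.fderiv_right (m := ∞) (by simp)).clm_apply contDiff_const
  compact := compact_partial φ.compact v

/-- The partial derivative of a test function. -/
noncomputable def partialD (φ : TestFn d) (i : Fin (d + 1)) : TestFn d := φ.dirDeriv (basisVec d i)

/-- The translate of a test function. -/
def shift (φ : TestFn d) (v : Space d) : TestFn d where
  toFun x := φ (x + v)
  contDiff := φ.contDiff.comp (by fun_prop)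
  compact := φ.compact.comp_homeomorph (Homeomorph.addRight v)

/-- The product of two test functions. -/
def mul (φ ψ : TestFn d) : TestFn d where
  toFun x := φ x * ψ x
  contDiff := φ.contDiff.mul ψ.contDiff
  compact := φ.compact.mul_right

/-- The product of a test function with the vertical coordinate. -/
def vmul (φ : TestFn d) : TestFn d where
  toFun x := x.2 * φ x
  contDiff := contDiff_snd.mul φ.contDiff
  compact := φ.compact.mul_left

/-- The homeomorphism `(x', t) ↦ (x', (b + t) / 2)`. -/
noncomputable def dilation (d : ℕ) (b : ℝ) : Space d ≃ₜ Space d where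
  toFun x := (x.1, (b + x.2) / 2)
  invFun x := (x.1, 2 * x.2 - b)
  left_inv x := by ext <;> simp; ring
  right_inv x := by ext <;> simp
  continuous_toFun := by fun_prop
  continuous_invFun := by fun_prop

/-- The composition of a test function with `(x', t) ↦ (x', (b + t) / 2)`. -/
noncomputable def dilate (φ : TestFn d) (b : ℝ) : TestFn d where
  toFun x := φ (dilation d b x)
  contDiff := φ.contDiff.comp (by change ContDiff ℝ ∞ fun x : Space d => (x.1, (b + x.2) / 2); fun_prop)
  compact := φ.compact.comp_homeomorph (dilation d b)

theorem shift_zero (φ : TestFn d) : φ.shift 0 = φ := by cases φ; simp [shift]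

theorem partialD_shift (φ : TestFn d) (v : Space d) (i : Fin (d + 1)) :
    (φ.shift v).partialD i = (φ.partialD i).shift v := by
  have : ∀ x, fderiv ℝ (φ.shift v) x = fderiv ℝ φ (x + v) := fun x => fderiv_comp_add_right v
  simp only [partialD, dirDeriv, this]; rfl

theorem tsupport_shift (φ : TestFn d) (v : Space d) :
    tsupport (φ.shift v) = {x | x + v ∈ tsupport φ} := by
  have := tsupport_comp_eq_preimage φ (Homeomorph.addRight v)
  exact this

theorem tsupport_dirDeriv_subset (φ : TestFn d) (v : Space d) :
    tsupport (φ.dirDeriv v) ⊆ tsupport φ := by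
  refine (closure_mono ?_).trans (tsupport_fderiv_subset ℝ)
  intro x hx h
  exact hx (by simp [dirDeriv, h])

variable {𝕜 : Type*} [RCLike 𝕜] {b : ℝ}

theorem memLp (φ : TestFn d) (b : ℝ) : MemLp (fun x => (φ x : 𝕜)) 2 (stripMeasure d b) :=
  Continuous.memLp_of_hasCompactSupport (RCLike.continuous_ofReal.comp φ.continuous)
    (φ.compact.comp_left (g := ((↑) : ℝ → 𝕜)) (by simp))

theorem memLp_bdry (φ : TestFn d) : MemLp (fun y : Hor d => (φ (y, 0) : 𝕜)) 2 volume :=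
  Continuous.memLp_of_hasCompactSupport
    (RCLike.continuous_ofReal.comp (φ.continuous.comp (by fun_prop)))
    ((bottom_compact φ.compact).comp_left (g := ((↑) : ℝ → 𝕜)) (by simp))

variable (𝕜 b) in
/-- The class of a test function in `L²(Ω)`. -/
noncomputable def toL2 (φ : TestFn d) : L2 𝕜 d b := (φ.memLp b).toLp _

variable (𝕜) in
/-- The restriction of a test function to `Σ₀`. -/
noncomputable def bdry (φ : TestFn d) : BdryL2 𝕜 d := φ.memLp_bdry.toLp _

theorem coeFn_toL2 (φ : TestFn d) : φ.toL2 𝕜 b =ᵐ[stripMeasure d b] fun x => (φ x : 𝕜) :=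
  MemLp.coeFn_toLp _

theorem coeFn_bdry (φ : TestFn d) : φ.bdry 𝕜 =ᵐ[volume] fun y => (φ (y, 0) : 𝕜) :=
  MemLp.coeFn_toLp _

theorem inner_toL2 (φ : TestFn d) (f : L2 𝕜 d b) :
    inner 𝕜 (φ.toL2 𝕜 b) f = ∫ x in strip d b, φ x • f x := by
  rw [L2.inner_def]
  refine integral_congr_ae ?_
  filter_upwards [φ.coeFn_toL2 (𝕜 := 𝕜) (b := b)] with x hx
  rw [hx, RCLike.inner_apply, RCLike.conj_ofReal, RCLike.real_smul_eq_coe_mul, mul_comm]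

theorem inner_bdry (φ : TestFn d) (g : BdryL2 𝕜 d) :
    inner 𝕜 (φ.bdry 𝕜) g = ∫ y : Hor d, φ (y, 0) • g y := by
  rw [L2.inner_def]
  refine integral_congr_ae ?_
  filter_upwards [φ.coeFn_bdry (𝕜 := 𝕜)] with x hx
  rw [hx, RCLike.inner_apply, RCLike.conj_ofReal, RCLike.real_smul_eq_coe_mul, mul_comm]

theorem inner_toL2_toL2 (φ ψ : TestFn d) :
    inner 𝕜 (φ.toL2 𝕜 b) (ψ.toL2 𝕜 b) = ((∫ x in strip d b, φ x * ψ x : ℝ) : 𝕜) := by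
  rw [inner_toL2, ← integral_ofReal]
  refine integral_congr_ae ?_
  filter_upwards [ψ.coeFn_toL2 (𝕜 := 𝕜) (b := b)] with x hx
  rw [hx, RCLike.real_smul_eq_coe_mul, RCLike.ofReal_mul]

theorem inner_bdry_bdry (φ ψ : TestFn d) :
    inner 𝕜 (φ.bdry 𝕜) (ψ.bdry 𝕜) = ((∫ y : Hor d, φ (y, 0) * ψ (y, 0) : ℝ) : 𝕜) := by
  rw [inner_bdry, ← integral_ofReal]
  refine integral_congr_ae ?_
  filter_upwards [ψ.coeFn_bdry (𝕜 := 𝕜)] with x hx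
  rw [hx, RCLike.real_smul_eq_coe_mul, RCLike.ofReal_mul]

end TestFn

/-! ### Weak derivatives and traces as conditions on inner products. -/

section

variable {𝕜 : Type*} [RCLike 𝕜] {d : ℕ} {b : ℝ}

theorem isOpen_strip : IsOpen (strip d b) :=
  (isOpen_lt continuous_const continuous_snd).inter (isOpen_lt continuous_snd continuous_const)

theorem measurableSet_strip : MeasurableSet (strip d b) := isOpen_strip.measurableSet

/-- Test functions are real, so the conjugation in the inner product is harmless. In this form the
condition is visibly closed in `(f, g)`, and adjoints of operators on `L²(Ω)` can be applied to it.
-/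
theorem isWeakPartial_iff {i : Fin (d + 1)} {f g : L2 𝕜 d b} :
    IsWeakPartial d b i f g ↔ ∀ φ : TestFn d, tsupport φ ⊆ strip d b →
      inner 𝕜 ((φ.partialD i).toL2 𝕜 b) f = - inner 𝕜 (φ.toL2 𝕜 b) g := by
  constructor
  · intro h φ hs
    rw [TestFn.inner_toL2, TestFn.inner_toL2]
    exact h φ φ.contDiff φ.compact hs
  · intro h φ hφ hc hs
    have := h ⟨φ, hφ, hc⟩ hs
    rwa [TestFn.inner_toL2, TestFn.inner_toL2] at this

theorem isTrace_iff {w : H1 𝕜 d b} {g : BdryL2 𝕜 d} :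
    IsTrace w g ↔ ∀ φ : TestFn d, tsupport φ ⊆ {x | x.2 < b} →
      inner 𝕜 ((φ.partialD (Fin.last d)).toL2 𝕜 b) w.1.fst
        + inner 𝕜 (φ.toL2 𝕜 b) (w.1.snd (Fin.last d)) = - inner 𝕜 (φ.bdry 𝕜) g := by
  have key : ∀ φ : TestFn d, inner 𝕜 ((φ.partialD (Fin.last d)).toL2 𝕜 b) w.1.fst
        + inner 𝕜 (φ.toL2 𝕜 b) (w.1.snd (Fin.last d))
      = ∫ x in strip d b, (fderiv ℝ φ x (basisVec d (Fin.last d)) • w.1.fst x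
        + φ x • w.1.snd (Fin.last d) x) := by
    intro φ
    rw [TestFn.inner_toL2, TestFn.inner_toL2, ← integral_add]
    · rfl
    · exact integrable_smul_L2 _ (φ.partialD _).continuous (φ.partialD _).compact
    · exact integrable_smul_L2 _ φ.continuous φ.compact
  constructor
  · intro h φ hs
    rw [key, TestFn.inner_bdry]
    exact h φ φ.contDiff φ.compact hs
  · intro h φ hφ hc hs
    have := h ⟨φ, hφ, hc⟩ hs
    rwa [key, TestFn.inner_bdry] at this

theorem eq_zero_of_inner_test {f : L2 𝕜 d b}
    (h : ∀ φ : TestFn d, tsupport φ ⊆ strip d b → inner 𝕜 (φ.toL2 𝕜 b) f = 0) : f = 0 := by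
  have h1 := isOpen_strip.ae_eq_zero_of_integral_contDiff_smul_eq_zero (f := f)
    (μ := stripMeasure d b) (U := strip d b)
    (((Lp.memLp f).locallyIntegrable (by norm_num)).locallyIntegrableOn _)
    (fun φ hφ hc hs => by
      have := h ⟨φ, hφ, hc⟩ hs
      rwa [TestFn.inner_toL2] at this)
  refine Lp.ext ?_
  filter_upwards [h1, ae_restrict_mem measurableSet_strip, Lp.coeFn_zero 𝕜 2 (stripMeasure d b)]
    with x hx hs h0
  rw [hx hs, h0]; rfl

/-- The derivative of the pairing of a translated test function with an element of `L²(Ω)`. -/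
theorem hasDerivAt_inner_shift (φ : TestFn d) (v : Space d) (f : L2 𝕜 d b) (s₀ : ℝ) :
    HasDerivAt (fun s : ℝ => inner 𝕜 ((φ.shift (s • v)).toL2 𝕜 b) f)
      (inner 𝕜 (((φ.dirDeriv v).shift (s₀ • v)).toL2 𝕜 b) f) s₀ := by
  simp only [TestFn.inner_toL2]
  obtain ⟨C, hC⟩ := (φ.dirDeriv v).continuous.bounded_above_of_compact_support (φ.dirDeriv v).compact
  -- A single compact set containing the supports of all translates with `|s - s₀| ≤ 1`; on it `f`
  -- is integrable, which yields the dominating function.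
  set Kf : Set (Space d) := (fun p : Space d × ℝ => p.1 - p.2 • v) ''
    (tsupport (φ.dirDeriv v) ×ˢ Metric.closedBall s₀ 1) with hKf
  have hK : IsCompact Kf :=
    ((φ.dirDeriv v).compact.prod (isCompact_closedBall s₀ 1)).image (by fun_prop)
  refine (hasDerivAt_integral_of_dominated_loc_of_deriv_le (μ := stripMeasure d b)
    (F := fun (s : ℝ) x => (φ.shift (s • v)) x • f x)
    (F' := fun (s : ℝ) x => ((φ.dirDeriv v).shift (s • v)) x • f x)
    (bound := Kf.indicator fun x => C * ‖f x‖)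
    (Metric.ball_mem_nhds s₀ one_pos) ?_ ?_ ?_ ?_ ?_ ?_).2
  · exact Eventually.of_forall fun s =>
      (integrable_smul_L2 f (φ.shift _).continuous (φ.shift _).compact).aestronglyMeasurable
  · exact integrable_smul_L2 f (φ.shift _).continuous (φ.shift _).compact
  · exact (integrable_smul_L2 f ((φ.dirDeriv v).shift _).continuous
      ((φ.dirDeriv v).shift _).compact).aestronglyMeasurable
  · refine Eventually.of_forall fun x s hs => ?_
    by_cases hx : x ∈ Kf
    · rw [indicator_of_mem hx, norm_smul]
      gcongr
      exact hC _
    · have : ((φ.dirDeriv v).shift (s • v)) x = 0 := by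
        refine image_eq_zero_of_notMem_tsupport fun h => hx ?_
        rw [TestFn.tsupport_shift] at h
        exact ⟨(x + s • v, s), ⟨h, Metric.ball_subset_closedBall hs⟩, by simp⟩
      rw [this, zero_smul, norm_zero, indicator_of_notMem hx]
  · rw [integrable_indicator_iff hK.measurableSet]
    have := ((Lp.memLp f).locallyIntegrable (by norm_num)).integrableOn_isCompact hK
    exact this.norm.const_mul C
  · refine Eventually.of_forall fun x s _ => ?_
    have h1 := φ.hasFDerivAt (x + s • v)
    have h2 : HasDerivAt (fun s : ℝ => x + s • v) v s := by
      simpa using ((hasDerivAt_id s).smul_const v).const_add x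
    exact (h1.comp_hasDerivAt s h2).smul_const (f x)

/-- The fundamental theorem of calculus in the vertical direction. -/
theorem integral_partialD_last (hb : 0 < b) (φ : TestFn d) :
    ∫ x in strip d b, φ.partialD (Fin.last d) x
      = (∫ y : Hor d, φ (y, b)) - ∫ y : Hor d, φ (y, 0) := by
  have hi : Integrable (φ.partialD (Fin.last d)) :=
    (φ.partialD _).continuous.integrable_of_hasCompactSupport (φ.partialD _).compact
  have hs : strip d b = univ ×ˢ Ioo 0 b := by ext x; simp [strip]
  have hj : ∀ t : ℝ, Integrable fun y : Hor d => φ (y, t) := by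
    intro t
    refine (φ.continuous.comp (by fun_prop)).integrable_of_hasCompactSupport ?_
    refine HasCompactSupport.of_support_subset_isCompact (IsCompact.image φ.compact continuous_fst) ?_
    intro y hy
    exact ⟨(y, t), subset_tsupport _ hy, rfl⟩
  rw [hs, Measure.volume_eq_prod, setIntegral_prod _ (by
    rw [← Measure.volume_eq_prod]; exact hi.integrableOn), Measure.restrict_univ,
    ← integral_sub (hj _) (hj _)]
  refine integral_congr_ae (Eventually.of_forall fun y => ?_)
  simp only
  rw [← integral_Ioc_eq_integral_Ioo, ← intervalIntegral.integral_of_le hb.le]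
  refine intervalIntegral.integral_eq_sub_of_hasDerivAt
    (fun t _ => vertical_hasDerivAt φ.contDiff y t) ?_
  exact ((φ.partialD (Fin.last d)).continuous.comp
    (by fun_prop : Continuous fun t : ℝ => ((y, t) : Space d))).intervalIntegrable _ _

end


/-! ### Operators on `L²(Ω)`: translation, vertical multiplication, dilation; Green's formulas for
test functions. -/

section

variable {𝕜 : Type*} [RCLike 𝕜] {d : ℕ} {b : ℝ}

instance instIsAddHaarMeasureSpace : (volume : Measure (Space d)).IsAddHaarMeasure := by
  rw [Measure.volume_eq_prod]; infer_instance

/-! ### Horizontal translations -/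

theorem measurePreserving_hshift (v : Hor d) :
    MeasurePreserving (fun x : Space d => x + (v, 0)) (stripMeasure d b) (stripMeasure d b) := by
  have h := (measurePreserving_add_right (volume : Measure (Space d)) (v, 0)).restrict_preimage
    (measurableSet_strip (d := d) (b := b))
  have e : (fun x : Space d => x + (v, 0)) ⁻¹' strip d b = strip d b := by
    ext x; simp [strip]
  rwa [e] at h

variable (𝕜 b) in
/-- The horizontal translation `f ↦ f(· + (v, 0))` on `L²(Ω)`. -/
noncomputable def hshift (v : Hor d) : L2 𝕜 d b →ₗᵢ[𝕜] L2 𝕜 d b :=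
  Lp.compMeasurePreservingₗᵢ 𝕜 _ (measurePreserving_hshift v)

theorem coeFn_hshift (v : Hor d) (f : L2 𝕜 d b) :
    hshift 𝕜 b v f =ᵐ[stripMeasure d b] fun x => f (x + (v, 0)) :=
  Lp.coeFn_compMeasurePreserving f (measurePreserving_hshift v)

theorem hshift_hshift (v w : Hor d) (f : L2 𝕜 d b) :
    hshift 𝕜 b v (hshift 𝕜 b w f) = hshift 𝕜 b (v + w) f := by
  refine Lp.ext ?_
  filter_upwards [coeFn_hshift v (hshift 𝕜 b w f), coeFn_hshift (v + w) f,
    (measurePreserving_hshift (b := b) v).quasiMeasurePreserving.ae (coeFn_hshift w f)]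
    with x h1 h2 h3
  have e : x + (v, 0) + (w, 0) = x + ((v + w, 0) : Space d) := by
    ext <;> simp [add_assoc]
  rw [h1, h2, h3, e]

theorem hshift_zero (f : L2 𝕜 d b) : hshift 𝕜 b 0 f = f := by
  refine Lp.ext ?_
  filter_upwards [coeFn_hshift 0 f] with x h1
  have e : x + ((0, 0) : Space d) = x := add_zero x
  rw [h1, e]

theorem inner_hshift_left (v : Hor d) (f g : L2 𝕜 d b) :
    inner 𝕜 (hshift 𝕜 b v f) g = inner 𝕜 f (hshift 𝕜 b (-v) g) := by
  have : g = hshift 𝕜 b v (hshift 𝕜 b (-v) g) := by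
    rw [hshift_hshift, add_neg_cancel, hshift_zero]
  rw [this, LinearIsometry.inner_map_map, hshift_hshift, neg_add_cancel, hshift_zero]

theorem hshift_toL2 (v : Hor d) (φ : TestFn d) :
    hshift 𝕜 b v (φ.toL2 𝕜 b) = (φ.shift (v, 0)).toL2 𝕜 b := by
  refine Lp.ext ?_
  filter_upwards [coeFn_hshift v (φ.toL2 𝕜 b), (φ.shift (v, 0)).coeFn_toL2 (𝕜 := 𝕜) (b := b),
    (measurePreserving_hshift (b := b) v).quasiMeasurePreserving.ae
      (φ.coeFn_toL2 (𝕜 := 𝕜) (b := b))] with x h1 h2 h3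
  rw [h1, h2, h3]; rfl

/-! ### Multiplication by the vertical coordinate -/

theorem abs_snd_le {x : Space d} (hx : x ∈ strip d b) : |x.2| ≤ |b| := by
  rw [abs_of_pos hx.1]; exact hx.2.le.trans (le_abs_self b)

theorem memLp_vmul (f : L2 𝕜 d b) :
    MemLp (fun x : Space d => (x.2 : 𝕜) * f x) 2 (stripMeasure d b) := by
  refine (Lp.memLp f).of_le_mul (c := |b|) ?_ ?_
  · exact (RCLike.continuous_ofReal.comp continuous_snd).aestronglyMeasurable.mul
      (Lp.aestronglyMeasurable _)
  · filter_upwards [ae_restrict_mem measurableSet_strip] with x hx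
    rw [norm_mul, RCLike.norm_ofReal]
    exact mul_le_mul_of_nonneg_right (abs_snd_le hx) (norm_nonneg _)

variable (𝕜 d b) in
/-- Multiplication by the vertical coordinate on `L²(Ω)`. -/
noncomputable def vmulL : L2 𝕜 d b →L[𝕜] L2 𝕜 d b :=
  LinearMap.mkContinuous
    { toFun := fun f => (memLp_vmul f).toLp _
      map_add' := fun f g => by
        rw [← MemLp.toLp_add, MemLp.toLp_eq_toLp_iff]
        filter_upwards [Lp.coeFn_add f g] with x hx
        rw [hx]; simp [mul_add]
      map_smul' := fun c f => by
        rw [RingHom.id_apply, ← MemLp.toLp_const_smul, MemLp.toLp_eq_toLp_iff]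
        filter_upwards [Lp.coeFn_smul c f] with x hx
        rw [hx]; simp [mul_left_comm] } |b| fun f => by
    refine Lp.norm_le_mul_norm_of_ae_le_mul ?_
    filter_upwards [(memLp_vmul f).coeFn_toLp, ae_restrict_mem measurableSet_strip] with x hx hs
    change ‖(memLp_vmul f).toLp _ x‖ ≤ _
    rw [hx, norm_mul, RCLike.norm_ofReal]
    exact mul_le_mul_of_nonneg_right (abs_snd_le hs) (norm_nonneg _)

theorem coeFn_vmulL (f : L2 𝕜 d b) :
    vmulL 𝕜 d b f =ᵐ[stripMeasure d b] fun x => (x.2 : 𝕜) * f x :=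
  (memLp_vmul f).coeFn_toLp

theorem norm_vmulL_le (hb : 0 < b) (f : L2 𝕜 d b) : ‖vmulL 𝕜 d b f‖ ≤ b * ‖f‖ := by
  refine Lp.norm_le_mul_norm_of_ae_le_mul ?_
  filter_upwards [coeFn_vmulL f, ae_restrict_mem measurableSet_strip] with x hx hs
  rw [hx, norm_mul, RCLike.norm_ofReal]
  exact mul_le_mul_of_nonneg_right ((abs_snd_le hs).trans (abs_of_pos hb).le) (norm_nonneg _)

theorem inner_vmulL_left (f g : L2 𝕜 d b) :
    inner 𝕜 (vmulL 𝕜 d b f) g = inner 𝕜 f (vmulL 𝕜 d b g) := by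
  rw [L2.inner_def, L2.inner_def]
  refine integral_congr_ae ?_
  filter_upwards [coeFn_vmulL f, coeFn_vmulL g] with x h1 h2
  rw [h1, h2, RCLike.inner_apply, RCLike.inner_apply, map_mul, RCLike.conj_ofReal]
  ring

theorem re_inner_vmulL_nonneg (f : L2 𝕜 d b) : 0 ≤ RCLike.re (inner 𝕜 (vmulL 𝕜 d b f) f) := by
  rw [L2.inner_def]
  have e : ∫ x, inner 𝕜 (vmulL 𝕜 d b f x) (f x) ∂(stripMeasure d b)
      = ((∫ x, x.2 * ‖f x‖ ^ 2 ∂(stripMeasure d b) : ℝ) : 𝕜) := by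
    rw [← integral_ofReal]
    refine integral_congr_ae ?_
    filter_upwards [coeFn_vmulL f] with x h1
    rw [h1, RCLike.inner_apply, map_mul, RCLike.conj_ofReal, mul_left_comm, RCLike.mul_conj]
    push_cast; ring
  rw [e, RCLike.ofReal_re]
  refine integral_nonneg_of_ae ?_
  filter_upwards [ae_restrict_mem measurableSet_strip] with x hx
  have := hx.1.le
  positivity

theorem vmulL_hshift (v : Hor d) (f : L2 𝕜 d b) :
    vmulL 𝕜 d b (hshift 𝕜 b v f) = hshift 𝕜 b v (vmulL 𝕜 d b f) := by
  refine Lp.ext ?_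
  filter_upwards [coeFn_hshift v (vmulL 𝕜 d b f), coeFn_hshift v f, coeFn_vmulL (hshift 𝕜 b v f),
    (measurePreserving_hshift (b := b) v).quasiMeasurePreserving.ae (coeFn_vmulL f)]
    with x h1 h2 h3 h4
  rw [h1, h3, h2, h4]; simp

theorem vmulL_toL2 (φ : TestFn d) : vmulL 𝕜 d b (φ.toL2 𝕜 b) = φ.vmul.toL2 𝕜 b := by
  refine Lp.ext ?_
  filter_upwards [coeFn_vmulL (φ.toL2 𝕜 b), φ.coeFn_toL2 (𝕜 := 𝕜) (b := b),
    φ.vmul.coeFn_toL2 (𝕜 := 𝕜) (b := b)] with x h1 h2 h3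
  rw [h1, h2, h3]; simp [TestFn.vmul]

/-! ### Dilation towards the top of the strip -/

/-- The map halves vertical lengths, so the image measure has density `2`. -/
theorem map_dilation_volume :
    Measure.map (TestFn.dilation d b) (volume : Measure (Space d)) = (2 : ℝ≥0∞) • volume := by
  have h1 : Measure.map (fun t : ℝ => (b + t) / 2) volume = (2 : ℝ≥0∞) • volume := by
    have e : (fun t : ℝ => (b + t) / 2) = (fun t => 2⁻¹ * t) ∘ fun t => b + t := by
      ext t; simp; ring
    rw [e, ← Measure.map_map (by fun_prop) (by fun_prop), map_add_left_eq_self,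
      Real.map_volume_mul_left (by norm_num)]
    norm_num
  have e : (TestFn.dilation d b : Space d → Space d) = Prod.map id fun t : ℝ => (b + t) / 2 := rfl
  rw [e, Measure.volume_eq_prod, ← Measure.map_prod_map _ _ measurable_id (by fun_prop),
    Measure.map_id, h1, Measure.prod_smul_right]

/-- The strip is mapped into its own upper half, so composition with the dilation acts on `L²(Ω)`.
-/
theorem map_dilation_le (hb : 0 < b) :
    Measure.map (TestFn.dilation d b) (stripMeasure d b) ≤ (2 : ℝ≥0∞) • stripMeasure d b := by
  have hm : Measurable (TestFn.dilation d b) := (TestFn.dilation d b).continuous.measurable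
  rw [stripMeasure, ← Measure.restrict_smul, ← map_dilation_volume (b := b),
    Measure.restrict_map hm measurableSet_strip]
  refine Measure.map_mono (Measure.restrict_mono_set _ fun x hx => ?_) hm
  change 0 < (b + x.2) / 2 ∧ (b + x.2) / 2 < b
  constructor <;> linarith [hx.1, hx.2]

theorem quasi_dilation (hb : 0 < b) : Measure.QuasiMeasurePreserving (TestFn.dilation d b)
    (stripMeasure d b) (stripMeasure d b) :=
  ⟨(TestFn.dilation d b).continuous.measurable,
    (Measure.absolutelyContinuous_of_le (map_dilation_le hb)).trans
      (Measure.smul_absolutelyContinuous)⟩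

theorem eLpNorm_dilation_le (hb : 0 < b) (f : L2 𝕜 d b) :
    eLpNorm (fun x => f (TestFn.dilation d b x)) 2 (stripMeasure d b)
      ≤ 2 * eLpNorm f 2 (stripMeasure d b) := by
  have hs : AEStronglyMeasurable f (Measure.map (TestFn.dilation d b) (stripMeasure d b)) :=
    (Lp.aestronglyMeasurable f).mono_ac (quasi_dilation hb).absolutelyContinuous
  have h1 := eLpNorm_map_measure (p := 2) hs (quasi_dilation hb).measurable.aemeasurable
  change eLpNorm (f ∘ TestFn.dilation d b) 2 _ ≤ _
  rw [← h1]
  refine (eLpNorm_mono_measure _ (map_dilation_le hb)).trans ?_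
  rw [eLpNorm_smul_measure_of_ne_top (by simp), smul_eq_mul]
  gcongr
  calc (2 : ℝ≥0∞) ^ (1 / (2 : ℝ≥0∞)).toReal ≤ 2 ^ (1 : ℝ) := by
        apply ENNReal.rpow_le_rpow_of_exponent_le <;> norm_num
    _ = 2 := by simp

theorem memLp_dilation (hb : 0 < b) (f : L2 𝕜 d b) :
    MemLp (fun x => f (TestFn.dilation d b x)) 2 (stripMeasure d b) :=
  ⟨(Lp.aestronglyMeasurable f).comp_quasiMeasurePreserving (quasi_dilation hb),
    (eLpNorm_dilation_le hb f).trans_lt (ENNReal.mul_lt_top (by simp) (Lp.memLp f).2)⟩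

variable (𝕜 d) in
/-- The operator `(S f)(x', t) = f(x', (b + t) / 2)` on `L²(Ω)`. -/
noncomputable def dilateL (hb : 0 < b) : L2 𝕜 d b →L[𝕜] L2 𝕜 d b :=
  LinearMap.mkContinuous
    { toFun := fun f => (memLp_dilation hb f).toLp _
      map_add' := fun f g => by
        rw [← MemLp.toLp_add, MemLp.toLp_eq_toLp_iff]
        filter_upwards [(quasi_dilation hb).ae (Lp.coeFn_add f g)] with x hx
        rw [hx]; simp
      map_smul' := fun c f => by
        rw [RingHom.id_apply, ← MemLp.toLp_const_smul, MemLp.toLp_eq_toLp_iff]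
        filter_upwards [(quasi_dilation hb).ae (Lp.coeFn_smul c f)] with x hx
        rw [hx]; simp } 2 fun f => by
    change ‖(memLp_dilation hb f).toLp _‖ ≤ _
    rw [Lp.norm_toLp, Lp.norm_def]
    have h := ENNReal.toReal_mono (ENNReal.mul_ne_top (by simp) (Lp.memLp f).2.ne)
      (eLpNorm_dilation_le hb f)
    simpa [ENNReal.toReal_mul] using h

theorem coeFn_dilateL (hb : 0 < b) (f : L2 𝕜 d b) :
    dilateL 𝕜 d hb f =ᵐ[stripMeasure d b] fun x => f (TestFn.dilation d b x) :=
  (memLp_dilation hb f).coeFn_toLp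

theorem norm_dilateL_le (hb : 0 < b) (f : L2 𝕜 d b) : ‖dilateL 𝕜 d hb f‖ ≤ 2 * ‖f‖ :=
  ContinuousLinearMap.le_of_opNorm_le _ (LinearMap.mkContinuous_norm_le _ (by norm_num) _) f

theorem dilateL_hshift (hb : 0 < b) (v : Hor d) (f : L2 𝕜 d b) :
    dilateL 𝕜 d hb (hshift 𝕜 b v f) = hshift 𝕜 b v (dilateL 𝕜 d hb f) := by
  refine Lp.ext ?_
  filter_upwards [coeFn_hshift v (dilateL 𝕜 d hb f), (quasi_dilation hb).ae (coeFn_hshift v f),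
    coeFn_dilateL hb (hshift 𝕜 b v f),
    (measurePreserving_hshift (b := b) v).quasiMeasurePreserving.ae (coeFn_dilateL hb f)]
    with x h1 h2 h3 h4
  rw [h1, h3, h2, h4]
  congr 1
  ext <;> simp [TestFn.dilation]

theorem dilateL_toL2 (hb : 0 < b) (φ : TestFn d) :
    dilateL 𝕜 d hb (φ.toL2 𝕜 b) = (φ.dilate b).toL2 𝕜 b := by
  refine Lp.ext ?_
  filter_upwards [coeFn_dilateL hb (φ.toL2 𝕜 b),
    (quasi_dilation hb).ae (φ.coeFn_toL2 (𝕜 := 𝕜) (b := b)),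
    (φ.dilate b).coeFn_toL2 (𝕜 := 𝕜) (b := b)] with x h1 h2 h3
  rw [h1, h2, h3]; rfl

/-! ### Integration by parts for test functions -/

theorem TestFn.partialD_last_apply (φ : TestFn d) (y : Hor d) (t : ℝ) :
    HasDerivAt (fun s => φ (y, s)) (φ.partialD (Fin.last d) (y, t)) t :=
  vertical_hasDerivAt φ.contDiff y t

theorem TestFn.partialD_mul (φ ψ : TestFn d) (x : Space d) : (φ.mul ψ).partialD (Fin.last d) x
    = φ.partialD (Fin.last d) x * ψ x + φ x * ψ.partialD (Fin.last d) x :=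
  ((φ.mul ψ).partialD_last_apply x.1 x.2).unique
    ((φ.partialD_last_apply x.1 x.2).mul (ψ.partialD_last_apply x.1 x.2))

theorem TestFn.partialD_vmul (φ : TestFn d) (x : Space d) : φ.vmul.partialD (Fin.last d) x
    = φ x + x.2 * φ.partialD (Fin.last d) x := by
  have := (φ.vmul.partialD_last_apply x.1 x.2).unique
    ((hasDerivAt_id x.2).mul (φ.partialD_last_apply x.1 x.2))
  simpa using this

theorem TestFn.partialD_dilate (φ : TestFn d) (x : Space d) :
    (φ.dilate b).partialD (Fin.last d) x = 2⁻¹ * (φ.partialD (Fin.last d)).dilate b x := by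
  have h : HasDerivAt (fun s : ℝ => (b + s) / 2) (1 / 2) x.2 :=
    ((hasDerivAt_id x.2).const_add b).div_const 2
  have := ((φ.dilate b).partialD_last_apply x.1 x.2).unique
    (HasDerivAt.comp (h₂ := fun s => φ (x.1, s)) x.2
      (φ.partialD_last_apply x.1 ((b + x.2) / 2)) h)
  rw [this, mul_comm, one_div]; rfl

theorem TestFn.integrable_strip (φ : TestFn d) : Integrable φ (stripMeasure d b) :=
  (φ.continuous.integrable_of_hasCompactSupport φ.compact).integrableOn

/-- The integral of the product of two test functions over the top of the strip. -/
noncomputable def topPairing (b : ℝ) (φ ψ : TestFn d) : ℝ := ∫ y : Hor d, φ (y, b) * ψ (y, b)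

/-- The fundamental theorem of calculus for `φψ` on vertical segments. -/
theorem inner_add_inner_partialD (hb : 0 < b) (φ ψ : TestFn d) :
    inner 𝕜 ((φ.partialD (Fin.last d)).toL2 𝕜 b) (ψ.toL2 𝕜 b)
      + inner 𝕜 (φ.toL2 𝕜 b) ((ψ.partialD (Fin.last d)).toL2 𝕜 b)
      = (topPairing b φ ψ : 𝕜) - inner 𝕜 (φ.bdry 𝕜) (ψ.bdry 𝕜) := by
  rw [TestFn.inner_toL2_toL2, TestFn.inner_toL2_toL2, TestFn.inner_bdry_bdry, ← RCLike.ofReal_add,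
    ← RCLike.ofReal_sub]
  congr 1
  have h := integral_partialD_last hb (φ.mul ψ)
  simp only [TestFn.partialD_mul] at h
  exact (integral_add ((φ.partialD (Fin.last d)).mul ψ).integrable_strip
    (φ.mul (ψ.partialD (Fin.last d))).integrable_strip).symm.trans (h.trans rfl)

/-- The same for `t φψ`: the weight vanishes on `Σ₀` and equals `b` on top, so only the top
contributes. -/
theorem inner_add_inner_vmulL (hb : 0 < b) (φ ψ : TestFn d) :
    inner 𝕜 (φ.toL2 𝕜 b) (ψ.toL2 𝕜 b)
      + inner 𝕜 (vmulL 𝕜 d b ((φ.partialD (Fin.last d)).toL2 𝕜 b)) (ψ.toL2 𝕜 b)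
      + inner 𝕜 (vmulL 𝕜 d b (φ.toL2 𝕜 b)) ((ψ.partialD (Fin.last d)).toL2 𝕜 b)
      = ((b * topPairing b φ ψ : ℝ) : 𝕜) := by
  rw [vmulL_toL2, vmulL_toL2, TestFn.inner_toL2_toL2, TestFn.inner_toL2_toL2,
    TestFn.inner_toL2_toL2, ← RCLike.ofReal_add, ← RCLike.ofReal_add]
  congr 1
  have h := integral_partialD_last hb (φ.mul ψ).vmul
  have e : ∀ x, (φ.mul ψ).vmul.partialD (Fin.last d) x
      = φ.mul ψ x + (φ.partialD (Fin.last d)).vmul.mul ψ x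
        + φ.vmul.mul (ψ.partialD (Fin.last d)) x := by
    intro x
    rw [TestFn.partialD_vmul, TestFn.partialD_mul]
    simp only [TestFn.mul, TestFn.vmul]; ring
  simp only [e] at h
  have i1 := (φ.mul ψ).integrable_strip (b := b)
  have i2 := ((φ.partialD (Fin.last d)).vmul.mul ψ).integrable_strip (b := b)
  have i3 := (φ.vmul.mul (ψ.partialD (Fin.last d))).integrable_strip (b := b)
  have h1 := integral_add (i1.add i2) i3
  have h2 := integral_add i1 i2
  refine (congrArg₂ (· + ·) h2.symm rfl).trans (h1.symm.trans (h.trans ?_))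
  simp [TestFn.vmul, TestFn.mul, topPairing, integral_const_mul]

/-- The dilation fixes the top. This is what makes `f - S f` free of boundary terms there. -/
theorem topPairing_dilate (φ ψ : TestFn d) :
    topPairing b (φ.dilate b) ψ = topPairing b φ ψ := by
  simp [topPairing, TestFn.dilate, TestFn.dilation]

theorem toL2_partialD_dilate (hb : 0 < b) (φ : TestFn d) :
    ((φ.dilate b).partialD (Fin.last d)).toL2 𝕜 b
      = (2⁻¹ : 𝕜) • dilateL 𝕜 d hb ((φ.partialD (Fin.last d)).toL2 𝕜 b) := by
  rw [dilateL_toL2]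
  refine Lp.ext ?_
  filter_upwards [((φ.dilate b).partialD (Fin.last d)).coeFn_toL2 (𝕜 := 𝕜) (b := b),
    ((φ.partialD (Fin.last d)).dilate b).coeFn_toL2 (𝕜 := 𝕜) (b := b),
    Lp.coeFn_smul (2⁻¹ : 𝕜) (((φ.partialD (Fin.last d)).dilate b).toL2 𝕜 b)] with x h1 h2 h3
  rw [h1, h3, Pi.smul_apply, h2, TestFn.partialD_dilate, RCLike.ofReal_mul, RCLike.ofReal_inv,
    RCLike.ofReal_ofNat, smul_eq_mul]

end


/-! ### Closure and weak convergence in Hilbert spaces. -/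

section Hilbert

variable {𝕜 : Type*} [RCLike 𝕜] {E : Type*} [NormedAddCommGroup E] [InnerProductSpace 𝕜 E]

/-- The extension principle for all Green formulas below: an identity that is linear and continuous
in one slot passes from test functions to the closure of their span. -/
theorem mem_closure_span_induction {F : Type*} [NormedAddCommGroup F] [NormedSpace 𝕜 F]
    {s : Set F} {p : F → Prop} (hcl : IsClosed {x | p x}) (zero : p 0)
    (add : ∀ x y, p x → p y → p (x + y)) (smul : ∀ (c : 𝕜) x, p x → p (c • x))
    (gen : ∀ x ∈ s, p x) {x : F} (hx : x ∈ (Submodule.span 𝕜 s).topologicalClosure) : p x := by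
  let K : Submodule 𝕜 F :=
    { carrier := {x | p x}
      zero_mem' := zero
      add_mem' := fun {x y} hx hy => add x y hx hy
      smul_mem' := fun c x hx => smul c x hx }
  exact Submodule.topologicalClosure_minimal (t := K) _ (Submodule.span_le.2 gen) hcl hx

/-- Weak convergence of a bounded family may be tested on a dense subspace. -/
theorem tendsto_inner_of_dense {ι : Type*} {l : Filter ι} {u : ι → E} {u₀ : E} {C : ℝ}
    (hC : ∀ᶠ i in l, ‖u i‖ ≤ C) {s : Submodule 𝕜 E} (hs : s.topologicalClosure = ⊤)
    (h : ∀ x ∈ s, Tendsto (fun i => inner 𝕜 x (u i)) l (𝓝 (inner 𝕜 x u₀))) (x : E) :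
    Tendsto (fun i => inner 𝕜 x (u i)) l (𝓝 (inner 𝕜 x u₀)) := by
  rw [Metric.tendsto_nhds]
  intro ε hε
  -- `K` bounds `‖u i - u₀‖` eventually; the `1` keeps it positive.
  set K := |C| + ‖u₀‖ + 1 with hK
  have hK0 : 0 < K := by positivity
  have hx : x ∈ closure (s : Set E) := by
    have : x ∈ s.topologicalClosure := hs ▸ Submodule.mem_top
    exact this
  obtain ⟨x', hx's, hx'⟩ := Metric.mem_closure_iff.1 hx (ε / (2 * K)) (by positivity)
  filter_upwards [hC, Metric.tendsto_nhds.1 (h x' hx's) (ε / 2) (by positivity)] with i h1 h2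
  rw [dist_eq_norm, ← inner_sub_right] at h2 ⊢
  have e : inner 𝕜 x (u i - u₀) = inner 𝕜 (x - x') (u i - u₀) + inner 𝕜 x' (u i - u₀) := by
    rw [inner_sub_left]; ring
  rw [e]
  have h3 : ‖inner 𝕜 (x - x') (u i - u₀)‖ ≤ ε / (2 * K) * K := by
    refine (norm_inner_le_norm _ _).trans ?_
    rw [dist_eq_norm] at hx'
    gcongr
    exact (norm_sub_le _ _).trans (by linarith [le_abs_self C])
  have h4 : ε / (2 * K) * K = ε / 2 := by field_simp
  linarith [norm_add_le (inner 𝕜 (x - x') (u i - u₀)) (inner 𝕜 x' (u i - u₀))]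

/-- A bounded sequence in a Hilbert space has a weak cluster point along an ultrafilter. -/
theorem exists_weak_limit [CompleteSpace E] (U : Ultrafilter ℕ) {u : ℕ → E} {C : ℝ}
    (hC : ∀ n, ‖u n‖ ≤ C) :
    ∃ g, ∀ x, Tendsto (fun n => inner 𝕜 x (u n)) U (𝓝 (inner 𝕜 x g)) := by
  -- The vectors become functionals by Riesz, and Banach–Alaoglu makes their ball compact;
  -- convergence along an ultrafilter replaces the choice of a subsequence.
  let T : ℕ → WeakDual 𝕜 E := fun n =>
    StrongDual.toWeakDual (InnerProductSpace.toDual 𝕜 E (u n))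
  have hK := WeakDual.isCompact_closedBall (𝕜 := 𝕜) (E := E) 0 C
  obtain ⟨ℓ, -, hℓ⟩ := hK.ultrafilter_le_nhds (U.map T) (by
    rw [Filter.le_principal_iff]
    refine Filter.mem_map.2 (Filter.univ_mem' fun n => ?_)
    simp only [mem_preimage, Metric.mem_closedBall, dist_zero_right]
    change ‖InnerProductSpace.toDual 𝕜 E (u n)‖ ≤ C
    rw [LinearIsometryEquiv.norm_map]
    exact hC n)
  refine ⟨(InnerProductSpace.toDual 𝕜 E).symm (WeakDual.toStrongDual ℓ), fun x => ?_⟩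
  have h1 : Tendsto (fun n => T n x) U (𝓝 (ℓ x)) :=
    ((WeakDual.eval_continuous x).tendsto ℓ).comp hℓ
  have h2 := (RCLike.continuous_conj (K := 𝕜)).continuousAt.tendsto.comp h1
  have e1 : (fun n => inner 𝕜 x (u n)) = (conj : 𝕜 → 𝕜) ∘ fun n => T n x := by
    ext n
    change _ = conj (inner 𝕜 (u n) x)
    rw [inner_conj_symm]
  have e2 : inner 𝕜 x ((InnerProductSpace.toDual 𝕜 E).symm (WeakDual.toStrongDual ℓ))
      = conj (ℓ x) := by
    rw [← inner_conj_symm, InnerProductSpace.toDual_symm_apply]; rfl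
  rw [e1, e2]
  exact h2

end Hilbert

/-! ### Horizontal difference quotients and weak derivatives. -/

section

variable {𝕜 : Type*} [RCLike 𝕜] {d : ℕ} {b : ℝ}

/-- The unit vector `e_j` of the horizontal space. -/
noncomputable abbrev horVec (j : Fin d) : Hor d := EuclideanSpace.single j 1

variable (𝕜 b) in
/-- The horizontal difference quotient `(f(· + h e_j) - f) / h` on `L²(Ω)`. -/
noncomputable def diffQ (j : Fin d) (h : ℝ) : L2 𝕜 d b →L[𝕜] L2 𝕜 d b :=
  (h : 𝕜)⁻¹ • ((hshift 𝕜 b (h • horVec j)).toContinuousLinearMap - ContinuousLinearMap.id 𝕜 _)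

theorem diffQ_apply (j : Fin d) (h : ℝ) (f : L2 𝕜 d b) :
    diffQ 𝕜 b j h f = (h : 𝕜)⁻¹ • (hshift 𝕜 b (h • horVec j) f - f) := rfl

/-- Discrete integration by parts; no boundary term occurs, since horizontal translations preserve
the strip and its measure. -/
theorem inner_diffQ_left (j : Fin d) (h : ℝ) (f g : L2 𝕜 d b) :
    inner 𝕜 (diffQ 𝕜 b j h f) g = - inner 𝕜 f (diffQ 𝕜 b j (-h) g) := by
  simp only [diffQ_apply, inner_smul_left, inner_smul_right, inner_sub_left, inner_sub_right,
    inner_hshift_left, map_inv₀, RCLike.conj_ofReal, neg_smul, RCLike.ofReal_neg, inv_neg, inner_neg_right]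
  ring

theorem diffQ_comm_of_hshift {Q : L2 𝕜 d b →L[𝕜] L2 𝕜 d b}
    (hQ : ∀ v f, Q (hshift 𝕜 b v f) = hshift 𝕜 b v (Q f)) (j : Fin d) (h : ℝ) (f : L2 𝕜 d b) :
    Q (diffQ 𝕜 b j h f) = diffQ 𝕜 b j h (Q f) := by
  simp only [diffQ_apply, map_smul, map_sub, hQ]

theorem vmulL_diffQ (j : Fin d) (h : ℝ) (f : L2 𝕜 d b) :
    vmulL 𝕜 d b (diffQ 𝕜 b j h f) = diffQ 𝕜 b j h (vmulL 𝕜 d b f) :=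
  diffQ_comm_of_hshift vmulL_hshift j h f

theorem dilateL_diffQ (hb : 0 < b) (j : Fin d) (h : ℝ) (f : L2 𝕜 d b) :
    dilateL 𝕜 d hb (diffQ 𝕜 b j h f) = diffQ 𝕜 b j h (dilateL 𝕜 d hb f) :=
  diffQ_comm_of_hshift (dilateL_hshift hb) j h f

/-- The translation is moved to `φ`, the only smooth factor, whence the sign. -/
theorem hasDerivAt_inner_hshift (φ : TestFn d) (j : Fin d) (f : L2 𝕜 d b) (s : ℝ) :
    HasDerivAt (fun s : ℝ => inner 𝕜 (φ.toL2 𝕜 b) (hshift 𝕜 b (s • horVec j) f))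
      (- inner 𝕜 ((φ.partialD j.castSucc).toL2 𝕜 b) (hshift 𝕜 b (s • horVec j) f)) s := by
  have key : ∀ (ψ : TestFn d) (s : ℝ), inner 𝕜 (ψ.toL2 𝕜 b) (hshift 𝕜 b (s • horVec j) f)
      = inner 𝕜 ((ψ.shift (s • -basisVec d j.castSucc)).toL2 𝕜 b) f := by
    intro ψ s
    have e : (s • -basisVec d j.castSucc : Space d) = (-(s • horVec j), 0) := by
      rw [basisVec_castSucc]; ext <;> simp
    rw [e, ← hshift_toL2, inner_hshift_left, neg_neg]
  simp only [key]
  have h := hasDerivAt_inner_shift φ (-basisVec d j.castSucc) f s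
  convert h using 1
  rw [TestFn.inner_toL2, TestFn.inner_toL2, ← integral_neg]
  refine integral_congr_ae (Eventually.of_forall fun x => ?_)
  simp [TestFn.shift, TestFn.dirDeriv, TestFn.partialD]

theorem tendsto_inner_diffQ (x f : L2 𝕜 d b) (j : Fin d) {c : 𝕜}
    (h : HasDerivAt (fun s : ℝ => inner 𝕜 x (hshift 𝕜 b (s • horVec j) f)) c 0) :
    Tendsto (fun s : ℝ => inner 𝕜 x (diffQ 𝕜 b j s f)) (𝓝[≠] 0) (𝓝 c) := by
  rw [hasDerivAt_iff_tendsto_slope] at h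
  refine h.congr fun s => ?_
  rw [slope_def_module, sub_zero, zero_smul, hshift_zero, diffQ_apply, inner_smul_right,
    inner_sub_right, RCLike.real_smul_eq_coe_mul, RCLike.ofReal_inv]

theorem isWeakPartial_hshift {i : Fin (d + 1)} {f g : L2 𝕜 d b} (h : IsWeakPartial d b i f g)
    (v : Hor d) : IsWeakPartial d b i (hshift 𝕜 b v f) (hshift 𝕜 b v g) := by
  rw [isWeakPartial_iff] at h ⊢
  intro φ hφ
  rw [← neg_neg v, ← inner_hshift_left, ← inner_hshift_left, hshift_toL2, hshift_toL2,
    ← TestFn.partialD_shift]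
  refine h _ ?_
  rw [TestFn.tsupport_shift]
  intro x hx
  have := hφ hx
  simpa [strip] using this

variable (𝕜 d b) in
/-- The span of the test functions supported in the strip. -/
noncomputable def testSpan : Submodule 𝕜 (L2 𝕜 d b) :=
  Submodule.span 𝕜 {f | ∃ φ : TestFn d, tsupport φ ⊆ strip d b ∧ φ.toL2 𝕜 b = f}

theorem testSpan_dense : (testSpan 𝕜 d b).topologicalClosure = ⊤ := by
  rw [Submodule.topologicalClosure_eq_top_iff, Submodule.eq_bot_iff]
  intro f hf
  refine eq_zero_of_inner_test fun φ hφ => ?_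
  exact (Submodule.mem_orthogonal _ _).1 hf _ (Submodule.subset_span ⟨φ, hφ, rfl⟩)

theorem hasDerivAt_inner_hshift_of_weak {j : Fin d} {f g : L2 𝕜 d b}
    (h : IsWeakPartial d b j.castSucc f g) {x : L2 𝕜 d b} (hx : x ∈ testSpan 𝕜 d b) (s : ℝ) :
    HasDerivAt (fun s : ℝ => inner 𝕜 x (hshift 𝕜 b (s • horVec j) f))
      (inner 𝕜 x (hshift 𝕜 b (s • horVec j) g)) s := by
  induction hx using Submodule.span_induction with
  | mem x hx =>
    obtain ⟨φ, hφ, rfl⟩ := hx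
    have h1 := hasDerivAt_inner_hshift φ j f s
    rwa [isWeakPartial_iff.1 (isWeakPartial_hshift h _) φ hφ, neg_neg] at h1
  | zero => simpa using hasDerivAt_const s (0 : 𝕜)
  | add x y _ _ hx hy => simp only [inner_add_left]; exact hx.add hy
  | smul c x _ hx => simpa only [inner_smul_left] using hx.const_mul (conj c)

/-- For `x` in the test span, `s ↦ ⟨x, f(· + s eⱼ)⟩` has derivative at most `‖x‖ ‖g‖`; the mean
value inequality and density give the bound for all `x`, in particular for the quotient itself. -/
theorem norm_diffQ_le {j : Fin d} {f g : L2 𝕜 d b} (h : IsWeakPartial d b j.castSucc f g) (s : ℝ) :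
    ‖diffQ 𝕜 b j s f‖ ≤ ‖g‖ := by
  have h1 : ∀ x : L2 𝕜 d b, ‖inner 𝕜 x (diffQ 𝕜 b j s f)‖ ≤ ‖x‖ * ‖g‖ := by
    intro x
    have hx : x ∈ (testSpan 𝕜 d b).topologicalClosure := by
      rw [testSpan_dense]; exact Submodule.mem_top
    have hcl : IsClosed {x : L2 𝕜 d b | ‖inner 𝕜 x (diffQ 𝕜 b j s f)‖ ≤ ‖x‖ * ‖g‖} :=
      isClosed_le (Continuous.inner (𝕜 := 𝕜) continuous_id continuous_const).norm
        (continuous_norm.mul continuous_const)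
    refine closure_minimal (fun x hx => ?_) hcl hx
    have h2 := (convex_univ (𝕜 := ℝ) (E := ℝ)).norm_image_sub_le_of_norm_hasDerivWithin_le
      (f := fun s : ℝ => inner 𝕜 x (hshift 𝕜 b (s • horVec j) f)) (C := ‖x‖ * ‖g‖)
      (fun s _ => (hasDerivAt_inner_hshift_of_weak h hx s).hasDerivWithinAt)
      (fun s _ => (norm_inner_le_norm _ _).trans (by rw [LinearIsometry.norm_map]))
      (mem_univ 0) (mem_univ s)
    simp only [zero_smul, hshift_zero, sub_zero] at h2
    change ‖inner 𝕜 x (diffQ 𝕜 b j s f)‖ ≤ ‖x‖ * ‖g‖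
    rw [diffQ_apply, inner_smul_right, inner_sub_right, norm_mul, norm_inv, RCLike.norm_ofReal]
    -- At `s = 0` the quotient is `0`, because `0⁻¹ = 0`.
    rcases eq_or_ne s 0 with rfl | hs
    · simp; positivity
    · rw [Real.norm_eq_abs] at h2
      rw [inv_mul_le_iff₀ (abs_pos.2 hs), mul_comm]
      exact h2
  have h2 := h1 (diffQ 𝕜 b j s f)
  rw [inner_self_eq_norm_sq_to_K, norm_pow, RCLike.norm_ofReal, abs_norm, sq] at h2
  rcases (norm_nonneg (diffQ 𝕜 b j s f)).eq_or_lt with h0 | h0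
  · rw [← h0]; exact norm_nonneg g
  · exact le_of_mul_le_mul_left h2 h0

/-- Difference quotients converge weakly to the weak derivative. -/
theorem tendsto_diffQ {j : Fin d} {f g : L2 𝕜 d b} (h : IsWeakPartial d b j.castSucc f g)
    (x : L2 𝕜 d b) :
    Tendsto (fun s : ℝ => inner 𝕜 x (diffQ 𝕜 b j s f)) (𝓝[≠] 0) (𝓝 (inner 𝕜 x g)) := by
  refine tendsto_inner_of_dense (Eventually.of_forall fun s => norm_diffQ_le h s) testSpan_dense
    (fun x hx => tendsto_inner_diffQ x f j ?_) x
  simpa [hshift_zero] using hasDerivAt_inner_hshift_of_weak h hx 0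

theorem tendsto_neg_punctured : Tendsto (fun s : ℝ => -s) (𝓝[≠] 0) (𝓝[≠] 0) := by
  have h : Tendsto (fun s : ℝ => -s) (𝓝[≠] 0) (𝓝 0) := by
    simpa using (continuous_neg.tendsto (0 : ℝ)).mono_left nhdsWithin_le_nhds
  refine tendsto_nhdsWithin_iff.2 ⟨h, ?_⟩
  filter_upwards [self_mem_nhdsWithin] with s hs
  simpa using hs

theorem tendsto_diffQ_neg {j : Fin d} {f g : L2 𝕜 d b} (h : IsWeakPartial d b j.castSucc f g)
    (x : L2 𝕜 d b) :
    Tendsto (fun s : ℝ => inner 𝕜 x (diffQ 𝕜 b j (-s) f)) (𝓝[≠] 0) (𝓝 (inner 𝕜 x g)) :=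
  (tendsto_diffQ h x).comp tendsto_neg_punctured

/-- A function whose horizontal difference quotients are bounded has a weak derivative. -/
theorem exists_isWeakPartial {j : Fin d} {f : L2 𝕜 d b} {C : ℝ}
    (hC : ∀ s : ℝ, ‖diffQ 𝕜 b j s f‖ ≤ C) : ∃ g : L2 𝕜 d b, IsWeakPartial d b j.castSucc f g := by
  let s : ℕ → ℝ := fun n => 1 / ((n : ℝ) + 1)
  have hs : Tendsto s atTop (𝓝[≠] 0) := by
    refine tendsto_nhdsWithin_iff.2 ⟨tendsto_one_div_add_atTop_nhds_zero_nat, ?_⟩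
    exact Eventually.of_forall fun n => by
      have : (0 : ℝ) < s n := by positivity
      exact this.ne'
  obtain ⟨g, hg⟩ := exists_weak_limit (𝕜 := 𝕜) (hyperfilter ℕ) fun n => hC (s n)
  refine ⟨g, isWeakPartial_iff.2 fun φ hφ => ?_⟩
  -- The quotients tested with `φ` converge to `-⟨∂ⱼφ, f⟩` for every `f ∈ L²(Ω)`, which identifies
  -- their weak limit `g` as the derivative.
  have h1 := hasDerivAt_inner_hshift φ j f 0
  rw [zero_smul, hshift_zero] at h1
  have h2 := ((tendsto_inner_diffQ _ f j h1).comp hs).mono_left Nat.hyperfilter_le_atTop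
  have h3 := tendsto_nhds_unique h2 (hg (φ.toL2 𝕜 b))
  rw [← h3, neg_neg]

/-- Limit of the discrete formula. Neither function is a test function, and no boundary condition is
required in horizontal directions. -/
theorem inner_weakPartial_swap {i : Fin d} {f g f' g' : L2 𝕜 d b}
    (hf : IsWeakPartial d b i.castSucc f f') (hg : IsWeakPartial d b i.castSucc g g') :
    inner 𝕜 f' g = - inner 𝕜 f g' := by
  have h1 := tendsto_diffQ_neg hg f
  have h2 := tendsto_diffQ hf g
  have h3 := ((RCLike.continuous_conj (K := 𝕜)).tendsto _).comp h2
  rw [inner_conj_symm] at h3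
  have h4 : Tendsto (fun s : ℝ => inner 𝕜 (diffQ 𝕜 b i s f) g) (𝓝[≠] 0) (𝓝 (inner 𝕜 f' g)) :=
    h3.congr fun s => inner_conj_symm _ _
  simp only [inner_diffQ_left] at h4
  exact tendsto_nhds_unique h4 h1.neg

theorem isWeakPartial_diffQ {i : Fin (d + 1)} {f g : L2 𝕜 d b} (h : IsWeakPartial d b i f g)
    (j : Fin d) (s : ℝ) :
    IsWeakPartial d b i (diffQ 𝕜 b j s f) (diffQ 𝕜 b j s g) := by
  have h' := isWeakPartial_hshift h (s • horVec j)
  rw [isWeakPartial_iff] at h h' ⊢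
  intro φ hφ
  simp only [diffQ_apply, inner_smul_right, inner_sub_right, h φ hφ, h' φ hφ]
  ring

/-- Mixed horizontal derivatives may be exchanged in `∫ ∂ⱼf ∂ᵢg`. -/
theorem inner_partial_partial_swap {i j : Fin d} {f g fi fj gi gj : L2 𝕜 d b}
    (hfi : IsWeakPartial d b i.castSucc f fi) (hfj : IsWeakPartial d b j.castSucc f fj)
    (hgi : IsWeakPartial d b i.castSucc g gi) (hgj : IsWeakPartial d b j.castSucc g gj) :
    inner 𝕜 fj gi = inner 𝕜 fi gj := by
  have h1 : Tendsto (fun s : ℝ => inner 𝕜 fj (diffQ 𝕜 b i s g)) (𝓝[≠] 0) (𝓝 (inner 𝕜 fj gi)) :=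
    tendsto_diffQ hgi fj
  -- With `∂ᵢg` replaced by a quotient, which does have a derivative `∂ⱼ`, two integrations by parts
  -- are legitimate: first in direction `j`, then discretely in direction `i`.
  have h2 : ∀ s, inner 𝕜 fj (diffQ 𝕜 b i s g) = inner 𝕜 (diffQ 𝕜 b i (-s) f) gj := by
    intro s
    rw [inner_weakPartial_swap hfj (isWeakPartial_diffQ hgj i s), inner_diffQ_left, neg_neg]
  simp only [h2] at h1
  have h3 := ((RCLike.continuous_conj (K := 𝕜)).tendsto _).comp (tendsto_diffQ_neg hfi gj)
  rw [inner_conj_symm] at h3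
  exact tendsto_nhds_unique h1 (h3.congr fun s => inner_conj_symm _ _)

end


/-! ### `H¹(Ω)` as a closed subspace, and vertical Green formulas on it. -/

section

variable {𝕜 : Type*} [RCLike 𝕜] {d : ℕ} {b : ℝ}

/-- The ambient Hilbert space of `H¹(Ω)`. -/
abbrev Amb (𝕜 : Type*) [RCLike 𝕜] (d : ℕ) (b : ℝ) : Type _ :=
  WithLp 2 (L2 𝕜 d b × PiLp 2 (fun _ : Fin (d + 1) => L2 𝕜 d b))

variable (𝕜 d b) in
/-- The function underlying an element of the ambient space, as a continuous linear map. -/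
noncomputable def ambVal : Amb 𝕜 d b →L[𝕜] L2 𝕜 d b := WithLp.fstL 2 𝕜 _ _

variable (𝕜 b) in
/-- The `i`-th entry of the gradient slot of the ambient space, as a continuous linear map. -/
noncomputable def ambGrad (i : Fin (d + 1)) : Amb 𝕜 d b →L[𝕜] L2 𝕜 d b :=
  (PiLp.proj 2 (fun _ : Fin (d + 1) => L2 𝕜 d b) i).comp (WithLp.sndL 2 𝕜 _ _)

theorem mem_H1_iff {w : Amb 𝕜 d b} :
    w ∈ H1 𝕜 d b ↔ ∀ i, IsWeakPartial d b i (ambVal 𝕜 d b w) (ambGrad 𝕜 b i w) := Iff.rfl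

theorem norm_sq_amb (w : Amb 𝕜 d b) :
    ‖w‖ ^ 2 = ‖ambVal 𝕜 d b w‖ ^ 2 + ∑ i, ‖ambGrad 𝕜 b i w‖ ^ 2 := by
  rw [WithLp.prod_norm_sq_eq_of_L2, PiLp.norm_sq_eq_of_L2]; rfl

theorem isClosed_H1 : IsClosed (H1 𝕜 d b : Set (Amb 𝕜 d b)) := by
  have : (H1 𝕜 d b : Set (Amb 𝕜 d b)) = ⋂ (i : Fin (d + 1)) (φ : TestFn d)
      (_ : tsupport φ ⊆ strip d b), {w | inner 𝕜 ((φ.partialD i).toL2 𝕜 b) (ambVal 𝕜 d b w)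
        = - inner 𝕜 (φ.toL2 𝕜 b) (ambGrad 𝕜 b i w)} := by
    ext w
    simp only [SetLike.mem_coe, mem_H1_iff, isWeakPartial_iff, mem_iInter, mem_ofPred_eq]
  rw [this]
  refine isClosed_iInter fun i => isClosed_iInter fun φ => isClosed_iInter fun _ => ?_
  exact isClosed_eq (by fun_prop) (by fun_prop)

instance : CompleteSpace (H1 𝕜 d b) := isClosed_H1.completeSpace_coe

variable (𝕜 b) in
/-- A test function with its gradient, as an element of the ambient space. -/
noncomputable def TestFn.toAmb (φ : TestFn d) : Amb 𝕜 d b :=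
  WithLp.toLp 2 (φ.toL2 𝕜 b, WithLp.toLp 2 fun i => (φ.partialD i).toL2 𝕜 b)

theorem TestFn.ambVal_toAmb (φ : TestFn d) : ambVal 𝕜 d b (φ.toAmb 𝕜 b) = φ.toL2 𝕜 b := rfl

theorem TestFn.ambGrad_toAmb (φ : TestFn d) (i : Fin (d + 1)) :
    ambGrad 𝕜 b i (φ.toAmb 𝕜 b) = (φ.partialD i).toL2 𝕜 b := rfl

theorem TestFn.toAmb_mem_H1 (φ : TestFn d) : φ.toAmb 𝕜 b ∈ H1 𝕜 d b := by
  rw [mem_H1_iff]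
  intro i
  rw [ambVal_toAmb, ambGrad_toAmb, isWeakPartial_iff]
  intro ψ hψ
  rw [inner_toL2_toL2, inner_toL2_toL2, ← RCLike.ofReal_neg]
  congr 1
  have h1 : ∀ (χ θ : TestFn d), tsupport χ ⊆ strip d b →
      ∫ x in strip d b, χ x * θ x = ∫ x, χ x * θ x := fun χ θ h =>
    setIntegral_eq_integral_of_forall_compl_eq_zero fun x hx => by
      rw [image_eq_zero_of_notMem_tsupport fun h' => hx (h h'), zero_mul]
  rw [h1 (ψ.partialD i) φ ((tsupport_dirDeriv_subset ψ _).trans hψ), h1 _ _ hψ]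
  have hint : ∀ χ : TestFn d, Integrable χ volume := fun χ =>
    χ.continuous.integrable_of_hasCompactSupport χ.compact
  have h2 := integral_mul_fderiv_eq_neg_fderiv_mul_of_integrable (μ := (volume : Measure (Space d)))
    (f := ψ) (g := φ) (v := basisVec d i) (hint ((ψ.partialD i).mul φ))
    (hint (ψ.mul (φ.partialD i))) (hint (ψ.mul φ))
    (fun x _ => (ψ.hasFDerivAt x).differentiableAt) (fun x _ => (φ.hasFDerivAt x).differentiableAt)
  exact (neg_eq_iff_eq_neg.2 h2).symm

/-! ### Vertical traces -/

variable (𝕜 b) in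
/-- A test function, its vertical derivative, and its restriction to `Σ₀`. -/
noncomputable def TestFn.vert (φ : TestFn d) : L2 𝕜 d b × L2 𝕜 d b × BdryL2 𝕜 d :=
  (φ.toL2 𝕜 b, (φ.partialD (Fin.last d)).toL2 𝕜 b, φ.bdry 𝕜)

variable (𝕜 d b) in
/-- The closure of the triples `(φ, ∂ₙφ, φ|_{Σ₀})` for test functions `φ`. -/
noncomputable def Vert : Submodule 𝕜 (L2 𝕜 d b × L2 𝕜 d b × BdryL2 𝕜 d) :=
  (Submodule.span 𝕜 (range (TestFn.vert (d := d) 𝕜 b))).topologicalClosure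

variable (𝕜 d b) in
/-- The closure of the pairs `(φ, ∂ₙφ)` for test functions `φ`. -/
noncomputable def VertPair : Submodule 𝕜 (L2 𝕜 d b × L2 𝕜 d b) :=
  (Submodule.span 𝕜 (range fun φ : TestFn d =>
    (φ.toL2 𝕜 b, (φ.partialD (Fin.last d)).toL2 𝕜 b))).topologicalClosure

/-- Green's formula with the weight `b - t`. -/
theorem Vert.inner_eq (hb : 0 < b) {p q : L2 𝕜 d b × L2 𝕜 d b × BdryL2 𝕜 d}
    (hp : p ∈ Vert 𝕜 d b) (hq : q ∈ Vert 𝕜 d b) :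
    inner 𝕜 p.1 q.1 = (b : 𝕜) * inner 𝕜 p.2.2 q.2.2
      + (b : 𝕜) * (inner 𝕜 p.2.1 q.1 + inner 𝕜 p.1 q.2.1)
      - inner 𝕜 (vmulL 𝕜 d b p.2.1) q.1 - inner 𝕜 (vmulL 𝕜 d b p.1) q.2.1 := by
  -- Closure in one slot at a time reduces to two test functions. There `b` times the unweighted
  -- formula minus the one with weight `t` cancels the top terms.
  refine mem_closure_span_induction (p := fun p : L2 𝕜 d b × L2 𝕜 d b × BdryL2 𝕜 d =>
    inner 𝕜 p.1 q.1 = (b : 𝕜) * inner 𝕜 p.2.2 q.2.2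
      + (b : 𝕜) * (inner 𝕜 p.2.1 q.1 + inner 𝕜 p.1 q.2.1)
      - inner 𝕜 (vmulL 𝕜 d b p.2.1) q.1 - inner 𝕜 (vmulL 𝕜 d b p.1) q.2.1)
    (isClosed_eq (by fun_prop) (by fun_prop)) (by simp) ?_ ?_ ?_ hp
  · intro x y hx hy
    simp only [Prod.fst_add, Prod.snd_add, map_add, inner_add_left, hx, hy]; ring
  · intro c x hx
    simp only [Prod.smul_fst, Prod.smul_snd, map_smul, inner_smul_left, hx]; ring
  rintro _ ⟨φ, rfl⟩
  refine mem_closure_span_induction (p := fun q : L2 𝕜 d b × L2 𝕜 d b × BdryL2 𝕜 d =>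
    inner 𝕜 (φ.vert 𝕜 b).1 q.1 = (b : 𝕜) * inner 𝕜 (φ.vert 𝕜 b).2.2 q.2.2
      + (b : 𝕜) * (inner 𝕜 (φ.vert 𝕜 b).2.1 q.1 + inner 𝕜 (φ.vert 𝕜 b).1 q.2.1)
      - inner 𝕜 (vmulL 𝕜 d b (φ.vert 𝕜 b).2.1) q.1
      - inner 𝕜 (vmulL 𝕜 d b (φ.vert 𝕜 b).1) q.2.1)
    (isClosed_eq (by fun_prop) (by fun_prop)) (by simp) ?_ ?_ ?_ hq
  · intro x y hx hy
    simp only [Prod.fst_add, Prod.snd_add, inner_add_right, hx, hy]; ring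
  · intro c x hx
    simp only [Prod.smul_fst, Prod.smul_snd, inner_smul_right, hx]; ring
  rintro _ ⟨ψ, rfl⟩
  have h1 := inner_add_inner_partialD (𝕜 := 𝕜) hb φ ψ
  have h2 := inner_add_inner_vmulL (𝕜 := 𝕜) hb φ ψ
  simp only [TestFn.vert]
  rw [h1]
  rw [RCLike.ofReal_mul] at h2
  linear_combination h2

theorem topPairing_eq_zero {φ : TestFn d} (hφ : tsupport φ ⊆ {x | x.2 < b}) (ψ : TestFn d) :
    topPairing b φ ψ = 0 := by
  have : ∀ y : Hor d, φ (y, b) = 0 := fun y =>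
    image_eq_zero_of_notMem_tsupport fun h => lt_irrefl b (hφ h)
  simp [topPairing, this]

theorem Vert.inner_test (hb : 0 < b) {p : L2 𝕜 d b × L2 𝕜 d b × BdryL2 𝕜 d}
    (hp : p ∈ Vert 𝕜 d b) {φ : TestFn d} (hφ : tsupport φ ⊆ {x | x.2 < b}) :
    inner 𝕜 ((φ.partialD (Fin.last d)).toL2 𝕜 b) p.1 + inner 𝕜 (φ.toL2 𝕜 b) p.2.1
      = - inner 𝕜 (φ.bdry 𝕜) p.2.2 := by
  refine mem_closure_span_induction (p := fun p : L2 𝕜 d b × L2 𝕜 d b × BdryL2 𝕜 d =>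
    inner 𝕜 ((φ.partialD (Fin.last d)).toL2 𝕜 b) p.1 + inner 𝕜 (φ.toL2 𝕜 b) p.2.1
      = - inner 𝕜 (φ.bdry 𝕜) p.2.2)
    (isClosed_eq (by fun_prop) (by fun_prop)) (by simp) ?_ ?_ ?_ hp
  · intro x y hx hy
    simp only [Prod.fst_add, Prod.snd_add, inner_add_right]
    linear_combination hx + hy
  · intro c x hx
    simp only [Prod.smul_fst, Prod.smul_snd, inner_smul_right]
    linear_combination c * hx
  rintro _ ⟨ψ, rfl⟩
  have h1 := inner_add_inner_partialD (𝕜 := 𝕜) hb φ ψ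
  rw [topPairing_eq_zero hφ, RCLike.ofReal_zero, zero_sub] at h1
  exact h1

theorem norm_sub_vmulL_le (hb : 0 < b) (f : L2 𝕜 d b) :
    ‖(b : 𝕜) • f - vmulL 𝕜 d b f‖ ≤ 2 * b * ‖f‖ := by
  refine (norm_sub_le _ _).trans ?_
  rw [norm_smul, RCLike.norm_ofReal, abs_of_pos hb]
  linarith [norm_vmulL_le hb f]

/-- Real part of Green's formula with both arguments equal, then Cauchy–Schwarz with the crude bound
`2b` for the weight. One half is a Poincaré inequality, the other bounds the trace. -/
theorem Vert.norm_sq_le (hb : 0 < b) {p : L2 𝕜 d b × L2 𝕜 d b × BdryL2 𝕜 d}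
    (hp : p ∈ Vert 𝕜 d b) : ‖p.1‖ ^ 2 ≤ b * ‖p.2.2‖ ^ 2 + 4 * b * ‖p.2.1‖ * ‖p.1‖
      ∧ b * ‖p.2.2‖ ^ 2 ≤ ‖p.1‖ ^ 2 + 4 * b * ‖p.2.1‖ * ‖p.1‖ := by
  have h := Vert.inner_eq hb hp hp
  set z : 𝕜 := inner 𝕜 ((b : 𝕜) • p.2.1 - vmulL 𝕜 d b p.2.1) p.1 with hz
  have hz' : conj z = (b : 𝕜) * inner 𝕜 p.1 p.2.1 - inner 𝕜 (vmulL 𝕜 d b p.1) p.2.1 := by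
    rw [hz, inner_conj_symm, inner_sub_right, inner_smul_right, inner_vmulL_left]
  have e : inner 𝕜 p.1 p.1 = (b : 𝕜) * inner 𝕜 p.2.2 p.2.2 + z + conj z := by
    rw [hz', hz, inner_sub_left, inner_smul_left, RCLike.conj_ofReal, h]; ring
  have e2 := congrArg RCLike.re e
  rw [inner_self_eq_norm_sq_to_K, inner_self_eq_norm_sq_to_K, map_add, map_add, RCLike.conj_re,
    ← RCLike.ofReal_pow, ← RCLike.ofReal_pow, ← RCLike.ofReal_mul, RCLike.ofReal_re,
    RCLike.ofReal_re] at e2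
  have hzn : |RCLike.re z| ≤ 2 * b * ‖p.2.1‖ * ‖p.1‖ :=
    (RCLike.abs_re_le_norm z).trans ((norm_inner_le_norm _ _).trans
      (mul_le_mul_of_nonneg_right (norm_sub_vmulL_le hb _) (norm_nonneg _)))
  have := abs_le.1 hzn
  constructor <;> linarith [this.1, this.2]

theorem le_of_sq_le_add {x a c : ℝ} (ha : 0 ≤ a) (hc : 0 ≤ c)
    (h : x ^ 2 ≤ c ^ 2 + a * x) : x ≤ a + c := by
  nlinarith [mul_nonneg ha hc]

theorem Vert.norm_le (hb : 0 < b) {p : L2 𝕜 d b × L2 𝕜 d b × BdryL2 𝕜 d}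
    (hp : p ∈ Vert 𝕜 d b) : ‖p.1‖ ≤ 4 * b * ‖p.2.1‖ + √b * ‖p.2.2‖ := by
  refine le_of_sq_le_add (by positivity) (by positivity) ?_
  rw [mul_pow, Real.sq_sqrt hb.le]
  exact (Vert.norm_sq_le hb hp).1

/-- A pairing with a test function vanishes if the vertical derivatives of its translates have
vanishing pairings until the support has left the strip. -/
theorem inner_eq_zero_of_shift (hb : 0 < b) {φ : TestFn d} (hφ : tsupport φ ⊆ strip d b)
    {σ : ℝ} (hσ : σ = 1 ∨ σ = -1) {f : L2 𝕜 d b}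
    (h : ∀ s ∈ Icc 0 b, inner 𝕜 (((φ.shift (0, s * σ)).partialD (Fin.last d)).toL2 𝕜 b) f = 0) :
    inner 𝕜 (φ.toL2 𝕜 b) f = 0 := by
  have e : ∀ s : ℝ, s • ((0, σ) : Space d) = (0, s * σ) := fun s => by simp
  have hd : ∀ s ∈ Icc 0 b, HasDerivAt
      (fun s : ℝ => inner 𝕜 ((φ.shift (0, s * σ)).toL2 𝕜 b) f) 0 s := by
    intro s hs
    have h1 := hasDerivAt_inner_shift φ (0, σ) f s
    simp only [e] at h1
    convert h1 using 1
    have h2 : inner 𝕜 (((φ.dirDeriv (0, σ)).shift (0, s * σ)).toL2 𝕜 b) f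
        = (σ : 𝕜) * inner 𝕜 (((φ.shift (0, s * σ)).partialD (Fin.last d)).toL2 𝕜 b) f := by
      rw [TestFn.partialD_shift, TestFn.inner_toL2, TestFn.inner_toL2, ← integral_const_mul]
      refine integral_congr_ae (Eventually.of_forall fun x => ?_)
      have h3 : ((0, σ) : Space d) = σ • basisVec d (Fin.last d) := by
        rw [basisVec_last]; simp
      simp only [TestFn.shift, TestFn.dirDeriv, TestFn.partialD, h3, map_smul,
        RCLike.real_smul_eq_coe_mul, smul_eq_mul, RCLike.ofReal_mul, mul_assoc]
    rw [h2, h s hs, mul_zero]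
  have h3 := (convex_Icc (0 : ℝ) b).norm_image_sub_le_of_norm_hasDerivWithin_le
    (f := fun s : ℝ => inner 𝕜 ((φ.shift (0, s * σ)).toL2 𝕜 b) f) (C := 0)
    (fun s hs => (hd s hs).hasDerivWithinAt) (fun s _ => by simp)
    (left_mem_Icc.2 hb.le) (right_mem_Icc.2 hb.le)
  replace h3 := h3.trans_eq (zero_mul _)
  rw [norm_le_zero_iff, sub_eq_zero] at h3
  -- After translation by the full height `b` the support is disjoint from the strip; the pairing is
  -- constant in `s`, so it was zero from the start.
  have h4 : inner 𝕜 ((φ.shift (0, b * σ)).toL2 𝕜 b) f = 0 := by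
    rw [TestFn.inner_toL2]
    refine setIntegral_eq_zero_of_forall_eq_zero fun x hx => ?_
    have : φ.shift (0, b * σ) x = 0 := by
      refine image_eq_zero_of_notMem_tsupport fun h => ?_
      rw [TestFn.tsupport_shift] at h
      have h1 : 0 < x.2 + b * σ ∧ x.2 + b * σ < b := hφ h
      rcases hσ with rfl | rfl
      · linarith [hx.1, h1.2]
      · linarith [hx.2, h1.1]
    rw [this, zero_smul]
  rw [h4] at h3
  simp only [zero_mul] at h3
  have h5 : φ.shift (0, 0) = φ := φ.shift_zero
  rw [h5] at h3
  exact h3.symm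

/-- The supports are pushed downwards through `Σ₀`, which keeps them below the top. -/
theorem eq_zero_of_inner_partialD_below (hb : 0 < b) {f : L2 𝕜 d b}
    (h : ∀ φ : TestFn d, tsupport φ ⊆ {x | x.2 < b} →
      inner 𝕜 ((φ.partialD (Fin.last d)).toL2 𝕜 b) f = 0) : f = 0 := by
  refine eq_zero_of_inner_test fun φ hφ => ?_
  refine inner_eq_zero_of_shift hb hφ (σ := 1) (Or.inl rfl) fun s hs => h _ ?_
  rw [TestFn.tsupport_shift]
  intro x hx
  have h1 : x.2 + s * 1 < b := (hφ hx).2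
  change x.2 < b
  linarith [hs.1]

/-- The supports are pushed upwards, which keeps them away from `Σ₀`. -/
theorem eq_zero_of_inner_partialD_above (hb : 0 < b) {f : L2 𝕜 d b}
    (h : ∀ φ : TestFn d, tsupport φ ⊆ {x | 0 < x.2} →
      inner 𝕜 ((φ.partialD (Fin.last d)).toL2 𝕜 b) f = 0) : f = 0 := by
  refine eq_zero_of_inner_test fun φ hφ => ?_
  refine inner_eq_zero_of_shift hb hφ (σ := -1) (Or.inr rfl) fun s hs => h _ ?_
  rw [TestFn.tsupport_shift]
  intro x hx
  have h1 : 0 < x.2 + s * -1 := (hφ hx).1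
  change 0 < x.2
  linarith [hs.1]

theorem eq_zero_of_inner_bdry {g : BdryL2 𝕜 d} (h : ∀ φ : TestFn d, inner 𝕜 (φ.bdry 𝕜) g = 0) :
    g = 0 := by
  have h1 := ae_eq_zero_of_integral_contDiff_smul_eq_zero (f := g) (μ := (volume : Measure (Hor d)))
    ((Lp.memLp g).locallyIntegrable (by norm_num)) (fun η hη hηc => by
      let χ : ContDiffBump (0 : ℝ) := ⟨1, 2, by positivity, by norm_num⟩
      let φ : TestFn d :=
        { toFun := fun x => η x.1 * χ x.2
          contDiff := (hη.comp contDiff_fst).mul (χ.contDiff.comp contDiff_snd)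
          compact := by
            refine HasCompactSupport.of_support_subset_isCompact
              (IsCompact.prod hηc χ.hasCompactSupport) fun x hx => ?_
            exact ⟨subset_tsupport _ (left_ne_zero_of_mul hx),
              subset_tsupport _ (right_ne_zero_of_mul hx)⟩ }
      have h2 := h φ
      rw [TestFn.inner_bdry] at h2
      rw [← h2]
      refine integral_congr_ae (Eventually.of_forall fun y => ?_)
      have : χ (0 : ℝ) = 1 := χ.one_of_mem_closedBall (Metric.mem_closedBall_self χ.rIn_pos.le)
      simp [φ, this])
  refine Lp.ext ?_
  filter_upwards [h1, Lp.coeFn_zero 𝕜 2 (volume : Measure (Hor d))] with x hx h0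
  rw [hx, h0]; rfl

/-- The vertical initial value problem `∂ₙf = F`, `f|_{Σ₀} = c`. By `Vert.norm_le` the projection of
`Vert` to the data `(F, c)` is bounded below, so its range is closed; it remains to see that the
range is dense. -/
theorem Vert.exists_mem (hb : 0 < b) (F : L2 𝕜 d b) (c : BdryL2 𝕜 d) :
    ∃ f, (f, F, c) ∈ Vert 𝕜 d b := by
  let π : Vert 𝕜 d b →L[𝕜] WithLp 2 (L2 𝕜 d b × BdryL2 𝕜 d) :=
    (WithLp.prodContinuousLinearEquiv 2 𝕜 (L2 𝕜 d b) (BdryL2 𝕜 d)).symm.toContinuousLinearMap.comp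
      ((ContinuousLinearMap.snd 𝕜 (L2 𝕜 d b) (L2 𝕜 d b × BdryL2 𝕜 d)).comp (Vert 𝕜 d b).subtypeL)
  have : CompleteSpace (Vert 𝕜 d b) :=
    (Submodule.isClosed_topologicalClosure _).completeSpace_coe
  have hanti : ∃ K, AntilipschitzWith K π := by
    refine ⟨⟨4 * b + √b + 1, by positivity⟩, AddMonoidHomClass.antilipschitz_of_bound π ?_⟩
    intro p
    have h1 : ‖p.1.2.1‖ ≤ ‖π p‖ := WithLp.norm_fst_le _ (π p)
    have h2 : ‖p.1.2.2‖ ≤ ‖π p‖ := WithLp.norm_snd_le _ (π p)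
    have h3 := Vert.norm_le hb p.2
    change ‖p.1‖ ≤ (4 * b + √b + 1) * ‖π p‖
    have hn := norm_nonneg (π p)
    have hs := Real.sqrt_nonneg b
    rw [Prod.norm_def, Prod.norm_def]
    have h4 : 4 * b * ‖p.1.2.1‖ ≤ 4 * b * ‖π p‖ := by gcongr
    have h5 : √b * ‖p.1.2.2‖ ≤ √b * ‖π p‖ := by gcongr
    have h6 : 0 ≤ 4 * b * ‖π p‖ := by positivity
    have h7 : 0 ≤ √b * ‖π p‖ := by positivity
    refine max_le (by linarith) (max_le (by linarith) (by linarith))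
  obtain ⟨K, hK⟩ := hanti
  have hcl : IsClosed (π.range : Set (WithLp 2 (L2 𝕜 d b × BdryL2 𝕜 d))) := by
    have h := hK.isClosed_range π.uniformContinuous
    rw [LinearMap.coe_range]
    exact h
  have htop : π.range = ⊤ := by
    have : CompleteSpace π.range := hcl.completeSpace_coe
    rw [← Submodule.orthogonal_eq_bot_iff, Submodule.eq_bot_iff]
    intro q hq
    rw [Submodule.mem_orthogonal] at hq
    have h1 : ∀ φ : TestFn d, inner 𝕜 ((φ.partialD (Fin.last d)).toL2 𝕜 b) q.fst
        + inner 𝕜 (φ.bdry 𝕜) q.snd = 0 := by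
      intro φ
      have := hq (π ⟨φ.vert 𝕜 b,
        Submodule.le_topologicalClosure _ (Submodule.subset_span ⟨φ, rfl⟩)⟩) ⟨_, rfl⟩
      rwa [WithLp.prod_inner_apply] at this
    -- Test functions that vanish near `Σ₀` and below it isolate the first component of the
    -- orthogonal vector; the second is then annihilated by all boundary values.
    have h2 : q.fst = 0 := by
      refine eq_zero_of_inner_partialD_above hb fun φ hφ => ?_
      have h3 := h1 φ
      have h4 : inner 𝕜 (φ.bdry 𝕜) q.snd = 0 := by
        rw [TestFn.inner_bdry]
        refine integral_eq_zero_of_ae (Eventually.of_forall fun y => ?_)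
        have : φ (y, 0) = 0 := image_eq_zero_of_notMem_tsupport fun h => lt_irrefl (0 : ℝ) (hφ h)
        simp [this]
      rwa [h4, add_zero] at h3
    have h3 : q.snd = 0 := by
      refine eq_zero_of_inner_bdry fun φ => ?_
      have := h1 φ
      rwa [h2, inner_zero_right, zero_add] at this
    exact (WithLp.ofLp_injective 2) (Prod.ext h2 h3)
  have hm : WithLp.toLp 2 (F, c) ∈ π.range := htop ▸ Submodule.mem_top
  obtain ⟨p, hp⟩ := hm
  refine ⟨p.1.1, ?_⟩
  have e : p.1.2 = (F, c) := congrArg WithLp.ofLp hp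
  rw [← e]
  exact p.2

/-- The element of `Vert` with the same vertical derivative and the same trace has the same
function: the difference is orthogonal to all `∂ₙφ` with `φ` supported below the top. This carries
Green's formulas over to `H¹(Ω)`. -/
theorem vert_mem (hb : 0 < b) (w : H1 𝕜 d b) :
    (ambVal 𝕜 d b w, ambGrad 𝕜 b (Fin.last d) w, trace hb w) ∈ Vert 𝕜 d b := by
  obtain ⟨f, hf⟩ := Vert.exists_mem hb (ambGrad 𝕜 b (Fin.last d) w) (trace hb w)
  have h : ambVal 𝕜 d b w - f = 0 := by
    refine eq_zero_of_inner_partialD_below hb fun φ hφ => ?_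
    have h1 := Vert.inner_test hb hf hφ
    have h2 := isTrace_iff.1 (trace_spec hb w) φ hφ
    rw [← h2] at h1
    rw [inner_sub_right, sub_eq_zero]
    exact (add_right_cancel h1).symm
  rwa [sub_eq_zero.1 h]

theorem Vert.pair_mem {p : L2 𝕜 d b × L2 𝕜 d b × BdryL2 𝕜 d} (hp : p ∈ Vert 𝕜 d b) :
    (p.1, p.2.1) ∈ VertPair 𝕜 d b := by
  refine mem_closure_span_induction (p := fun p : L2 𝕜 d b × L2 𝕜 d b × BdryL2 𝕜 d =>
    (p.1, p.2.1) ∈ VertPair 𝕜 d b) ?_ (Submodule.zero_mem _)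
    (fun x y hx hy => Submodule.add_mem _ hx hy) (fun c x hx => Submodule.smul_mem _ c hx) ?_ hp
  · exact (Submodule.isClosed_topologicalClosure _).preimage (by fun_prop)
  · rintro _ ⟨φ, rfl⟩
    exact Submodule.le_topologicalClosure _ (Submodule.subset_span ⟨φ, rfl⟩)

theorem VertPair.dilate_mem (hb : 0 < b) {p : L2 𝕜 d b × L2 𝕜 d b} (hp : p ∈ VertPair 𝕜 d b) :
    (dilateL 𝕜 d hb p.1, (2⁻¹ : 𝕜) • dilateL 𝕜 d hb p.2) ∈ VertPair 𝕜 d b := by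
  refine mem_closure_span_induction (p := fun p : L2 𝕜 d b × L2 𝕜 d b =>
    (dilateL 𝕜 d hb p.1, (2⁻¹ : 𝕜) • dilateL 𝕜 d hb p.2) ∈ VertPair 𝕜 d b) ?_ ?_ ?_ ?_ ?_ hp
  · exact (Submodule.isClosed_topologicalClosure _).preimage (by fun_prop)
  · simp only [Prod.fst_zero, Prod.snd_zero, map_zero, smul_zero]
    exact (VertPair 𝕜 d b).zero_mem
  · intro x y hx hy
    simpa using (VertPair 𝕜 d b).add_mem hx hy
  · intro c x hx
    have := (VertPair 𝕜 d b).smul_mem c hx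
    simpa [smul_comm c (2⁻¹ : 𝕜)] using this
  · rintro _ ⟨φ, rfl⟩
    refine Submodule.le_topologicalClosure _ (Submodule.subset_span ⟨φ.dilate b, ?_⟩)
    simp only [toL2_partialD_dilate hb, dilateL_toL2]

/-- Green's formula with the weight `t` for `f - S f`, which vanishes on top of the strip. -/
theorem VertPair.inner_dilate (hb : 0 < b) {p q : L2 𝕜 d b × L2 𝕜 d b}
    (hp : p ∈ VertPair 𝕜 d b) (hq : q ∈ VertPair 𝕜 d b) :
    inner 𝕜 (p.1 - dilateL 𝕜 d hb p.1) q.1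
      + inner 𝕜 (vmulL 𝕜 d b (p.2 - (2⁻¹ : 𝕜) • dilateL 𝕜 d hb p.2)) q.1
      + inner 𝕜 (vmulL 𝕜 d b (p.1 - dilateL 𝕜 d hb p.1)) q.2 = 0 := by
  refine mem_closure_span_induction (p := fun p : L2 𝕜 d b × L2 𝕜 d b =>
    inner 𝕜 (p.1 - dilateL 𝕜 d hb p.1) q.1
      + inner 𝕜 (vmulL 𝕜 d b (p.2 - (2⁻¹ : 𝕜) • dilateL 𝕜 d hb p.2)) q.1
      + inner 𝕜 (vmulL 𝕜 d b (p.1 - dilateL 𝕜 d hb p.1)) q.2 = 0)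
    (isClosed_eq (by fun_prop) (by fun_prop)) (by simp) ?_ ?_ ?_ hp
  · intro x y hx hy
    simp only [Prod.fst_add, Prod.snd_add, map_add, inner_add_left, smul_add, map_sub,
      inner_sub_left] at hx hy ⊢
    linear_combination hx + hy
  · intro c x hx
    simp only [Prod.smul_fst, Prod.smul_snd, map_smul, inner_smul_left, map_sub,
      inner_sub_left] at hx ⊢
    linear_combination conj c * hx
  rintro _ ⟨φ, rfl⟩
  refine mem_closure_span_induction (p := fun q : L2 𝕜 d b × L2 𝕜 d b =>
    inner 𝕜 (φ.toL2 𝕜 b - dilateL 𝕜 d hb (φ.toL2 𝕜 b)) q.1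
      + inner 𝕜 (vmulL 𝕜 d b ((φ.partialD (Fin.last d)).toL2 𝕜 b
        - (2⁻¹ : 𝕜) • dilateL 𝕜 d hb ((φ.partialD (Fin.last d)).toL2 𝕜 b))) q.1
      + inner 𝕜 (vmulL 𝕜 d b (φ.toL2 𝕜 b - dilateL 𝕜 d hb (φ.toL2 𝕜 b))) q.2 = 0)
    (isClosed_eq (by fun_prop) (by fun_prop)) (by simp) ?_ ?_ ?_ hq
  · intro x y hx hy
    simp only [Prod.fst_add, Prod.snd_add, inner_add_right]
    linear_combination hx + hy
  · intro c x hx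
    simp only [Prod.smul_fst, Prod.smul_snd, inner_smul_right]
    linear_combination c * hx
  rintro _ ⟨ψ, rfl⟩
  have h1 := inner_add_inner_vmulL (𝕜 := 𝕜) hb φ ψ
  -- `φ` and its dilate agree on top, so the top terms cancel in the difference of the two formulas.
  have h2 := inner_add_inner_vmulL (𝕜 := 𝕜) hb (φ.dilate b) ψ
  rw [topPairing_dilate, toL2_partialD_dilate hb, ← dilateL_toL2 hb] at h2
  simp only [map_sub, inner_sub_left] at h1 h2 ⊢
  linear_combination h1 - h2

end


/-! ### Boundedness of the trace, exchange of derivatives, Korn's inequality. -/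

section

variable {𝕜 : Type*} [RCLike 𝕜] {d : ℕ} {b : ℝ}

theorem norm_ambVal_le (w : Amb 𝕜 d b) : ‖ambVal 𝕜 d b w‖ ≤ ‖w‖ := by
  refine abs_le_of_sq_le_sq' ?_ (norm_nonneg _) |>.2
  rw [norm_sq_amb w]
  have : 0 ≤ ∑ i, ‖ambGrad 𝕜 b i w‖ ^ 2 := Finset.sum_nonneg fun _ _ => sq_nonneg _
  linarith

theorem norm_ambGrad_le (i : Fin (d + 1)) (w : Amb 𝕜 d b) : ‖ambGrad 𝕜 b i w‖ ≤ ‖w‖ := by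
  refine abs_le_of_sq_le_sq' ?_ (norm_nonneg _) |>.2
  rw [norm_sq_amb w]
  have : ‖ambGrad 𝕜 b i w‖ ^ 2 ≤ ∑ i, ‖ambGrad 𝕜 b i w‖ ^ 2 :=
    Finset.single_le_sum (f := fun i => ‖ambGrad 𝕜 b i w‖ ^ 2) (fun _ _ => sq_nonneg _)
      (Finset.mem_univ i)
  linarith [sq_nonneg ‖ambVal 𝕜 d b w‖]

theorem norm_trace_le (hb : 0 < b) (w : H1 𝕜 d b) : ‖trace hb w‖ ≤ √((1 + 4 * b) / b) * ‖w‖ := by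
  have h := (Vert.norm_sq_le hb (vert_mem hb w)).2
  simp only at h
  have h1 := norm_ambVal_le (w : Amb 𝕜 d b)
  have h2 := norm_ambGrad_le (Fin.last d) (w : Amb 𝕜 d b)
  have h3 : ‖ambVal 𝕜 d b w‖ ^ 2 ≤ ‖(w : Amb 𝕜 d b)‖ ^ 2 := by gcongr
  have h4 : 4 * b * ‖ambGrad 𝕜 b (Fin.last d) w‖ * ‖ambVal 𝕜 d b w‖
      ≤ 4 * b * ‖(w : Amb 𝕜 d b)‖ * ‖(w : Amb 𝕜 d b)‖ := by gcongr
  refine abs_le_of_sq_le_sq' ?_ (by positivity) |>.2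
  rw [mul_pow, Real.sq_sqrt (by positivity), div_mul_eq_mul_div, le_div_iff₀ hb]
  change ‖trace hb w‖ ^ 2 * b ≤ (1 + 4 * b) * ‖(w : Amb 𝕜 d b)‖ ^ 2
  linarith

variable (𝕜 d) in
/-- The trace as a continuous linear map. -/
noncomputable def traceL (hb : 0 < b) : H1 𝕜 d b →L[𝕜] BdryL2 𝕜 d :=
  LinearMap.mkContinuous
    { toFun := trace hb
      map_add' := trace_add hb
      map_smul' := trace_smul hb } _ (norm_trace_le hb)

theorem exists_diffQ_H1 (j : Fin d) (h : ℝ) (w : H1 𝕜 d b) :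
    ∃ w' : H1 𝕜 d b, ambVal 𝕜 d b w' = diffQ 𝕜 b j h (ambVal 𝕜 d b w) ∧
      ∀ i, ambGrad 𝕜 b i w' = diffQ 𝕜 b j h (ambGrad 𝕜 b i w) := by
  refine ⟨⟨WithLp.toLp 2 (diffQ 𝕜 b j h (ambVal 𝕜 d b w),
    WithLp.toLp 2 fun i => diffQ 𝕜 b j h (ambGrad 𝕜 b i w)), ?_⟩, rfl, fun i => rfl⟩
  exact fun i => isWeakPartial_diffQ (w.2 i) j h

theorem tendsto_inner_clm_diffQ {j : Fin d} {f g : L2 𝕜 d b}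
    (h : IsWeakPartial d b j.castSucc f g) (Q : L2 𝕜 d b →L[𝕜] L2 𝕜 d b) (y : L2 𝕜 d b) :
    Tendsto (fun s : ℝ => inner 𝕜 (Q (diffQ 𝕜 b j s f)) y) (𝓝[≠] 0) (𝓝 (inner 𝕜 (Q g) y)) := by
  have h2 := ((RCLike.continuous_conj (K := 𝕜)).tendsto _).comp
    (tendsto_diffQ h (ContinuousLinearMap.adjoint Q y))
  rw [inner_conj_symm, ContinuousLinearMap.adjoint_inner_right] at h2
  refine h2.congr fun s => ?_
  rw [Function.comp_apply, inner_conj_symm, ContinuousLinearMap.adjoint_inner_right]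

variable (𝕜 d b) in
/-- Multiplication by `b - t` on `L²(Ω)`, where `t` is the vertical coordinate. -/
noncomputable def covmulL : L2 𝕜 d b →L[𝕜] L2 𝕜 d b :=
  (b : 𝕜) • ContinuousLinearMap.id 𝕜 _ - vmulL 𝕜 d b

theorem covmulL_apply (f : L2 𝕜 d b) :
    covmulL 𝕜 d b f = (b : 𝕜) • f - vmulL 𝕜 d b f := rfl

theorem inner_covmulL_left (f g : L2 𝕜 d b) :
    inner 𝕜 (covmulL 𝕜 d b f) g = inner 𝕜 f (covmulL 𝕜 d b g) := by
  simp only [covmulL_apply, inner_sub_left, inner_sub_right, inner_smul_left, inner_smul_right,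
    inner_vmulL_left, RCLike.conj_ofReal]

theorem re_inner_covmulL (f : L2 𝕜 d b) : RCLike.re (inner 𝕜 (covmulL 𝕜 d b f) f)
    = b * ‖f‖ ^ 2 - RCLike.re (inner 𝕜 (vmulL 𝕜 d b f) f) := by
  rw [covmulL_apply, inner_sub_left, inner_smul_left, RCLike.conj_ofReal,
    inner_self_eq_norm_sq_to_K, map_sub, ← RCLike.ofReal_pow, ← RCLike.ofReal_mul,
    RCLike.ofReal_re]

theorem covmulL_diffQ (j : Fin d) (h : ℝ) (f : L2 𝕜 d b) :
    covmulL 𝕜 d b (diffQ 𝕜 b j h f) = diffQ 𝕜 b j h (covmulL 𝕜 d b f) := by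
  simp only [covmulL_apply, vmulL_diffQ, map_sub, map_smul]

/-! ### Exchange of vertical and horizontal derivatives -/

theorem inner_covmulL_cross (hb : 0 < b) (j : Fin d) (f g : H1 𝕜 d b) (hg : trace hb g = 0) :
    inner 𝕜 (covmulL 𝕜 d b (ambGrad 𝕜 b (Fin.last d) f)) (ambGrad 𝕜 b j.castSucc g)
      = inner 𝕜 (covmulL 𝕜 d b (ambGrad 𝕜 b j.castSucc f)) (ambGrad 𝕜 b (Fin.last d) g)
        - inner 𝕜 (ambGrad 𝕜 b j.castSucc f) (ambVal 𝕜 d b g) := by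
  have h1 := tendsto_diffQ_neg (g.2 j.castSucc) (covmulL 𝕜 d b (ambGrad 𝕜 b (Fin.last d) f))
  have h2 := (tendsto_inner_clm_diffQ (f.2 j.castSucc) (covmulL 𝕜 d b)
    (ambGrad 𝕜 b (Fin.last d) g)).sub
    (tendsto_inner_clm_diffQ (f.2 j.castSucc) (ContinuousLinearMap.id 𝕜 _) (ambVal 𝕜 d b g))
  refine tendsto_nhds_unique h1 (h2.congr fun s => ?_)
  obtain ⟨f', hf1, hf2⟩ := exists_diffQ_H1 j s f
  have h3 := Vert.inner_eq hb (vert_mem hb f') (vert_mem hb g)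
  simp only [hg, inner_zero_right, mul_zero, zero_add] at h3
  have h4 := inner_diffQ_left j s (covmulL 𝕜 d b (ambGrad 𝕜 b (Fin.last d) f)) (ambVal 𝕜 d b g)
  rw [← covmulL_diffQ, ← hf2] at h4
  change inner 𝕜 (covmulL 𝕜 d b (diffQ 𝕜 b j s (ambVal 𝕜 d b f))) _
    - inner 𝕜 (diffQ 𝕜 b j s (ambVal 𝕜 d b f)) _
      = inner 𝕜 _ (diffQ 𝕜 b j (-s) (ambVal 𝕜 d b g))
  rw [← hf1]
  simp only [covmulL_apply, inner_sub_left, inner_smul_left, RCLike.conj_ofReal] at h4 ⊢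
  linear_combination -h3 - h4

/-- `∂ₙ` and `∂ⱼ` trade places between `f - S f` and `g`. The weight `t` takes care of the bottom
and `f - S f` of the top, so `g` needs no boundary condition. -/
theorem inner_vmulL_cross (hb : 0 < b) (j : Fin d) (f g : H1 𝕜 d b) :
    inner 𝕜 (vmulL 𝕜 d b (ambGrad 𝕜 b (Fin.last d) f
        - (2⁻¹ : 𝕜) • dilateL 𝕜 d hb (ambGrad 𝕜 b (Fin.last d) f))) (ambGrad 𝕜 b j.castSucc g)
      = inner 𝕜 (ambGrad 𝕜 b j.castSucc f - dilateL 𝕜 d hb (ambGrad 𝕜 b j.castSucc f))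
          (ambVal 𝕜 d b g)
        + inner 𝕜 (vmulL 𝕜 d b (ambGrad 𝕜 b j.castSucc f
          - dilateL 𝕜 d hb (ambGrad 𝕜 b j.castSucc f))) (ambGrad 𝕜 b (Fin.last d) g) := by
  set Q : L2 𝕜 d b →L[𝕜] L2 𝕜 d b := ContinuousLinearMap.id 𝕜 _ - dilateL 𝕜 d hb
  have h1 := tendsto_diffQ_neg (g.2 j.castSucc) (vmulL 𝕜 d b (ambGrad 𝕜 b (Fin.last d) f
        - (2⁻¹ : 𝕜) • dilateL 𝕜 d hb (ambGrad 𝕜 b (Fin.last d) f)))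
  have h2 := (tendsto_inner_clm_diffQ (f.2 j.castSucc) Q (ambVal 𝕜 d b g)).add
    (tendsto_inner_clm_diffQ (f.2 j.castSucc) ((vmulL 𝕜 d b).comp Q)
      (ambGrad 𝕜 b (Fin.last d) g))
  refine tendsto_nhds_unique h1 (h2.congr fun s => ?_)
  -- The quotient of `f` is again in `H¹(Ω)`, so the Green formula applies to it; only in the limit
  -- does it become `∂ⱼf`.
  obtain ⟨f', hf1, hf2⟩ := exists_diffQ_H1 j s f
  have h3 := VertPair.inner_dilate hb (Vert.pair_mem (vert_mem hb f'))
    (Vert.pair_mem (vert_mem hb g))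
  have h4 := inner_diffQ_left j s (vmulL 𝕜 d b (ambGrad 𝕜 b (Fin.last d) f
        - (2⁻¹ : 𝕜) • dilateL 𝕜 d hb (ambGrad 𝕜 b (Fin.last d) f))) (ambVal 𝕜 d b g)
  rw [← vmulL_diffQ, map_sub (diffQ 𝕜 b j s), map_smul (diffQ 𝕜 b j s), ← dilateL_diffQ, ← hf2]
    at h4
  change inner 𝕜 (diffQ 𝕜 b j s (ambVal 𝕜 d b f) - dilateL 𝕜 d hb (diffQ 𝕜 b j s (ambVal 𝕜 d b f))) _
    + inner 𝕜 (vmulL 𝕜 d b (diffQ 𝕜 b j s (ambVal 𝕜 d b f)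
      - dilateL 𝕜 d hb (diffQ 𝕜 b j s (ambVal 𝕜 d b f)))) _
      = inner 𝕜 _ (diffQ 𝕜 b j (-s) (ambVal 𝕜 d b g))
  rw [← hf1]
  linear_combination h3 - h4

/-- The mirror image: here `g - S g` vanishes on top, and `f` enters through `Q f` with vertical
derivative `W`. Commutation with translations lets the quotient pass through `Q`. -/
theorem inner_vmulL_cross' (hb : 0 < b) (j : Fin d) (f g : H1 𝕜 d b)
    {Q : L2 𝕜 d b →L[𝕜] L2 𝕜 d b} (hQ : ∀ v f, Q (hshift 𝕜 b v f) = hshift 𝕜 b v (Q f))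
    {W : L2 𝕜 d b} (hW : (Q (ambVal 𝕜 d b f), W) ∈ VertPair 𝕜 d b) :
    inner 𝕜 (vmulL 𝕜 d b (ambGrad 𝕜 b j.castSucc g
        - dilateL 𝕜 d hb (ambGrad 𝕜 b j.castSucc g))) W
      = inner 𝕜 (ambVal 𝕜 d b g - dilateL 𝕜 d hb (ambVal 𝕜 d b g)) (Q (ambGrad 𝕜 b j.castSucc f))
        + inner 𝕜 (vmulL 𝕜 d b (ambGrad 𝕜 b (Fin.last d) g
          - (2⁻¹ : 𝕜) • dilateL 𝕜 d hb (ambGrad 𝕜 b (Fin.last d) g)))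
          (Q (ambGrad 𝕜 b j.castSucc f)) := by
  set R : L2 𝕜 d b →L[𝕜] L2 𝕜 d b := ContinuousLinearMap.id 𝕜 _ - dilateL 𝕜 d hb
  set z := ambVal 𝕜 d b g - dilateL 𝕜 d hb (ambVal 𝕜 d b g) with hz
  set Z := vmulL 𝕜 d b (ambGrad 𝕜 b (Fin.last d) g
    - (2⁻¹ : 𝕜) • dilateL 𝕜 d hb (ambGrad 𝕜 b (Fin.last d) g)) with hZ
  have h1 := tendsto_inner_clm_diffQ (g.2 j.castSucc) ((vmulL 𝕜 d b).comp R) W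
  have h0 := (tendsto_diffQ_neg (f.2 j.castSucc) (ContinuousLinearMap.adjoint Q z)).add
    (tendsto_diffQ_neg (f.2 j.castSucc) (ContinuousLinearMap.adjoint Q Z))
  simp only [ContinuousLinearMap.adjoint_inner_left] at h0
  refine tendsto_nhds_unique h1 (h0.congr fun s => ?_)
  obtain ⟨g', hg1, hg2⟩ := exists_diffQ_H1 j s g
  have h3 := VertPair.inner_dilate hb (Vert.pair_mem (vert_mem hb g')) hW
  simp only [hg1, hg2] at h3
  have h4 := inner_diffQ_left j s z (Q (ambVal 𝕜 d b f))
  have h5 := inner_diffQ_left j s Z (Q (ambVal 𝕜 d b f))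
  rw [hz, map_sub (diffQ 𝕜 b j s), ← dilateL_diffQ, ← hz] at h4
  rw [hZ, ← vmulL_diffQ, map_sub (diffQ 𝕜 b j s), map_smul (diffQ 𝕜 b j s), ← dilateL_diffQ,
    ← hZ] at h5
  rw [diffQ_comm_of_hshift hQ]
  change _ = inner 𝕜 (vmulL 𝕜 d b (diffQ 𝕜 b j s (ambVal 𝕜 d b g)
      - dilateL 𝕜 d hb (diffQ 𝕜 b j s (ambVal 𝕜 d b g)))) W
  change inner 𝕜 z (diffQ 𝕜 b j (-s) (Q (ambVal 𝕜 d b f)))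
    + inner 𝕜 Z (diffQ 𝕜 b j (-s) (Q (ambVal 𝕜 d b f))) = _
  linear_combination -h3 + h4 + h5

/-! ### Korn's inequality -/

theorem re_inner_add_add {M : L2 𝕜 d b →L[𝕜] L2 𝕜 d b}
    (hM : ∀ f g, inner 𝕜 (M f) g = inner 𝕜 f (M g)) (x y : L2 𝕜 d b) :
    RCLike.re (inner 𝕜 (M (x + y)) (x + y)) = RCLike.re (inner 𝕜 (M x) x)
      + RCLike.re (inner 𝕜 (M y) y) + 2 * RCLike.re (inner 𝕜 (M x) y) := by
  have h : RCLike.re (inner 𝕜 (M y) x) = RCLike.re (inner 𝕜 (M x) y) := by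
    rw [hM, inner_re_symm]
  simp only [map_add, inner_add_left, inner_add_right, h]; ring

theorem abs_re_inner_le {x y : L2 𝕜 d b} {A B : ℝ} (hx : ‖x‖ ≤ A) (hy : ‖y‖ ≤ B) :
    |RCLike.re (inner 𝕜 x y)| ≤ A * B :=
  (RCLike.abs_re_le_norm _).trans ((norm_inner_le_norm _ _).trans
    (mul_le_mul hx hy (norm_nonneg _) ((norm_nonneg _).trans hx)))

theorem norm_vmulL_le' (hb : 0 < b) {x : L2 𝕜 d b} {A : ℝ} (hx : ‖x‖ ≤ A) :
    ‖vmulL 𝕜 d b x‖ ≤ b * A :=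
  (norm_vmulL_le hb x).trans (mul_le_mul_of_nonneg_left hx hb.le)

theorem norm_sub_dilateL_le (hb : 0 < b) {x : L2 𝕜 d b} {A : ℝ} (hx : ‖x‖ ≤ A) :
    ‖x - dilateL 𝕜 d hb x‖ ≤ 3 * A := by
  refine (norm_sub_le _ _).trans ?_
  linarith [norm_dilateL_le hb x]

theorem norm_sub_half_dilateL_le (hb : 0 < b) {x : L2 𝕜 d b} {A : ℝ} (hx : ‖x‖ ≤ A) :
    ‖x - (2⁻¹ : 𝕜) • dilateL 𝕜 d hb x‖ ≤ 2 * A := by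
  refine (norm_sub_le _ _).trans ?_
  rw [norm_smul, norm_inv, RCLike.norm_ofNat]
  linarith [norm_dilateL_le hb x]

theorem norm_three_sub_two_dilateL_le (hb : 0 < b) {x : L2 𝕜 d b} {A : ℝ} (hx : ‖x‖ ≤ A) :
    ‖(3 : 𝕜) • x - (2 : 𝕜) • dilateL 𝕜 d hb x‖ ≤ 7 * A := by
  refine (norm_sub_le _ _).trans ?_
  rw [norm_smul, norm_smul, RCLike.norm_ofNat, RCLike.norm_ofNat]
  linarith [norm_dilateL_le hb x]

/-- The part of Korn's inequality with the weight `b - t`. -/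
theorem korn_bottom (hb : 0 < b) (j : Fin d) (f g : H1 𝕜 d b) (hg : trace hb g = 0) {N : ℝ}
    (hfj : ‖ambGrad 𝕜 b j.castSucc f‖ ≤ N) (hG : ‖ambGrad 𝕜 b (Fin.last d) g‖ ≤ N)
    (he : ‖ambGrad 𝕜 b (Fin.last d) f + ambGrad 𝕜 b j.castSucc g‖ ≤ N)
    (hg0 : ‖ambVal 𝕜 d b g‖ ≤ 2 * b * N) :
    RCLike.re (inner 𝕜 (covmulL 𝕜 d b (ambGrad 𝕜 b (Fin.last d) f)) (ambGrad 𝕜 b (Fin.last d) f))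
      + RCLike.re (inner 𝕜 (covmulL 𝕜 d b (ambGrad 𝕜 b j.castSucc g)) (ambGrad 𝕜 b j.castSucc g))
      ≤ 9 * b * N ^ 2 := by
  have h1 := re_inner_add_add (inner_covmulL_left (𝕜 := 𝕜) (d := d) (b := b))
    (ambGrad 𝕜 b (Fin.last d) f) (ambGrad 𝕜 b j.castSucc g)
  have h2 := congrArg RCLike.re (inner_covmulL_cross hb j f g hg)
  rw [map_sub] at h2
  have h3 := abs_re_inner_le (𝕜 := 𝕜) ((norm_sub_vmulL_le hb (ambGrad 𝕜 b j.castSucc f)).trans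
    (mul_le_mul_of_nonneg_left hfj (by positivity))) hG
  rw [← covmulL_apply] at h3
  have h4 := abs_re_inner_le (𝕜 := 𝕜) hfj hg0
  have h5 := re_inner_vmulL_nonneg (ambGrad 𝕜 b (Fin.last d) f + ambGrad 𝕜 b j.castSucc g)
  rw [re_inner_covmulL] at h1
  have h6 : b * ‖ambGrad 𝕜 b (Fin.last d) f + ambGrad 𝕜 b j.castSucc g‖ ^ 2 ≤ b * N ^ 2 := by
    gcongr
  have h7 := (abs_le.1 h3).1
  have h8 := (abs_le.1 h4).2
  -- The constant: `1` from the square of the sum, and `2 · (2 + 2)` from the two terms of the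
  -- exchanged product.
  nlinarith

/-- The part of Korn's inequality with the weight `t`, by reflection at the top of the strip. -/
theorem korn_top (hb : 0 < b) (j : Fin d) (f g : H1 𝕜 d b) {N : ℝ}
    (hfj : ‖ambGrad 𝕜 b j.castSucc f‖ ≤ N) (hG : ‖ambGrad 𝕜 b (Fin.last d) g‖ ≤ N)
    (he : ‖ambGrad 𝕜 b (Fin.last d) f + ambGrad 𝕜 b j.castSucc g‖ ≤ N)
    (hg0 : ‖ambVal 𝕜 d b g‖ ≤ 2 * b * N) :
    RCLike.re (inner 𝕜 (vmulL 𝕜 d b (ambGrad 𝕜 b (Fin.last d) f)) (ambGrad 𝕜 b (Fin.last d) f))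
      + RCLike.re (inner 𝕜 (vmulL 𝕜 d b (ambGrad 𝕜 b j.castSucc g)) (ambGrad 𝕜 b j.castSucc g))
      ≤ 474 * b * N ^ 2 := by
  set F := ambGrad 𝕜 b (Fin.last d) f with hF
  set gj := ambGrad 𝕜 b j.castSucc g with hgj
  set fj := ambGrad 𝕜 b j.castSucc f
  set G := ambGrad 𝕜 b (Fin.last d) g
  set S := dilateL 𝕜 d hb
  set M := vmulL 𝕜 d b
  -- Nitsche's extension: `-3f + 4Sf` and `3g - 2Sg` agree with `f` and `g` on top. Here `W` is the
  -- vertical derivative of the former and `v` the `j`-th derivative of the latter. Unfolding across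
  -- the top reverses `∂ₙ`, hence `-W`; the coefficients are such that `-W + v` depends on `F + gj`
  -- only.
  set W := (-3 : 𝕜) • F + (2 : 𝕜) • S F with hW
  set v := (3 : 𝕜) • gj - (2 : 𝕜) • S gj with hv
  have hMs : ∀ f g, inner 𝕜 (M f) g = inner 𝕜 f (M g) := inner_vmulL_left
  have h1 := re_inner_add_add hMs F gj
  have h2 := re_inner_add_add hMs (-W) v
  have e1 : -W + v = (3 : 𝕜) • (F + gj) - (2 : 𝕜) • S (F + gj) := by
    rw [hW, hv, map_add]; module
  have n1 : RCLike.re (inner 𝕜 (M (F + gj)) (F + gj)) ≤ b * N * N :=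
    (le_abs_self _).trans (abs_re_inner_le (norm_vmulL_le' hb he) he)
  have n2 : RCLike.re (inner 𝕜 (M (-W + v)) (-W + v)) ≤ b * (7 * N) * (7 * N) := by
    rw [e1]
    exact (le_abs_self _).trans (abs_re_inner_le
      (norm_vmulL_le' hb (norm_three_sub_two_dilateL_le hb he))
      (norm_three_sub_two_dilateL_le hb he))
  have p1 : 0 ≤ RCLike.re (inner 𝕜 (M (-W)) (-W)) := re_inner_vmulL_nonneg _
  have p2 : 0 ≤ RCLike.re (inner 𝕜 (M v) v) := re_inner_vmulL_nonneg _
  -- The products on the strip and on its mirror image recombine so that each remaining one contains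
  -- a derivative of `f - S f` or of `g - S g`, to which the exchange formulas apply.
  have e2 : inner 𝕜 (M F) gj + inner 𝕜 (M (-W)) v
      = 4 * inner 𝕜 (M (F - (2⁻¹ : 𝕜) • S F)) gj - 2 * inner 𝕜 (M W) (gj - S gj) := by
    have h4 : inner 𝕜 (M W) v = inner 𝕜 (M W) gj + 2 * inner 𝕜 (M W) (gj - S gj) := by
      rw [hv]
      simp only [inner_sub_right, inner_smul_right]; ring
    have h5 : inner 𝕜 (M W) gj = -3 * inner 𝕜 (M F) gj + 2 * inner 𝕜 (M (S F)) gj := by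
      rw [hW]
      simp only [map_add, map_smul, inner_add_left, inner_smul_left, map_neg, map_ofNat]
    have h6 : inner 𝕜 (M (F - (2⁻¹ : 𝕜) • S F)) gj
        = inner 𝕜 (M F) gj - 2⁻¹ * inner 𝕜 (M (S F)) gj := by
      simp only [map_sub, map_smul, inner_sub_left, inner_smul_left, map_inv₀, map_ofNat]
    rw [map_neg, inner_neg_left, h4, h5, h6]
    ring
  have c1 := inner_vmulL_cross hb j f g
  -- The coefficient `4` here turns into the `2` in `W`, because `∂ₙ(S f) = ½ S(∂ₙf)`.
  set Q : L2 𝕜 d b →L[𝕜] L2 𝕜 d b := (-3 : 𝕜) • ContinuousLinearMap.id 𝕜 _ + (4 : 𝕜) • S with hQd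
  have hQ : ∀ v f, Q (hshift 𝕜 b v f) = hshift 𝕜 b v (Q f) := by
    intro v f
    change (-3 : 𝕜) • hshift 𝕜 b v f + (4 : 𝕜) • S (hshift 𝕜 b v f)
      = hshift 𝕜 b v ((-3 : 𝕜) • f + (4 : 𝕜) • S f)
    rw [map_add, map_smul, map_smul, dilateL_hshift]
  have hWm : (Q (ambVal 𝕜 d b f), W) ∈ VertPair 𝕜 d b := by
    have m1 := Vert.pair_mem (vert_mem hb f)
    have m2 := VertPair.dilate_mem hb m1
    have m3 := (VertPair 𝕜 d b).add_mem ((VertPair 𝕜 d b).smul_mem (-3) m1)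
      ((VertPair 𝕜 d b).smul_mem 4 m2)
    have e : (Q (ambVal 𝕜 d b f), W) = (-3 : 𝕜) • (ambVal 𝕜 d b f, F)
        + (4 : 𝕜) • (S (ambVal 𝕜 d b f), (2⁻¹ : 𝕜) • S F) := by
      refine Prod.ext rfl ?_
      change W = (-3 : 𝕜) • F + (4 : 𝕜) • (2⁻¹ : 𝕜) • S F
      rw [hW, smul_smul]; norm_num
    rw [e]
    exact m3
  have c2 := inner_vmulL_cross' hb j f g hQ hWm
  have hQn : ‖Q fj‖ ≤ 11 * N := by
    change ‖(-3 : 𝕜) • fj + (4 : 𝕜) • S fj‖ ≤ 11 * N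
    refine (norm_add_le _ _).trans ?_
    rw [norm_smul, norm_smul, norm_neg, RCLike.norm_ofNat, RCLike.norm_ofNat]
    linarith [norm_dilateL_le hb fj]
  have r1 : |RCLike.re (inner 𝕜 (M (F - (2⁻¹ : 𝕜) • S F)) gj)| ≤ 9 * b * N ^ 2 := by
    rw [c1, map_add]
    have a1 := abs_re_inner_le (𝕜 := 𝕜) (norm_sub_dilateL_le hb hfj) hg0
    have a2 := abs_re_inner_le (𝕜 := 𝕜) (norm_vmulL_le' hb (norm_sub_dilateL_le hb hfj)) hG
    refine (abs_add_le _ _).trans ((add_le_add a1 a2).trans (le_of_eq ?_))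
    ring
  have r2 : |RCLike.re (inner 𝕜 (M W) (gj - S gj))| ≤ 88 * b * N ^ 2 := by
    rw [hMs, inner_re_symm, c2, map_add]
    have a1 := abs_re_inner_le (𝕜 := 𝕜) (norm_sub_dilateL_le hb hg0) hQn
    have a2 := abs_re_inner_le (𝕜 := 𝕜) (norm_vmulL_le' hb (norm_sub_half_dilateL_le hb hG)) hQn
    refine (abs_add_le _ _).trans ((add_le_add a1 a2).trans (le_of_eq ?_))
    ring
  have e3 := congrArg RCLike.re e2
  have re4 : ∀ z : 𝕜, RCLike.re (4 * z) = 4 * RCLike.re z := fun z => by simp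
  have re2 : ∀ z : 𝕜, RCLike.re (2 * z) = 2 * RCLike.re z := fun z => by simp
  rw [map_add, map_sub, re4, re2] at e3
  have := (abs_le.1 r1).1
  have := (abs_le.1 r2).2
  -- The constant: `1 + 7²` from the squares of the sums, and `2 · (4 · 9 + 2 · 88)` from the
  -- products.
  nlinarith

/-- The weights `b - t` and `t` add up to the constant `b`, so the two estimates give `b` times the
full squares; `9 + 474 ≤ 22²`. -/
theorem korn_cross (hb : 0 < b) (j : Fin d) (f g : H1 𝕜 d b) (hg : trace hb g = 0) {N : ℝ}
    (hfj : ‖ambGrad 𝕜 b j.castSucc f‖ ≤ N) (hG : ‖ambGrad 𝕜 b (Fin.last d) g‖ ≤ N)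
    (he : ‖ambGrad 𝕜 b (Fin.last d) f + ambGrad 𝕜 b j.castSucc g‖ ≤ N)
    (hg0 : ‖ambVal 𝕜 d b g‖ ≤ 2 * b * N) :
    ‖ambGrad 𝕜 b (Fin.last d) f‖ ≤ 22 * N ∧ ‖ambGrad 𝕜 b j.castSucc g‖ ≤ 22 * N := by
  have hN : 0 ≤ N := (norm_nonneg _).trans hfj
  have h1 := korn_bottom hb j f g hg hfj hG he hg0
  have h2 := korn_top hb j f g hfj hG he hg0
  rw [re_inner_covmulL, re_inner_covmulL] at h1
  have h3 : b * (‖ambGrad 𝕜 b (Fin.last d) f‖ ^ 2 + ‖ambGrad 𝕜 b j.castSucc g‖ ^ 2)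
      ≤ b * (22 * N) ^ 2 := by nlinarith [mul_nonneg hb.le (sq_nonneg N)]
  have h4 := le_of_mul_le_mul_left h3 hb
  constructor
  · refine abs_le_of_sq_le_sq' ?_ (by positivity) |>.2
    linarith [sq_nonneg ‖ambGrad 𝕜 b j.castSucc g‖]
  · refine abs_le_of_sq_le_sq' ?_ (by positivity) |>.2
    linarith [sq_nonneg ‖ambGrad 𝕜 b (Fin.last d) f‖]

/-- The quantity `∑ᵢⱼ ‖(𝔻u)ᵢⱼ‖² + ∑ᵢ ‖uᵢ|_{Σ₀}‖²` that controls the `H¹` norm. -/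
noncomputable def kornEnergy (hb : 0 < b) (u : VecH1 𝕜 d b) : ℝ :=
  (∑ i, ∑ j, ‖symGrad u i j‖ ^ 2) + ∑ i, ‖trace hb (u i)‖ ^ 2

theorem norm_symGrad_le (hb : 0 < b) (u : VecH1 𝕜 d b) (i j : Fin (d + 1)) :
    ‖symGrad u i j‖ ≤ √(kornEnergy hb u) := by
  refine Real.le_sqrt_of_sq_le ?_
  have h1 : ‖symGrad u i j‖ ^ 2 ≤ ∑ j, ‖symGrad u i j‖ ^ 2 :=
    Finset.single_le_sum (f := fun j => ‖symGrad u i j‖ ^ 2) (fun _ _ => sq_nonneg _)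
      (Finset.mem_univ j)
  have h2 : ∑ j, ‖symGrad u i j‖ ^ 2 ≤ ∑ i, ∑ j, ‖symGrad u i j‖ ^ 2 :=
    Finset.single_le_sum (f := fun i => ∑ j, ‖symGrad u i j‖ ^ 2)
      (fun _ _ => Finset.sum_nonneg fun _ _ => sq_nonneg _) (Finset.mem_univ i)
  have h3 : 0 ≤ ∑ i, ‖trace hb (u i)‖ ^ 2 := Finset.sum_nonneg fun _ _ => sq_nonneg _
  unfold kornEnergy
  linarith

theorem norm_trace_le_korn (hb : 0 < b) (u : VecH1 𝕜 d b) (i : Fin (d + 1)) :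
    ‖trace hb (u i)‖ ≤ √(kornEnergy hb u) := by
  refine Real.le_sqrt_of_sq_le ?_
  have h1 : ‖trace hb (u i)‖ ^ 2 ≤ ∑ i, ‖trace hb (u i)‖ ^ 2 :=
    Finset.single_le_sum (f := fun i => ‖trace hb (u i)‖ ^ 2) (fun _ _ => sq_nonneg _)
      (Finset.mem_univ i)
  have h2 : 0 ≤ ∑ i, ∑ j, ‖symGrad u i j‖ ^ 2 :=
    Finset.sum_nonneg fun _ _ => Finset.sum_nonneg fun _ _ => sq_nonneg _
  unfold kornEnergy
  linarith

/-- Expanding `‖∂ⱼuᵢ + ∂ᵢuⱼ‖²` and exchanging derivatives turns the sum of the mixed terms into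
`2‖∑ᵢ ∂ᵢuᵢ‖²`, which has the good sign. -/
theorem korn_horizontal (hb : 0 < b) (u : VecH1 𝕜 d b) (i j : Fin d) :
    ‖partialDeriv j.castSucc u i.castSucc‖ ≤ √(kornEnergy hb u) := by
  refine Real.le_sqrt_of_sq_le ?_
  set p : Fin d → Fin d → L2 𝕜 d b := fun i j => partialDeriv j.castSucc u i.castSucc with hp
  have h1 : ∑ i : Fin d, ∑ j : Fin d, ‖symGrad u i.castSucc j.castSucc‖ ^ 2 ≤ kornEnergy hb u := by
    have a1 : ∀ i : Fin (d + 1), ∑ j : Fin d, ‖symGrad u i j.castSucc‖ ^ 2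
        ≤ ∑ j, ‖symGrad u i j‖ ^ 2 := fun i => by
      rw [Fin.sum_univ_castSucc (fun j => ‖symGrad u i j‖ ^ 2)]
      linarith [sq_nonneg ‖symGrad u i (Fin.last d)‖]
    have a2 : ∑ i : Fin d, ∑ j, ‖symGrad u i.castSucc j‖ ^ 2 ≤ ∑ i, ∑ j, ‖symGrad u i j‖ ^ 2 := by
      rw [Fin.sum_univ_castSucc (fun i => ∑ j, ‖symGrad u i j‖ ^ 2)]
      have : 0 ≤ ∑ j, ‖symGrad u (Fin.last d) j‖ ^ 2 := Finset.sum_nonneg fun _ _ => sq_nonneg _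
      linarith
    have a3 : 0 ≤ ∑ i, ‖trace hb (u i)‖ ^ 2 := Finset.sum_nonneg fun _ _ => sq_nonneg _
    have a4 := Finset.sum_le_sum fun (i : Fin d) (_ : i ∈ Finset.univ) => a1 i.castSucc
    unfold kornEnergy
    linarith
  have h2 : ∀ i j : Fin d, ‖symGrad u i.castSucc j.castSucc‖ ^ 2
      = ‖p i j‖ ^ 2 + ‖p j i‖ ^ 2 + 2 * RCLike.re (inner 𝕜 (p i i) (p j j)) := by
    intro i j
    have a : inner 𝕜 (p i j) (p j i) = inner 𝕜 (p i i) (p j j) :=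
      inner_partial_partial_swap ((u i.castSucc).2 i.castSucc) ((u i.castSucc).2 j.castSucc)
        ((u j.castSucc).2 i.castSucc) ((u j.castSucc).2 j.castSucc)
    rw [← a]
    have := norm_add_sq (𝕜 := 𝕜) (p i j) (p j i)
    change ‖p i j + p j i‖ ^ 2 = _
    linarith
  have h3 : 0 ≤ ∑ i, ∑ j, RCLike.re (inner 𝕜 (p i i) (p j j)) := by
    have : ∑ i, ∑ j, RCLike.re (inner 𝕜 (p i i) (p j j))
        = RCLike.re (inner 𝕜 (∑ i, p i i) (∑ j, p j j)) := by
      simp only [sum_inner, inner_sum, map_sum]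
      exact Finset.sum_comm
    rw [this]
    exact inner_self_nonneg
  have h4 : ∑ i, ∑ j, ‖p i j‖ ^ 2 ≤ kornEnergy hb u := by
    refine le_trans ?_ h1
    simp only [h2, Finset.sum_add_distrib, ← Finset.mul_sum]
    have : 0 ≤ ∑ i, ∑ j, ‖p j i‖ ^ 2 :=
      Finset.sum_nonneg fun _ _ => Finset.sum_nonneg fun _ _ => sq_nonneg _
    linarith
  have h5 : ‖p i j‖ ^ 2 ≤ ∑ j, ‖p i j‖ ^ 2 :=
    Finset.single_le_sum (f := fun j => ‖p i j‖ ^ 2) (fun _ _ => sq_nonneg _) (Finset.mem_univ j)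
  have h6 : ∑ j, ‖p i j‖ ^ 2 ≤ ∑ i, ∑ j, ‖p i j‖ ^ 2 :=
    Finset.single_le_sum (f := fun i => ∑ j, ‖p i j‖ ^ 2)
      (fun _ _ => Finset.sum_nonneg fun _ _ => sq_nonneg _) (Finset.mem_univ i)
  exact h5.trans (h6.trans h4)

/-- Korn's inequality on the strip for fields that are tangential on `Σ₀`. -/
theorem korn (hb : 0 < b) (u : VecH1 𝕜 d b) (hu : trace hb (u (Fin.last d)) = 0) :
    (∀ i j, ‖partialDeriv j u i‖ ≤ (22 + 88 * b + √b) * √(kornEnergy hb u)) ∧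
      ∀ i, ‖component u i‖ ≤ (22 + 88 * b + √b) * √(kornEnergy hb u) := by
  set N := √(kornEnergy hb u) with hN
  have hN0 : 0 ≤ N := Real.sqrt_nonneg _
  have hsb : 0 ≤ √b := Real.sqrt_nonneg b
  have hbN : 0 ≤ b * N := by positivity
  have hsN : 0 ≤ √b * N := by positivity
  -- The diagonal entry of `𝔻u` is `2∂ₙuₙ`. As `uₙ` has zero trace, the Poincaré inequality then
  -- bounds `uₙ` itself, as the cross estimate requires.
  have hnn : ‖partialDeriv (Fin.last d) u (Fin.last d)‖ ≤ N / 2 := by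
    have h := norm_symGrad_le hb u (Fin.last d) (Fin.last d)
    rw [symGrad, ← two_smul 𝕜, norm_smul, RCLike.norm_ofNat] at h
    linarith
  have hn : ‖component u (Fin.last d)‖ ≤ 2 * b * N := by
    have h := Vert.norm_le hb (vert_mem hb (u (Fin.last d)))
    simp only [hu, norm_zero, mul_zero, add_zero] at h
    have : 4 * b * ‖ambGrad 𝕜 b (Fin.last d) (u (Fin.last d))‖ ≤ 4 * b * (N / 2) :=
      mul_le_mul_of_nonneg_left hnn (by positivity)
    have h' : ‖component u (Fin.last d)‖ ≤ 4 * b * (N / 2) := h.trans this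
    linarith
  have hcross : ∀ i : Fin d, ‖partialDeriv (Fin.last d) u i.castSucc‖ ≤ 22 * N ∧
      ‖partialDeriv i.castSucc u (Fin.last d)‖ ≤ 22 * N := fun i =>
    korn_cross hb i (u i.castSucc) (u (Fin.last d)) hu (korn_horizontal hb u i i)
      (hnn.trans (by linarith)) (norm_symGrad_le hb u i.castSucc (Fin.last d)) hn
  constructor
  · intro i j
    refine Fin.lastCases ?_ (fun i => ?_) i <;> refine Fin.lastCases ?_ (fun j => ?_) j
    · linarith
    · linarith [(hcross j).2]
    · linarith [(hcross i).1]
    · linarith [korn_horizontal hb u i j]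
  · intro i
    refine Fin.lastCases ?_ (fun i => ?_) i
    · linarith
    · have h := Vert.norm_le hb (vert_mem hb (u i.castSucc))
      simp only at h
      have h1 : 4 * b * ‖ambGrad 𝕜 b (Fin.last d) (u i.castSucc)‖ ≤ 4 * b * (22 * N) :=
        mul_le_mul_of_nonneg_left (hcross i).1 (by positivity)
      have h2 : √b * ‖trace hb (u i.castSucc)‖ ≤ √b * N :=
        mul_le_mul_of_nonneg_left (norm_trace_le_korn hb u _) hsb
      have h3 : ‖component u i.castSucc‖ ≤ 4 * b * (22 * N) + √b * N :=
        h.trans (add_le_add h1 h2)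
      linarith

end


/-! ### Coercive operators. -/

section Hilbert

variable {𝕜 : Type*} [RCLike 𝕜] {E : Type*} [NormedAddCommGroup E] [InnerProductSpace 𝕜 E]
  [CompleteSpace E]

/-- The Lax–Milgram theorem. -/
theorem bijective_of_coercive (A : E →L[𝕜] E) {c : ℝ} (hc : 0 < c)
    (h : ∀ x, c * ‖x‖ ^ 2 ≤ RCLike.re (inner 𝕜 x (A x))) : Function.Bijective A := by
  have hb : ∀ x, ‖x‖ ≤ c⁻¹ * ‖A x‖ := by
    intro x
    have h1 := (h x).trans ((RCLike.re_le_norm _).trans (norm_inner_le_norm x (A x)))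
    rcases (norm_nonneg x).eq_or_lt with h0 | h0
    · rw [← h0]; positivity
    · rw [le_inv_mul_iff₀ hc]
      refine le_of_mul_le_mul_left ?_ h0
      linarith
  have hanti : AntilipschitzWith ⟨c⁻¹, by positivity⟩ A :=
    AddMonoidHomClass.antilipschitz_of_bound A hb
  refine ⟨hanti.injective, ?_⟩
  have hcl : IsClosed (A.range : Set E) := by
    rw [LinearMap.coe_range]
    exact hanti.isClosed_range A.uniformContinuous
  have htop : A.range = ⊤ := by
    have : CompleteSpace A.range := hcl.completeSpace_coe
    rw [← Submodule.orthogonal_eq_bot_iff, Submodule.eq_bot_iff]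
    intro q hq
    rw [Submodule.mem_orthogonal] at hq
    -- A vector orthogonal to the range is in particular orthogonal to its own image, so coercivity
    -- makes it zero.
    have h1 := hq (A q) ⟨q, rfl⟩
    have h2 := h q
    rw [← inner_conj_symm, h1, map_zero, map_zero] at h2
    have h3 : ‖q‖ ^ 2 ≤ 0 := by nlinarith
    exact norm_eq_zero.1 (pow_eq_zero_iff (two_ne_zero) |>.1 (le_antisymm h3 (sq_nonneg _)))
  exact LinearMap.range_eq_top.1 htop

end Hilbert

/-! ### The mixed Poisson problem and surjectivity of the divergence. -/

section

variable {𝕜 : Type*} [RCLike 𝕜] {d : ℕ} {b : ℝ}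

theorem TestFn.partialD_comm (φ : TestFn d) (i k : Fin (d + 1)) :
    (φ.partialD i).partialD k = (φ.partialD k).partialD i := by
  have h : ∀ (i k : Fin (d + 1)) (x : Space d), (φ.partialD i).partialD k x
      = fderiv ℝ (fderiv ℝ φ) x (basisVec d k) (basisVec d i) := by
    intro i k x
    have hd : DifferentiableAt ℝ (fderiv ℝ φ) x :=
      (φ.contDiff.fderiv_right (m := 1) (by norm_cast)).differentiable (by simp) x
    change fderiv ℝ (fun y => fderiv ℝ φ y (basisVec d i)) x (basisVec d k) = _
    rw [fderiv_clm_apply hd (differentiableAt_const _)]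
    simp
  have hsymm : ∀ x, (φ.partialD i).partialD k x = (φ.partialD k).partialD i x := by
    intro x
    rw [h, h]
    exact (φ.contDiff.contDiffAt.isSymmSndFDerivAt (by
      rw [minSmoothness_of_isRCLikeNormedField]; norm_cast)) _ _
  have e : ((φ.partialD i).partialD k).toFun = ((φ.partialD k).partialD i).toFun := funext hsymm
  generalize (φ.partialD i).partialD k = p at e
  generalize (φ.partialD k).partialD i = q at e
  cases p; cases q; cases e; rfl

/-- Both mixed derivatives are `f` tested with the same second derivative of `φ`. The existence of
one order therefore gives the other. -/
theorem isWeakPartial_swap {i k : Fin (d + 1)} {f fi fk h : L2 𝕜 d b}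
    (hi : IsWeakPartial d b i f fi) (hk : IsWeakPartial d b k f fk)
    (hh : IsWeakPartial d b i fk h) : IsWeakPartial d b k fi h := by
  rw [isWeakPartial_iff] at *
  intro φ hφ
  have h1 := hi (φ.partialD k) ((TestFn.tsupport_dirDeriv_subset _ _).trans hφ)
  have h2 := hk (φ.partialD i) ((TestFn.tsupport_dirDeriv_subset _ _).trans hφ)
  have h3 := hh φ hφ
  rw [TestFn.partialD_comm] at h1
  rw [← neg_eq_iff_eq_neg.2 h1, h2, h3, neg_neg]

/-! ### The mixed Poisson problem -/

variable (𝕜 d b) in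
/-- The elements of `H¹(Ω)` that vanish on top of the strip. -/
noncomputable def TopH1 : Submodule 𝕜 (Amb 𝕜 d b) :=
  (Submodule.span 𝕜 {w | ∃ φ : TestFn d, tsupport φ ⊆ {x | x.2 < b} ∧
    φ.toAmb 𝕜 b = w}).topologicalClosure

instance : CompleteSpace (TopH1 𝕜 d b) :=
  (Submodule.isClosed_topologicalClosure _).completeSpace_coe

theorem TestFn.toAmb_mem_topH1 {φ : TestFn d} (hφ : tsupport φ ⊆ {x | x.2 < b}) :
    φ.toAmb 𝕜 b ∈ TopH1 𝕜 d b :=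
  Submodule.le_topologicalClosure _ (Submodule.subset_span ⟨φ, hφ, rfl⟩)

theorem topH1_le : TopH1 𝕜 d b ≤ H1 𝕜 d b := by
  refine Submodule.topologicalClosure_minimal _ (Submodule.span_le.2 ?_) isClosed_H1
  rintro _ ⟨φ, -, rfl⟩
  exact φ.toAmb_mem_H1

/-- The weight `t` vanishes at the bottom and the functions on top. With `w = v` this yields the
Poincaré inequality, with no condition on `Σ₀`. -/
theorem TopH1.inner_eq (hb : 0 < b) {w v : Amb 𝕜 d b} (hw : w ∈ TopH1 𝕜 d b)
    (hv : v ∈ TopH1 𝕜 d b) :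
    inner 𝕜 (ambVal 𝕜 d b w) (ambVal 𝕜 d b v)
      + inner 𝕜 (vmulL 𝕜 d b (ambGrad 𝕜 b (Fin.last d) w)) (ambVal 𝕜 d b v)
      + inner 𝕜 (vmulL 𝕜 d b (ambVal 𝕜 d b w)) (ambGrad 𝕜 b (Fin.last d) v) = 0 := by
  refine mem_closure_span_induction (p := fun w : Amb 𝕜 d b =>
    inner 𝕜 (ambVal 𝕜 d b w) (ambVal 𝕜 d b v)
      + inner 𝕜 (vmulL 𝕜 d b (ambGrad 𝕜 b (Fin.last d) w)) (ambVal 𝕜 d b v)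
      + inner 𝕜 (vmulL 𝕜 d b (ambVal 𝕜 d b w)) (ambGrad 𝕜 b (Fin.last d) v) = 0)
    (isClosed_eq (by fun_prop) (by fun_prop)) (by simp) ?_ ?_ ?_ hw
  · intro x y hx hy
    simp only [map_add, inner_add_left]
    linear_combination hx + hy
  · intro c x hx
    simp only [map_smul, inner_smul_left]
    linear_combination conj c * hx
  rintro _ ⟨φ, hφ, rfl⟩
  refine mem_closure_span_induction (p := fun v : Amb 𝕜 d b =>
    inner 𝕜 (ambVal 𝕜 d b (φ.toAmb 𝕜 b)) (ambVal 𝕜 d b v)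
      + inner 𝕜 (vmulL 𝕜 d b (ambGrad 𝕜 b (Fin.last d) (φ.toAmb 𝕜 b))) (ambVal 𝕜 d b v)
      + inner 𝕜 (vmulL 𝕜 d b (ambVal 𝕜 d b (φ.toAmb 𝕜 b))) (ambGrad 𝕜 b (Fin.last d) v) = 0)
    (isClosed_eq (by fun_prop) (by fun_prop)) (by simp) ?_ ?_ ?_ hv
  · intro x y hx hy
    simp only [map_add, inner_add_right]
    linear_combination hx + hy
  · intro c x hx
    simp only [map_smul, inner_smul_right]
    linear_combination c * hx
  rintro _ ⟨ψ, -, rfl⟩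
  have h := inner_add_inner_vmulL (𝕜 := 𝕜) hb φ ψ
  rw [topPairing_eq_zero hφ, mul_zero, RCLike.ofReal_zero] at h
  exact h

/-- The Poincaré inequality. -/
theorem TopH1.norm_le (hb : 0 < b) {w : Amb 𝕜 d b} (hw : w ∈ TopH1 𝕜 d b) :
    ‖ambVal 𝕜 d b w‖ ≤ 2 * b * ‖ambGrad 𝕜 b (Fin.last d) w‖ := by
  have h := congrArg RCLike.re (TopH1.inner_eq hb hw hw)
  set f := ambVal 𝕜 d b w
  set F := ambGrad 𝕜 b (Fin.last d) w
  rw [map_add, map_add, inner_self_eq_norm_sq_to_K, ← RCLike.ofReal_pow, RCLike.ofReal_re,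
    map_zero] at h
  have h1 := (abs_le.1 (abs_re_inner_le (𝕜 := 𝕜) (norm_vmulL_le hb F) (le_refl ‖f‖))).1
  have h2 := (abs_le.1 (abs_re_inner_le (𝕜 := 𝕜) (norm_vmulL_le hb f) (le_refl ‖F‖))).1
  have h3 := le_of_sq_le_add (x := ‖f‖) (a := 2 * b * ‖F‖) (c := 0) (by positivity) le_rfl
    (by linarith)
  linarith

theorem TopH1.norm_sq_le (hb : 0 < b) {w : Amb 𝕜 d b} (hw : w ∈ TopH1 𝕜 d b) :
    ‖w‖ ^ 2 ≤ (4 * b ^ 2 + 1) * ∑ i, ‖ambGrad 𝕜 b i w‖ ^ 2 := by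
  rw [norm_sq_amb]
  have h1 : ‖ambVal 𝕜 d b w‖ ^ 2 ≤ (2 * b * ‖ambGrad 𝕜 b (Fin.last d) w‖) ^ 2 := by
    gcongr
    exact TopH1.norm_le hb hw
  have h2 : ‖ambGrad 𝕜 b (Fin.last d) w‖ ^ 2 ≤ ∑ i, ‖ambGrad 𝕜 b i w‖ ^ 2 :=
    Finset.single_le_sum (f := fun i => ‖ambGrad 𝕜 b i w‖ ^ 2) (fun _ _ => sq_nonneg _)
      (Finset.mem_univ _)
  nlinarith [sq_nonneg b]

theorem TopH1.exists_hshift {w : Amb 𝕜 d b} (hw : w ∈ TopH1 𝕜 d b) (v : Hor d) :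
    WithLp.toLp 2 (hshift 𝕜 b v (ambVal 𝕜 d b w),
      WithLp.toLp 2 fun i => hshift 𝕜 b v (ambGrad 𝕜 b i w)) ∈ TopH1 𝕜 d b := by
  refine mem_closure_span_induction (p := fun w : Amb 𝕜 d b =>
    WithLp.toLp 2 (hshift 𝕜 b v (ambVal 𝕜 d b w),
      WithLp.toLp 2 fun i => hshift 𝕜 b v (ambGrad 𝕜 b i w)) ∈ TopH1 𝕜 d b) ?_ ?_ ?_ ?_ ?_ hw
  · refine (Submodule.isClosed_topologicalClosure _).preimage ?_
    have h1 : Continuous (hshift 𝕜 b v) := (hshift 𝕜 b v).continuous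
    refine (WithLp.prod_continuous_toLp 2 _ _).comp (Continuous.prodMk ?_ ?_)
    · exact h1.comp (ambVal 𝕜 d b).continuous
    · refine (PiLp.continuous_toLp 2 _).comp (continuous_pi fun i => ?_)
      exact h1.comp (ambGrad 𝕜 b i).continuous
  · simp only [map_zero]
    exact (TopH1 𝕜 d b).zero_mem
  · intro x y hx hy
    simp only [map_add]
    exact (TopH1 𝕜 d b).add_mem hx hy
  · intro c x hx
    simp only [map_smul]
    exact (TopH1 𝕜 d b).smul_mem c hx
  · rintro _ ⟨φ, hφ, rfl⟩
    have h1 : tsupport (φ.shift (v, 0)) ⊆ {x | x.2 < b} := by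
      rw [TestFn.tsupport_shift]
      intro x hx
      simpa using hφ hx
    have h2 := TestFn.toAmb_mem_topH1 (𝕜 := 𝕜) h1
    simp only [TestFn.toAmb, ← hshift_toL2, TestFn.partialD_shift] at h2
    exact h2

theorem TopH1.exists_diffQ {w : Amb 𝕜 d b} (hw : w ∈ TopH1 𝕜 d b) (j : Fin d) (h : ℝ) :
    ∃ w' ∈ TopH1 𝕜 d b, ambVal 𝕜 d b w' = diffQ 𝕜 b j h (ambVal 𝕜 d b w) ∧
      ∀ i, ambGrad 𝕜 b i w' = diffQ 𝕜 b j h (ambGrad 𝕜 b i w) :=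
  ⟨_, (TopH1 𝕜 d b).smul_mem (h : 𝕜)⁻¹
    ((TopH1 𝕜 d b).sub_mem (TopH1.exists_hshift hw (h • horVec j)) hw), rfl, fun _ => rfl⟩

/-- Weak solvability of `Δw = f` with `∂ₙw = 0` on `Σ₀` and `w = 0` on top of the strip. -/
theorem TopH1.exists_poisson (hb : 0 < b) (f : L2 𝕜 d b) : ∃ w ∈ TopH1 𝕜 d b,
    ∀ v ∈ TopH1 𝕜 d b, ∑ i, inner 𝕜 (ambGrad 𝕜 b i v) (ambGrad 𝕜 b i w)
      = - inner 𝕜 (ambVal 𝕜 d b v) f := by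
  let G : Fin (d + 1) → TopH1 𝕜 d b →L[𝕜] L2 𝕜 d b := fun i =>
    (ambGrad 𝕜 b i).comp (TopH1 𝕜 d b).subtypeL
  let V : TopH1 𝕜 d b →L[𝕜] L2 𝕜 d b := (ambVal 𝕜 d b).comp (TopH1 𝕜 d b).subtypeL
  -- This operator represents the Dirichlet form, which is coercive by the Poincaré inequality.
  let A : TopH1 𝕜 d b →L[𝕜] TopH1 𝕜 d b :=
    ∑ i, (ContinuousLinearMap.adjoint (E := TopH1 𝕜 d b) (F := L2 𝕜 d b) (G i)).comp (G i)
  have hA : ∀ v w, inner 𝕜 v (A w) = ∑ i, inner 𝕜 (G i v) (G i w) := by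
    intro v w
    simp only [A, sum_apply, inner_sum, ContinuousLinearMap.comp_apply,
      ContinuousLinearMap.adjoint_inner_right]
  have hco : ∀ w : TopH1 𝕜 d b, (4 * b ^ 2 + 1)⁻¹ * ‖w‖ ^ 2 ≤ RCLike.re (inner 𝕜 w (A w)) := by
    intro w
    rw [hA, inv_mul_le_iff₀ (by positivity)]
    refine (TopH1.norm_sq_le hb w.2).trans (le_of_eq ?_)
    rw [map_sum]
    congr 1
    refine Finset.sum_congr rfl fun i _ => ?_
    rw [inner_self_eq_norm_sq_to_K, ← RCLike.ofReal_pow, RCLike.ofReal_re]; rfl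
  obtain ⟨w, hw⟩ := (bijective_of_coercive (𝕜 := 𝕜) (E := TopH1 𝕜 d b) A
    (c := (4 * b ^ 2 + 1)⁻¹) (by positivity) hco).2
    (-(ContinuousLinearMap.adjoint (𝕜 := 𝕜) (E := TopH1 𝕜 d b) (F := L2 𝕜 d b) V f))
  refine ⟨w, w.2, fun v hv => ?_⟩
  have := hA ⟨v, hv⟩ w
  rw [hw, inner_neg_right, ContinuousLinearMap.adjoint_inner_right] at this
  exact this.symm

/-- Nirenberg's method: testing the equation with `D₋ₛDₛw`, which is admissible since `TopH1` is
invariant under horizontal translations, gives `∑ᵢ ‖Dₛ∂ᵢw‖² ≤ ‖Dₛ∂ⱼw‖ ‖f‖`. -/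
theorem TopH1.norm_diffQ_grad_le {f : L2 𝕜 d b} {w : Amb 𝕜 d b}
    (hw : w ∈ TopH1 𝕜 d b) (h : ∀ v ∈ TopH1 𝕜 d b,
      ∑ i, inner 𝕜 (ambGrad 𝕜 b i v) (ambGrad 𝕜 b i w) = - inner 𝕜 (ambVal 𝕜 d b v) f)
    (j : Fin d) (s : ℝ) (i : Fin (d + 1)) :
    ‖diffQ 𝕜 b j s (ambGrad 𝕜 b i w)‖ ≤ ‖f‖ := by
  obtain ⟨w', hw', e1, e2⟩ := TopH1.exists_diffQ hw j s
  obtain ⟨w'', hw'', e3, e4⟩ := TopH1.exists_diffQ hw' j (-s)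
  have h1 : ∑ i, ‖diffQ 𝕜 b j s (ambGrad 𝕜 b i w)‖ ^ 2
      ≤ ‖diffQ 𝕜 b j s (ambGrad 𝕜 b j.castSucc w)‖ * ‖f‖ := by
    have h2 : ∀ i, inner 𝕜 (ambGrad 𝕜 b i w'') (ambGrad 𝕜 b i w)
        = ((-‖diffQ 𝕜 b j s (ambGrad 𝕜 b i w)‖ ^ 2 : ℝ) : 𝕜) := by
      intro i
      rw [e4, inner_diffQ_left, neg_neg, ← e2, inner_self_eq_norm_sq_to_K]
      push_cast; rfl
    have h3 := congrArg RCLike.re (h w'' hw'')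
    simp only [h2, map_sum, RCLike.ofReal_re, Finset.sum_neg_distrib, map_neg] at h3
    rw [neg_inj] at h3
    rw [h3]
    refine (le_abs_self _).trans (abs_re_inner_le ?_ le_rfl)
    rw [e3, ← e2]
    exact norm_diffQ_le ((topH1_le hw') j.castSucc) (-s)
  have h2 : ∀ i, ‖diffQ 𝕜 b j s (ambGrad 𝕜 b i w)‖ ^ 2
      ≤ ‖diffQ 𝕜 b j s (ambGrad 𝕜 b j.castSucc w)‖ * ‖f‖ := fun i =>
    (Finset.single_le_sum (f := fun i => ‖diffQ 𝕜 b j s (ambGrad 𝕜 b i w)‖ ^ 2)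
      (fun _ _ => sq_nonneg _) (Finset.mem_univ i)).trans h1
  have h3 : ‖diffQ 𝕜 b j s (ambGrad 𝕜 b j.castSucc w)‖ ≤ ‖f‖ := by
    have := le_of_sq_le_add (x := ‖diffQ 𝕜 b j s (ambGrad 𝕜 b j.castSucc w)‖) (a := ‖f‖) (c := 0)
      (norm_nonneg _) le_rfl (by linarith [h2 j.castSucc])
    linarith
  refine abs_le_of_sq_le_sq' ?_ (norm_nonneg _) |>.2
  rw [sq ‖f‖]
  exact (h2 i).trans (mul_le_mul_of_nonneg_right h3 (norm_nonneg _))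

/-- The divergence maps the tangential fields onto `L²(Ω)`. -/
theorem exists_divergence_eq (hb : 0 < b) (f : L2 𝕜 d b) :
    ∃ u : TanH1 𝕜 d hb, divergence (u : VecH1 𝕜 d b) = f := by
  obtain ⟨w, hw, h⟩ := TopH1.exists_poisson hb f
  have hw1 := topH1_le hw
  have hex : ∀ (i : Fin (d + 1)) (j : Fin d), ∃ g : L2 𝕜 d b,
      IsWeakPartial d b j.castSucc (ambGrad 𝕜 b i w) g := fun i j =>
    exists_isWeakPartial fun s => TopH1.norm_diffQ_grad_le hw h j s i
  choose g hg using hex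
  -- The candidate for `∂ₙ∂ₙw`, read off from `Δw = f`.
  set hn : L2 𝕜 d b := f - ∑ j : Fin d, g j.castSucc j with hhn
  -- Admissible `φ` need not vanish on `Σ₀`. The identity therefore says both that `hn` is `∂ₙ∂ₙw`
  -- and that `∂ₙw` has zero trace.
  have hlast : ∀ φ : TestFn d, tsupport φ ⊆ {x | x.2 < b} →
      inner 𝕜 ((φ.partialD (Fin.last d)).toL2 𝕜 b) (ambGrad 𝕜 b (Fin.last d) w)
        = - inner 𝕜 (φ.toL2 𝕜 b) hn := by
    intro φ hφ
    have h1 := h _ (TestFn.toAmb_mem_topH1 hφ)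
    rw [Fin.sum_univ_castSucc] at h1
    have h2 : ∀ j : Fin d, inner 𝕜 (ambGrad 𝕜 b j.castSucc (φ.toAmb 𝕜 b))
        (ambGrad 𝕜 b j.castSucc w) = - inner 𝕜 (φ.toL2 𝕜 b) (g j.castSucc j) := fun j =>
      inner_weakPartial_swap (φ.toAmb_mem_H1 j.castSucc) (hg j.castSucc j)
    simp only [h2] at h1
    simp only [Finset.sum_neg_distrib, TestFn.ambGrad_toAmb, TestFn.ambVal_toAmb] at h1
    rw [hhn, inner_sub_right, inner_sum]
    linear_combination h1
  -- `D i k` is `∂ₖ∂ᵢw`. For `k` vertical and `i` horizontal it is defined by symmetry.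
  let D : Fin (d + 1) → Fin (d + 1) → L2 𝕜 d b := fun i k =>
    Fin.lastCases (motive := fun _ => L2 𝕜 d b)
      (Fin.lastCases (motive := fun _ => L2 𝕜 d b) hn (fun j => g (Fin.last d) j) i)
      (fun j => g i j) k
  have hD1 : ∀ i (j : Fin d), D i j.castSucc = g i j := fun i j => by simp [D]
  have hD2 : ∀ i : Fin d, D i.castSucc (Fin.last d) = g (Fin.last d) i := fun i => by simp [D]
  have hD3 : D (Fin.last d) (Fin.last d) = hn := by simp [D]
  have hmem : ∀ i k, IsWeakPartial d b k (ambGrad 𝕜 b i w) (D i k) := by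
    intro i k
    refine Fin.lastCases ?_ (fun k => ?_) k
    · refine Fin.lastCases ?_ (fun i => ?_) i
      · rw [hD3, isWeakPartial_iff]
        exact fun φ hφ => hlast φ (hφ.trans fun x hx => hx.2)
      · rw [hD2]
        exact isWeakPartial_swap (hw1 i.castSucc) (hw1 (Fin.last d)) (hg (Fin.last d) i)
    · rw [hD1]
      exact hg i k
  let u : VecH1 𝕜 d b := WithLp.toLp 2 fun i =>
    ⟨WithLp.toLp 2 (ambGrad 𝕜 b i w, WithLp.toLp 2 (D i)), hmem i⟩
  have hu : trace hb (u (Fin.last d)) = 0 := by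
    refine (trace_spec hb _).unique hb (isTrace_iff.2 fun φ hφ => ?_)
    rw [inner_zero_right, neg_zero]
    change inner 𝕜 ((φ.partialD (Fin.last d)).toL2 𝕜 b) (ambGrad 𝕜 b (Fin.last d) w)
      + inner 𝕜 (φ.toL2 𝕜 b) (D (Fin.last d) (Fin.last d)) = 0
    rw [hD3, hlast φ hφ, neg_add_cancel]
  refine ⟨⟨u, hu⟩, ?_⟩
  change ∑ i, D i i = f
  rw [Fin.sum_univ_castSucc, hD3]
  simp only [hD1, hhn]
  abel

end


/-! ### Saddle point problems and antilinear functionals. -/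

section Antidual

variable {𝕜 : Type*} [RCLike 𝕜] {E : Type*} [NormedAddCommGroup E] [InnerProductSpace 𝕜 E]

variable (𝕜 E) in
/-- The map `x ↦ ⟨·, x⟩` to the space of bounded antilinear functionals. -/
noncomputable def toAntidual : E →L[𝕜] E →L⋆[𝕜] 𝕜 := (innerSL 𝕜 : E →L⋆[𝕜] E →L[𝕜] 𝕜).flip

theorem toAntidual_apply (x v : E) : toAntidual 𝕜 E x v = inner 𝕜 v x := rfl

end Antidual

section Hilbert

variable {𝕜 : Type*} [RCLike 𝕜] {E F : Type*} [NormedAddCommGroup E] [InnerProductSpace 𝕜 E]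
  [CompleteSpace E] [NormedAddCommGroup F] [InnerProductSpace 𝕜 F] [CompleteSpace F]
  {G : Type*} [NormedAddCommGroup G] [InnerProductSpace 𝕜 G] [CompleteSpace G]

/-- A saddle point problem with a coercive operator and a surjective constraint is uniquely
solvable. -/
theorem bijective_saddle (A : E →L[𝕜] E) {c : ℝ} (hc : 0 < c)
    (hA : ∀ x, c * ‖x‖ ^ 2 ≤ RCLike.re (inner 𝕜 x (A x))) (B : E →L[𝕜] F)
    (hB : Function.Surjective B) :
    Function.Bijective fun x : E × F =>
      (A x.1 - ContinuousLinearMap.adjoint B x.2, B x.1) := by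
  set B' := ContinuousLinearMap.adjoint B with hB'
  obtain ⟨C, hC0, hC⟩ := B.exists_preimage_norm_le hB
  -- A bounded right inverse of `B` makes the adjoint bounded below, by pairing `B' p` with a
  -- preimage of `p`; this is the inf-sup condition.
  have hB'b : ∀ p, ‖p‖ ≤ C * ‖B' p‖ := by
    intro p
    obtain ⟨x, hx, hxn⟩ := hC p
    have h1 : ‖p‖ * ‖p‖ ≤ ‖B' p‖ * ‖x‖ := by
      have h2 : inner 𝕜 (B' p) x = inner 𝕜 p p := by
        rw [hB', ContinuousLinearMap.adjoint_inner_left, hx]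
      have h3 : ‖p‖ * ‖p‖ = ‖(inner 𝕜 p p : 𝕜)‖ := by
        rw [inner_self_eq_norm_sq_to_K, norm_pow, RCLike.norm_ofReal, abs_norm, sq]
      rw [h3, ← h2]
      exact norm_inner_le_norm _ _
    rcases (norm_nonneg p).eq_or_lt with h0 | h0
    · rw [← h0]; positivity
    · refine le_of_mul_le_mul_right (h1.trans ?_) h0
      calc ‖B' p‖ * ‖x‖ ≤ ‖B' p‖ * (C * ‖p‖) := by gcongr
        _ = C * ‖B' p‖ * ‖p‖ := by ring
  have hbij := bijective_of_coercive A hc hA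
  let Ae : E ≃L[𝕜] E := ContinuousLinearEquiv.ofBijective A
    (LinearMap.ker_eq_bot.2 hbij.1) (LinearMap.range_eq_top.2 hbij.2)
  have hAe : ∀ x, A (Ae.symm x) = x := fun x => Ae.apply_symm_apply x
  -- The Schur complement. With `x = A⁻¹B' p` one has `⟨p, S p⟩ = ⟨A x, x⟩`, and `‖p‖` is controlled
  -- by `‖B' p‖ = ‖A x‖`. In the constant, `‖A‖ + 1` is used to have a positive number in any case.
  let S : F →L[𝕜] F := B.comp (Ae.symm.toContinuousLinearMap.comp B')
  have hS : ∀ p, c * ((C * (‖A‖ + 1)) ^ 2)⁻¹ * ‖p‖ ^ 2 ≤ RCLike.re (inner 𝕜 p (S p)) := by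
    intro p
    set x := Ae.symm (B' p) with hx
    have h1 : inner 𝕜 p (S p) = inner 𝕜 (A x) x := by
      rw [hx, hAe, hB', ContinuousLinearMap.adjoint_inner_left]; rfl
    rw [h1, inner_re_symm]
    refine le_trans ?_ (hA x)
    have h2 : ‖p‖ ≤ C * (‖A‖ + 1) * ‖x‖ := by
      refine (hB'b p).trans ?_
      have h3 : ‖B' p‖ ≤ (‖A‖ + 1) * ‖x‖ := by
        have h4 := A.le_opNorm x
        rw [hx, hAe, ← hx] at h4
        linarith [norm_nonneg x]
      calc C * ‖B' p‖ ≤ C * ((‖A‖ + 1) * ‖x‖) := by gcongr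
        _ = _ := by ring
    rw [mul_assoc]
    refine mul_le_mul_of_nonneg_left ?_ hc.le
    rw [inv_mul_le_iff₀ (by positivity), ← mul_pow]
    gcongr
  have hSb := bijective_of_coercive S (by positivity) hS
  constructor
  · rintro ⟨u, p⟩ ⟨v, q⟩ h
    obtain ⟨h1, h2⟩ := Prod.ext_iff.1 h
    simp only at h1 h2
    have h3 : A (u - v) = B' (p - q) := by
      rw [map_sub, map_sub]
      rw [sub_eq_sub_iff_add_eq_add] at h1 ⊢
      rw [h1]; abel
    have h4 : B (u - v) = 0 := by rw [map_sub, h2, sub_self]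
    -- `u - v` lies in the kernel of `B`, hence is orthogonal to the range of `B'`, which contains
    -- `A (u - v)`.
    have h5 := hA (u - v)
    rw [h3, hB', ContinuousLinearMap.adjoint_inner_right, h4, inner_zero_left, map_zero] at h5
    have h6 : ‖u - v‖ ^ 2 ≤ 0 := by nlinarith
    have h7 : u - v = 0 :=
      norm_eq_zero.1 (pow_eq_zero_iff two_ne_zero |>.1 (le_antisymm h6 (sq_nonneg _)))
    have h8 := hB'b (p - q)
    rw [← h3, h7, map_zero, norm_zero, mul_zero, norm_le_zero_iff] at h8
    exact Prod.ext (sub_eq_zero.1 h7) (sub_eq_zero.1 h8)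
  · rintro ⟨f, g⟩
    -- Elimination: `u = A⁻¹(f + B' p)`, and `B u = g` becomes an equation for `p` alone.
    obtain ⟨p, hp⟩ := hSb.2 (g - B (Ae.symm f))
    refine ⟨(Ae.symm (f + B' p), p), ?_⟩
    have h1 : B (Ae.symm (B' p)) = g - B (Ae.symm f) := hp
    simp only [hAe, map_add, h1, add_sub_cancel_right, add_sub_cancel]

/-- The Riesz theorem, applied to the conjugate of an antilinear functional. -/
theorem toAntidual_bijective : Function.Bijective (toAntidual 𝕜 E) := by
  constructor
  · intro x y h
    refine ext_inner_left 𝕜 fun v => ?_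
    rw [← toAntidual_apply, h, toAntidual_apply]
  · intro ℓ
    let m : StrongDual 𝕜 E :=
      { toFun := fun v => conj (ℓ v)
        map_add' := fun v w => by rw [map_add, map_add]
        map_smul' := fun c v => by simp
        cont := RCLike.continuous_conj.comp ℓ.continuous }
    refine ⟨(InnerProductSpace.toDual 𝕜 E).symm m, ?_⟩
    ext v
    rw [toAntidual_apply, ← inner_conj_symm, InnerProductSpace.toDual_symm_apply]
    change conj (conj (ℓ v)) = ℓ v
    exact RCLike.conj_conj _

/-- The isomorphism given by a saddle point problem, in variational form. -/
theorem exists_saddle_equiv (A : E →L[𝕜] E) {c : ℝ} (hc : 0 < c)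
    (hA : ∀ x, c * ‖x‖ ^ 2 ≤ RCLike.re (inner 𝕜 x (A x))) (B : E →L[𝕜] F)
    (hB : Function.Surjective B) :
    ∃ χ : (E × F) ≃L[𝕜] ((E →L⋆[𝕜] 𝕜) × F), ∀ (u : E) (p : F),
      (∀ v : E, (χ (u, p)).1 v = inner 𝕜 v (A u) - inner 𝕜 (B v) p) ∧ (χ (u, p)).2 = B u := by
  let T : (E × F) →L[𝕜] ((E →L⋆[𝕜] 𝕜) × F) :=
    ((toAntidual 𝕜 E).comp (A.comp (ContinuousLinearMap.fst 𝕜 E F)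
        - (ContinuousLinearMap.adjoint B).comp (ContinuousLinearMap.snd 𝕜 E F))).prod
      (B.comp (ContinuousLinearMap.fst 𝕜 E F))
  have hT : Function.Bijective T :=
    (toAntidual_bijective (𝕜 := 𝕜) (E := E)).prodMap Function.bijective_id |>.comp
      (bijective_saddle A hc hA B hB)
  refine ⟨ContinuousLinearEquiv.ofBijective T (LinearMap.ker_eq_bot.2 hT.1)
    (LinearMap.range_eq_top.2 hT.2), fun u p => ⟨fun v => ?_, rfl⟩⟩
  change inner 𝕜 v (A u - ContinuousLinearMap.adjoint B p) = _
  rw [inner_sub_right, ContinuousLinearMap.adjoint_inner_right]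

/-- The operator that represents a form built from inner products of given operators. -/
noncomputable def formL {n : ℕ} (μ γ α : 𝕜) (β : Fin n → Fin n → 𝕜) (S : Fin n → Fin n → E →L[𝕜] F)
    (C P : Fin n → E →L[𝕜] F) (T : Fin n → E →L[𝕜] G) : E →L[𝕜] E :=
  μ • ∑ i, ∑ j, (ContinuousLinearMap.adjoint (S i j)).comp (S i j)
    - γ • ∑ i, (ContinuousLinearMap.adjoint (C i)).comp (P i)
    + α • ∑ i, ∑ j, β i j • (ContinuousLinearMap.adjoint (T i)).comp (T j)

theorem inner_formL {n : ℕ} (μ γ α : 𝕜) (β : Fin n → Fin n → 𝕜) (S : Fin n → Fin n → E →L[𝕜] F)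
    (C P : Fin n → E →L[𝕜] F) (T : Fin n → E →L[𝕜] G) (u v : E) :
    inner 𝕜 v (formL μ γ α β S C P T u)
      = μ * (∑ i, ∑ j, inner 𝕜 (S i j v) (S i j u)) - γ * (∑ i, inner 𝕜 (C i v) (P i u))
        + α * ∑ i, ∑ j, β i j * inner 𝕜 (T i v) (T j u) := by
  simp only [formL, add_apply, sub_apply,
    smul_apply, sum_apply, ContinuousLinearMap.comp_apply,
    inner_add_right, inner_sub_right, inner_smul_right, inner_sum,
    ContinuousLinearMap.adjoint_inner_right]

variable {n : ℕ} (μ γ α : 𝕜) (β : Fin n → Fin n → 𝕜)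

/-- A saddle point problem whose coercive part is built from inner products of given operators
defines an isomorphism. -/
theorem exists_form_equiv (S : Fin n → Fin n → E →L[𝕜] F) (C P : Fin n → E →L[𝕜] F)
    (T : Fin n → E →L[𝕜] G) {c : ℝ} (hc : 0 < c)
    (hcoer : ∀ u, c * ‖u‖ ^ 2 ≤ RCLike.re (μ * (∑ i, ∑ j, inner 𝕜 (S i j u) (S i j u))
      - γ * (∑ i, inner 𝕜 (C i u) (P i u)) + α * ∑ i, ∑ j, β i j * inner 𝕜 (T i u) (T j u)))
    (B : E →L[𝕜] F) (hB : Function.Surjective B) :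
    ∃ χ : (E × F) ≃L[𝕜] ((E →L⋆[𝕜] 𝕜) × F), ∀ (u : E) (p : F),
      (∀ v : E, (χ (u, p)).1 v = μ * (∑ i, ∑ j, inner 𝕜 (S i j v) (S i j u))
        - γ * (∑ i, inner 𝕜 (C i v) (P i u)) + α * (∑ i, ∑ j, β i j * inner 𝕜 (T i v) (T j u))
        - inner 𝕜 (B v) p) ∧ (χ (u, p)).2 = B u := by
  have hA : ∀ u, c * ‖u‖ ^ 2 ≤ RCLike.re (inner 𝕜 u (formL μ γ α β S C P T u)) := fun u => by
    rw [inner_formL]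
    exact hcoer u
  obtain ⟨χ, hχ⟩ := exists_saddle_equiv (formL μ γ α β S C P T) hc hA B hB
  refine ⟨χ, fun u p => ⟨fun v => ?_, (hχ u p).2⟩⟩
  rw [(hχ u p).1 v, inner_formL]

/-- `exists_form_equiv` for a subspace. -/
theorem exists_form_equiv_submodule
    {H : Type*} [NormedAddCommGroup H] [InnerProductSpace 𝕜 H] (W : Submodule 𝕜 H) [CompleteSpace W]
    (S : Fin n → Fin n → W →L[𝕜] F) (C P : Fin n → W →L[𝕜] F)
    (T : Fin n → W →L[𝕜] G) {c : ℝ} (hc : 0 < c)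
    (hcoer : ∀ u, c * ‖u‖ ^ 2 ≤ RCLike.re (μ * (∑ i, ∑ j, inner 𝕜 (S i j u) (S i j u))
      - γ * (∑ i, inner 𝕜 (C i u) (P i u)) + α * ∑ i, ∑ j, β i j * inner 𝕜 (T i u) (T j u)))
    (B : W →L[𝕜] F) (hB : Function.Surjective B) :
    ∃ χ : (W × F) ≃L[𝕜] ((W →L⋆[𝕜] 𝕜) × F), ∀ (u : W) (p : F),
      (∀ v : W, (χ (u, p)).1 v = μ * (∑ i, ∑ j, inner 𝕜 (S i j v) (S i j u))
        - γ * (∑ i, inner 𝕜 (C i v) (P i u)) + α * (∑ i, ∑ j, β i j * inner 𝕜 (T i v) (T j u))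
        - inner 𝕜 (B v) p) ∧ (χ (u, p)).2 = B u :=
  exists_form_equiv (E := W) μ γ α β S C P T hc hcoer B hB

/-- `exists_form_equiv` for a space of vector fields. Stated for abstract spaces, since
instance unification is costly for the concrete ones. -/
theorem exists_form_equiv_piLp
    {H : Type*} [NormedAddCommGroup H] [InnerProductSpace 𝕜 H] (K : Submodule 𝕜 H)
    (W : Submodule 𝕜 (PiLp 2 fun _ : Fin n => K)) [CompleteSpace W]
    (S : Fin n → Fin n → W →L[𝕜] F) (C P : Fin n → W →L[𝕜] F)
    (T : Fin n → W →L[𝕜] G) {c : ℝ} (hc : 0 < c)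
    (hcoer : ∀ u, c * ‖u‖ ^ 2 ≤ RCLike.re (μ * (∑ i, ∑ j, inner 𝕜 (S i j u) (S i j u))
      - γ * (∑ i, inner 𝕜 (C i u) (P i u)) + α * ∑ i, ∑ j, β i j * inner 𝕜 (T i u) (T j u)))
    (B : W →L[𝕜] F) (hB : Function.Surjective B) :
    ∃ χ : (W × F) ≃L[𝕜] ((W →L⋆[𝕜] 𝕜) × F), ∀ (u : W) (p : F),
      (∀ v : W, (χ (u, p)).1 v = μ * (∑ i, ∑ j, inner 𝕜 (S i j v) (S i j u))
        - γ * (∑ i, inner 𝕜 (C i v) (P i u)) + α * (∑ i, ∑ j, β i j * inner 𝕜 (T i v) (T j u))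
        - inner 𝕜 (B v) p) ∧ (χ (u, p)).2 = B u :=
  exists_form_equiv_submodule μ γ α β W S C P T hc hcoer B hB

end Hilbert

/-! ### The Stokes form on tangential fields. -/

section

variable {𝕜 : Type*} [RCLike 𝕜] {d : ℕ} {b : ℝ}

/-! ### The operators of the weak formulation -/

variable (𝕜 b) in
/-- The projection of a vector field to its `i`-th component, as an element of `H¹(Ω)`. -/
noncomputable def projH1 (i : Fin (d + 1)) : VecH1 𝕜 d b →L[𝕜] H1 𝕜 d b :=
  PiLp.proj 2 (fun _ : Fin (d + 1) => H1 𝕜 d b) i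

instance instCompleteTanH1 (hb : 0 < b) : CompleteSpace (TanH1 𝕜 d hb) := by
  have : (TanH1 𝕜 d hb : Set (VecH1 𝕜 d b))
      = {u | (traceL 𝕜 d hb).comp (projH1 𝕜 b (Fin.last d)) u = 0} := rfl
  have hcl : IsClosed (TanH1 𝕜 d hb : Set (VecH1 𝕜 d b)) := by
    rw [this]
    exact isClosed_eq (by fun_prop) continuous_const
  exact hcl.completeSpace_coe

/-- The components, as continuous linear maps. -/
noncomputable def componentL (hb : 0 < b) (i : Fin (d + 1)) : TanH1 𝕜 d hb →L[𝕜] L2 𝕜 d b :=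
  (ambVal 𝕜 d b).comp ((H1 𝕜 d b).subtypeL.comp ((projH1 𝕜 b i).comp (TanH1 𝕜 d hb).subtypeL))

/-- The weak derivatives, as continuous linear maps. -/
noncomputable def partialL (hb : 0 < b) (j i : Fin (d + 1)) : TanH1 𝕜 d hb →L[𝕜] L2 𝕜 d b :=
  (ambGrad 𝕜 b j).comp
    ((H1 𝕜 d b).subtypeL.comp ((projH1 𝕜 b i).comp (TanH1 𝕜 d hb).subtypeL))

/-- The entries of the symmetrized gradient, as continuous linear maps. -/
noncomputable def symGradL (hb : 0 < b) (i j : Fin (d + 1)) : TanH1 𝕜 d hb →L[𝕜] L2 𝕜 d b :=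
  partialL hb j i + partialL hb i j

/-- The divergence, as a continuous linear map. -/
noncomputable def divergenceL (hb : 0 < b) : TanH1 𝕜 d hb →L[𝕜] L2 𝕜 d b :=
  ∑ i, partialL hb i i

/-- The traces of the components, as continuous linear maps. -/
noncomputable def traceCompL (hb : 0 < b) (i : Fin (d + 1)) : TanH1 𝕜 d hb →L[𝕜] BdryL2 𝕜 d :=
  (traceL 𝕜 d hb).comp ((projH1 𝕜 b i).comp (TanH1 𝕜 d hb).subtypeL)

theorem componentL_apply (hb : 0 < b) (i : Fin (d + 1)) (u : TanH1 𝕜 d hb) :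
    componentL hb i u = component (u : VecH1 𝕜 d b) i := rfl

theorem partialL_apply (hb : 0 < b) (j i : Fin (d + 1)) (u : TanH1 𝕜 d hb) :
    partialL hb j i u = partialDeriv j (u : VecH1 𝕜 d b) i := rfl

theorem symGradL_apply (hb : 0 < b) (i j : Fin (d + 1)) (u : TanH1 𝕜 d hb) :
    symGradL hb i j u = symGrad (u : VecH1 𝕜 d b) i j := rfl

theorem traceCompL_apply (hb : 0 < b) (i : Fin (d + 1)) (u : TanH1 𝕜 d hb) :
    traceCompL hb i u = trace hb ((u : VecH1 𝕜 d b) i) := rfl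

theorem divergenceL_apply (hb : 0 < b) (u : TanH1 𝕜 d hb) :
    divergenceL hb u = divergence (u : VecH1 𝕜 d b) := by
  rw [divergenceL, sum_apply]; rfl

theorem divergenceL_surjective (hb : 0 < b) :
    Function.Surjective (divergenceL (𝕜 := 𝕜) (d := d) hb) := fun f => by
  obtain ⟨u, hu⟩ := exists_divergence_eq hb f
  exact ⟨u, (divergenceL_apply hb u).trans hu⟩

/-- The inner product is antilinear in its first argument, so `v` stands there. All products are
integrable as products of `L²` functions, which allows the integrals to be split. -/
theorem weakStokes_eq (hb : 0 < b) (μ α γ : ℝ) (β : Matrix (Fin (d + 1)) (Fin (d + 1)) ℝ)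
    (u v : VecH1 𝕜 d b) (p : L2 𝕜 d b) :
    weakStokes hb μ α γ β u p v
      = ((μ / 2 : ℝ) : 𝕜) * (∑ i, ∑ j, inner 𝕜 (symGrad v i j) (symGrad u i j))
        - inner 𝕜 (divergence v) p
        - (γ : 𝕜) * (∑ i, inner 𝕜 (component v i) (partialDeriv 0 u i))
        + ((1 / α : ℝ) : 𝕜) * ∑ i, ∑ j, (β i j : 𝕜) *
          inner 𝕜 (trace hb (v i)) (trace hb (u j)) := by
  have hint : ∀ x y : L2 𝕜 d b, Integrable (fun t => y t * conj (x t)) (stripMeasure d b) :=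
    fun x y => (L2.integrable_inner x y).congr (Eventually.of_forall fun t =>
      RCLike.inner_apply _ _)
  have hin : ∀ x y : L2 𝕜 d b, inner 𝕜 x y = ∫ t in strip d b, y t * conj (x t) := fun x y =>
    (L2.inner_def x y).trans (integral_congr_ae (Eventually.of_forall fun t =>
      RCLike.inner_apply _ _))
  have hint' : ∀ x y : BdryL2 𝕜 d, Integrable (fun t => y t * conj (x t)) volume :=
    fun x y => (L2.integrable_inner x y).congr (Eventually.of_forall fun t =>
      RCLike.inner_apply _ _)
  have hin' : ∀ x y : BdryL2 𝕜 d, inner 𝕜 x y = ∫ t, y t * conj (x t) := fun x y =>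
    (L2.inner_def x y).trans (integral_congr_ae (Eventually.of_forall fun t =>
      RCLike.inner_apply _ _))
  have i1 : Integrable (fun x => ((μ / 2 : ℝ) : 𝕜) * ∑ i, ∑ j, symGrad u i j x *
      conj (symGrad v i j x)) (stripMeasure d b) :=
    (integrable_finsetSum _ fun i _ => integrable_finsetSum _ fun j _ => hint _ _).const_mul _
  have i2 : Integrable (fun x => p x * conj (divergence v x)) (stripMeasure d b) := hint _ _
  have i3 : Integrable (fun x => (γ : 𝕜) * ∑ i, partialDeriv 0 u i x * conj (component v i x))
      (stripMeasure d b) := (integrable_finsetSum _ fun i _ => hint _ _).const_mul _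
  have e1 := integral_sub (i1.sub i2) i3
  have e2 := integral_sub i1 i2
  simp only [Pi.sub_apply] at e1
  rw [weakStokes, e1, e2, integral_const_mul,
    integral_const_mul, integral_finsetSum _ fun i _ => integrable_finsetSum _ fun j _ =>
      hint (symGrad v i j) (symGrad u i j),
    integral_finsetSum _ fun i _ => hint (component v i) (partialDeriv 0 u i), ← hin]
  congr 1
  · congr 1
    · congr 2
      refine Finset.sum_congr rfl fun i _ => ?_
      rw [integral_finsetSum _ fun j _ => hint (symGrad v i j) (symGrad u i j)]
      exact Finset.sum_congr rfl fun j _ => (hin _ _).symm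
  · congr 1
    have e : ∀ y, ∑ i, (∑ j, (β i j : 𝕜) * trace hb (u j) y) * conj (trace hb (v i) y)
        = ∑ i, ∑ j, (β i j : 𝕜) * (trace hb (u j) y * conj (trace hb (v i) y)) := by
      intro y
      simp only [Finset.sum_mul, mul_assoc]
    simp only [e]
    rw [integral_finsetSum _ fun i _ => integrable_finsetSum _ fun j _ =>
      (hint' (trace hb (v i)) (trace hb (u j))).const_mul _]
    refine Finset.sum_congr rfl fun i _ => ?_
    rw [integral_finsetSum _ fun j _ => (hint' (trace hb (v i)) (trace hb (u j))).const_mul _]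
    refine Finset.sum_congr rfl fun j _ => ?_
    rw [integral_const_mul, ← hin']

theorem weakStokes_eq_form (hb : 0 < b) (μ α γ : ℝ) (β : Matrix (Fin (d + 1)) (Fin (d + 1)) ℝ)
    (u v : TanH1 𝕜 d hb) (p : L2 𝕜 d b) :
    weakStokes hb μ α γ β (u : VecH1 𝕜 d b) p (v : VecH1 𝕜 d b)
      = ((μ / 2 : ℝ) : 𝕜) * (∑ i, ∑ j, inner 𝕜 (symGradL hb i j v) (symGradL hb i j u))
        - (γ : 𝕜) * (∑ i, inner 𝕜 (componentL hb i v) (partialL hb 0 i u))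
        + ((1 / α : ℝ) : 𝕜) * (∑ i, ∑ j, (β i j : 𝕜) *
          inner 𝕜 (traceCompL hb i v) (traceCompL hb j u))
        - inner 𝕜 (divergenceL hb v) p := by
  simp only [symGradL_apply, componentL_apply, partialL_apply, traceCompL_apply, divergenceL_apply]
  rw [weakStokes_eq, sub_right_comm, sub_add_eq_add_sub]

/-! ### Coercivity -/

theorem exists_coercive_bound {n : ℕ} {β : Matrix (Fin n) (Fin n) ℝ}
    (hβ : ∀ w : Fin n → ℝ, w ≠ 0 → 0 < w ⬝ᵥ β.mulVec w) :
    ∃ c > 0, ∀ w : Fin n → ℝ, c * ∑ i, w i ^ 2 ≤ w ⬝ᵥ β.mulVec w := by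
  have hcont : Continuous fun w : EuclideanSpace ℝ (Fin n) => w.ofLp ⬝ᵥ β.mulVec w.ofLp := by
    simp only [dotProduct, Matrix.mulVec]
    fun_prop
  have key : ∀ m : ℝ, (∀ w : EuclideanSpace ℝ (Fin n), ‖w‖ = 1 → m ≤ w.ofLp ⬝ᵥ β.mulVec w.ofLp) →
      ∀ w : Fin n → ℝ, m * ∑ i, w i ^ 2 ≤ w ⬝ᵥ β.mulVec w := by
    intro m hm w
    set x : EuclideanSpace ℝ (Fin n) := WithLp.toLp 2 w with hx
    have hxn : ‖x‖ ^ 2 = ∑ i, w i ^ 2 := EuclideanSpace.real_norm_sq_eq x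
    rcases eq_or_ne x 0 with h0 | h0
    · have hw : w = 0 := congrArg WithLp.ofLp h0
      simp [hw]
    · have hn : ‖x‖ ≠ 0 := norm_ne_zero_iff.2 h0
      have h1 := hm (‖x‖⁻¹ • x) (by rw [norm_smul, norm_inv, norm_norm, inv_mul_cancel₀ hn])
      have e : (‖x‖⁻¹ • x).ofLp = ‖x‖⁻¹ • w := rfl
      rw [e, Matrix.mulVec_smul, dotProduct_smul, smul_dotProduct, smul_eq_mul, smul_eq_mul,
        ← mul_assoc, ← mul_inv, ← sq, le_inv_mul_iff₀ (by positivity)] at h1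
      rw [← hxn, mul_comm]
      exact h1
  -- The sphere is empty for `n = 0`. Otherwise the minimum of the form on it is attained and
  -- positive.
  rcases (Metric.sphere (0 : EuclideanSpace ℝ (Fin n)) 1).eq_empty_or_nonempty with hE | hne
  · refine ⟨1, one_pos, key 1 fun w hw => ?_⟩
    have : w ∈ Metric.sphere (0 : EuclideanSpace ℝ (Fin n)) 1 := by simpa using hw
    rw [hE] at this
    exact this.elim
  · obtain ⟨z, hz, hmin⟩ := (isCompact_sphere (0 : EuclideanSpace ℝ (Fin n)) 1).exists_isMinOn hne
      hcont.continuousOn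
    have hz0 : z.ofLp ≠ 0 := by
      intro h
      have : z = 0 := WithLp.ofLp_injective 2 h
      simp [this] at hz
    exact ⟨_, hβ _ hz0, key _ fun w hw => hmin (by simpa using hw)⟩

/-- As `β` is real, the real part of the form at `z` is the sum of its values at `Re z` and `Im z`,
even without symmetry of `β`. The pointwise bound is then integrated. -/
theorem re_sum_trace_ge {n : ℕ} {β : Matrix (Fin n) (Fin n) ℝ} {c : ℝ}
    (hc : ∀ w : Fin n → ℝ, c * ∑ i, w i ^ 2 ≤ w ⬝ᵥ β.mulVec w) (g : Fin n → BdryL2 𝕜 d) :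
    c * ∑ i, ‖g i‖ ^ 2 ≤ RCLike.re (∑ i, ∑ j, (β i j : 𝕜) * inner 𝕜 (g i) (g j)) := by
  have hz : ∀ z : Fin n → 𝕜, c * ∑ i, ‖z i‖ ^ 2
      ≤ RCLike.re (∑ i, ∑ j, (β i j : 𝕜) * inner 𝕜 (z i) (z j)) := by
    intro z
    have h1 := hc fun i => RCLike.re (z i)
    have h2 := hc fun i => RCLike.im (z i)
    have e1 : ∑ i, ‖z i‖ ^ 2 = ∑ i, RCLike.re (z i) ^ 2 + ∑ i, RCLike.im (z i) ^ 2 := by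
      rw [← Finset.sum_add_distrib]
      refine Finset.sum_congr rfl fun i _ => ?_
      rw [RCLike.norm_sq_eq_def, sq, sq]
    have e2 : RCLike.re (∑ i, ∑ j, (β i j : 𝕜) * inner 𝕜 (z i) (z j))
        = (fun i => RCLike.re (z i)) ⬝ᵥ β.mulVec (fun i => RCLike.re (z i))
          + (fun i => RCLike.im (z i)) ⬝ᵥ β.mulVec (fun i => RCLike.im (z i)) := by
      simp only [dotProduct, Matrix.mulVec, map_sum, Finset.mul_sum, ← Finset.sum_add_distrib]
      refine Finset.sum_congr rfl fun i _ => Finset.sum_congr rfl fun j _ => ?_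
      rw [RCLike.re_ofReal_mul, RCLike.inner_apply, RCLike.mul_re, RCLike.conj_re, RCLike.conj_im]
      ring
    rw [e1, e2]
    linarith
  have hint : ∀ i j, Integrable (fun y => inner 𝕜 (g i y) (g j y)) volume := fun i j =>
    L2.integrable_inner (g i) (g j)
  have e1 : ∑ i, ∑ j, (β i j : 𝕜) * inner 𝕜 (g i) (g j)
      = ∫ y, ∑ i, ∑ j, (β i j : 𝕜) * inner 𝕜 (g i y) (g j y) := by
    rw [integral_finsetSum _ fun i _ => integrable_finsetSum _ fun j _ =>
      (hint i j).const_mul _]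
    refine Finset.sum_congr rfl fun i _ => ?_
    rw [integral_finsetSum _ fun j _ => (hint i j).const_mul _]
    refine Finset.sum_congr rfl fun j _ => ?_
    rw [integral_const_mul, L2.inner_def]
  have hI : Integrable (fun y => ∑ i, ∑ j, (β i j : 𝕜) * inner 𝕜 (g i y) (g j y)) volume :=
    integrable_finsetSum _ fun i _ => integrable_finsetSum _ fun j _ => (hint i j).const_mul _
  have hn : ∀ i, Integrable (fun y => ‖g i y‖ ^ 2) volume := fun i => (Lp.memLp (g i)).integrable_norm_pow (by norm_num)
  have e2 : c * ∑ i, ‖g i‖ ^ 2 = ∫ y, c * ∑ i, ‖g i y‖ ^ 2 := by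
    rw [integral_const_mul, integral_finsetSum _ fun i _ => hn i]
    congr 1
    refine Finset.sum_congr rfl fun i _ => ?_
    have h1 := L2.inner_def (𝕜 := 𝕜) (g i) (g i)
    have h2 : ∀ y, inner 𝕜 (g i y) (g i y) = ((‖g i y‖ ^ 2 : ℝ) : 𝕜) := fun y => by
      rw [inner_self_eq_norm_sq_to_K]; push_cast; rfl
    simp only [h2] at h1
    rw [integral_ofReal, inner_self_eq_norm_sq_to_K, ← RCLike.ofReal_pow] at h1
    exact RCLike.ofReal_injective h1
  rw [e1, e2, ← integral_re hI]
  exact integral_mono ((integrable_finsetSum _ fun i _ => hn i).const_mul c) hI.re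
    fun y => hz fun i => g i y

/-- The factors count `d + 1` components, each with its value and `d + 1` derivatives. -/
theorem norm_sq_le_korn (hb : 0 < b) (u : TanH1 𝕜 d hb) :
    ‖u‖ ^ 2 ≤ (d + 1) * ((d + 2) * (22 + 88 * b + √b) ^ 2) * kornEnergy hb (u : VecH1 𝕜 d b) := by
  obtain ⟨h1, h2⟩ := korn hb (u : VecH1 𝕜 d b) u.2
  set K := 22 + 88 * b + √b with hK
  set w : VecH1 𝕜 d b := u.1
  have hE : 0 ≤ kornEnergy hb w :=
    add_nonneg (Finset.sum_nonneg fun _ _ => Finset.sum_nonneg fun _ _ => sq_nonneg _)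
      (Finset.sum_nonneg fun _ _ => sq_nonneg _)
  have hsq : ∀ x : L2 𝕜 d b, ‖x‖ ≤ K * √(kornEnergy hb w) → ‖x‖ ^ 2 ≤ K ^ 2 * kornEnergy hb w := by
    intro x hx
    have : ‖x‖ ^ 2 ≤ (K * √(kornEnergy hb w)) ^ 2 := by gcongr
    rwa [mul_pow, Real.sq_sqrt hE] at this
  have h3 : ‖u‖ ^ 2 = ∑ i, ‖w i‖ ^ 2 := PiLp.norm_sq_eq_of_L2 _ w
  have h4 : ∀ i, ‖w i‖ ^ 2 ≤ (d + 2) * K ^ 2 * kornEnergy hb w := by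
    intro i
    have h5 : ‖w i‖ ^ 2 = ‖component w i‖ ^ 2 + ∑ j, ‖partialDeriv j w i‖ ^ 2 :=
      norm_sq_amb (w i : Amb 𝕜 d b)
    have h6 : ∑ j, ‖partialDeriv j w i‖ ^ 2 ≤ ∑ _j : Fin (d + 1), K ^ 2 * kornEnergy hb w :=
      Finset.sum_le_sum fun j _ => hsq _ (h1 i j)
    rw [Finset.sum_const, Finset.card_univ, Fintype.card_fin, nsmul_eq_mul] at h6
    push_cast at h6
    linarith [hsq _ (h2 i)]
  rw [h3]
  refine (Finset.sum_le_sum fun i _ => h4 i).trans (le_of_eq ?_)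
  rw [Finset.sum_const, Finset.card_univ, Fintype.card_fin, nsmul_eq_mul]
  push_cast; ring

/-- Since `d ≥ 1`, the index `0` is a horizontal direction, in which differentiation is skew. For `d
= 0` it would be the vertical one, with boundary terms. -/
theorem re_inner_component_partial (hd : 1 ≤ d) (u : VecH1 𝕜 d b) (i : Fin (d + 1)) :
    RCLike.re (inner 𝕜 (component u i) (partialDeriv 0 u i)) = 0 := by
  obtain ⟨d, rfl⟩ : ∃ e, d = e + 1 := ⟨d - 1, by omega⟩
  have h0 : (0 : Fin (d + 1 + 1)) = (0 : Fin (d + 1)).castSucc := rfl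
  have h := (u i).2 0
  rw [h0] at h
  have h1 := congrArg RCLike.re (inner_weakPartial_swap h h)
  rw [map_neg, inner_re_symm] at h1
  have h2 : RCLike.re (inner 𝕜 (component u i) (partialDeriv 0 u i))
      = - RCLike.re (inner 𝕜 (component u i) (partialDeriv 0 u i)) := h1
  linarith

/-- The viscous term and the friction term bound the two halves of `kornEnergy`, and the `γ` term
drops out of the real part, so no smallness of `γ` is needed. -/
theorem exists_coercive_stokes (hd : 1 ≤ d) (hb : 0 < b) {μ α : ℝ} (γ : ℝ) (hμ : 0 < μ)
    (hα : 0 < α) {β : Matrix (Fin (d + 1)) (Fin (d + 1)) ℝ}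
    (hβ : ∀ w : Fin (d + 1) → ℝ, w ≠ 0 → 0 < w ⬝ᵥ β.mulVec w) :
    ∃ c > 0, ∀ u : TanH1 𝕜 d hb, c * ‖u‖ ^ 2
      ≤ RCLike.re (((μ / 2 : ℝ) : 𝕜) * (∑ i, ∑ j, inner 𝕜 (symGradL hb i j u) (symGradL hb i j u))
        - (γ : 𝕜) * (∑ i, inner 𝕜 (componentL hb i u) (partialL hb 0 i u))
        + ((1 / α : ℝ) : 𝕜) * ∑ i, ∑ j, (β i j : 𝕜) *
          inner 𝕜 (traceCompL hb i u) (traceCompL hb j u)) := by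
  obtain ⟨c, hc0, hc⟩ := exists_coercive_bound hβ
  set L : ℝ := (d + 1) * ((d + 2) * (22 + 88 * b + √b) ^ 2) with hL
  have hL0 : 0 < L := by positivity
  refine ⟨min (μ / 2) (1 / α * c) * L⁻¹, by positivity, fun u => ?_⟩
  have h1 := norm_sq_le_korn hb u
  rw [← hL] at h1
  have h2 : L⁻¹ * ‖u‖ ^ 2 ≤ kornEnergy hb (u : VecH1 𝕜 d b) := by
    rwa [inv_mul_le_iff₀ hL0]
  have h3 := re_sum_trace_ge hc fun i => trace hb ((u : VecH1 𝕜 d b) i)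
  have h4 : RCLike.re (∑ i, inner 𝕜 (component (u : VecH1 𝕜 d b) i)
      (partialDeriv 0 (u : VecH1 𝕜 d b) i)) = 0 := by
    rw [map_sum]
    exact Finset.sum_eq_zero fun i _ => re_inner_component_partial hd _ i
  have h5 : RCLike.re (∑ i, ∑ j, inner 𝕜 (symGrad (u : VecH1 𝕜 d b) i j)
      (symGrad (u : VecH1 𝕜 d b) i j)) = ∑ i, ∑ j, ‖symGrad (u : VecH1 𝕜 d b) i j‖ ^ 2 := by
    simp only [map_sum]
    refine Finset.sum_congr rfl fun i _ => Finset.sum_congr rfl fun j _ => ?_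
    rw [inner_self_eq_norm_sq_to_K, ← RCLike.ofReal_pow, RCLike.ofReal_re]
  simp only [symGradL_apply, componentL_apply, partialL_apply, traceCompL_apply]
  rw [map_add, map_sub, RCLike.re_ofReal_mul, RCLike.re_ofReal_mul,
    RCLike.re_ofReal_mul, h4, h5, mul_zero, sub_zero, mul_assoc]
  set m := min (μ / 2) (1 / α * c) with hm
  have hm0 : 0 < m := by positivity
  set s1 := ∑ i, ∑ j, ‖symGrad (u : VecH1 𝕜 d b) i j‖ ^ 2 with hs1
  set s2 := ∑ i, ‖trace hb ((u : VecH1 𝕜 d b) i)‖ ^ 2 with hs2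
  have hs1' : 0 ≤ s1 := Finset.sum_nonneg fun _ _ => Finset.sum_nonneg fun _ _ => sq_nonneg _
  have hs2' : 0 ≤ s2 := Finset.sum_nonneg fun _ _ => sq_nonneg _
  have h6 : m * (L⁻¹ * ‖u‖ ^ 2) ≤ m * (s1 + s2) := mul_le_mul_of_nonneg_left h2 hm0.le
  have h7 : m * s1 ≤ μ / 2 * s1 := mul_le_mul_of_nonneg_right (min_le_left _ _) hs1'
  have h8 : m * s2 ≤ 1 / α * c * s2 := mul_le_mul_of_nonneg_right (min_le_right _ _) hs2'
  have h9 : 1 / α * (c * s2) ≤ 1 / α * RCLike.re (∑ i, ∑ j, (β i j : 𝕜) *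
      inner 𝕜 (trace hb ((u : VecH1 𝕜 d b) i)) (trace hb ((u : VecH1 𝕜 d b) j))) :=
    mul_le_mul_of_nonneg_left h3 (by positivity)
  linarith

set_option maxHeartbeats 1000000 in
theorem exists_stokes_equiv (hd : 1 ≤ d) (hb : 0 < b) {μ α : ℝ} (γ : ℝ) (hμ : 0 < μ)
    (hα : 0 < α) {β : Matrix (Fin (d + 1)) (Fin (d + 1)) ℝ}
    (hβ : ∀ w : Fin (d + 1) → ℝ, w ≠ 0 → 0 < w ⬝ᵥ β.mulVec w) :
    ∃ χ : (TanH1 𝕜 d hb × L2 𝕜 d b) ≃L[𝕜] ((TanH1 𝕜 d hb →L⋆[𝕜] 𝕜) × L2 𝕜 d b),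
      ∀ (u : TanH1 𝕜 d hb) (p : L2 𝕜 d b), (∀ v : TanH1 𝕜 d hb,
        (χ (u, p)).1 v =
          ((μ / 2 : ℝ) : 𝕜) * (∑ i, ∑ j, inner 𝕜 (symGradL hb i j v) (symGradL hb i j u))
          - (γ : 𝕜) * (∑ i, inner 𝕜 (componentL hb i v) (partialL hb 0 i u))
          + ((1 / α : ℝ) : 𝕜) * (∑ i, ∑ j, (β i j : 𝕜) *
            inner 𝕜 (traceCompL hb i v) (traceCompL hb j u))
          - inner 𝕜 (divergenceL hb v) p) ∧ (χ (u, p)).2 = divergenceL hb u := by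
  obtain ⟨c, hc0, hc⟩ := exists_coercive_stokes (𝕜 := 𝕜) hd hb γ hμ hα hβ
  exact exists_form_equiv_piLp ((μ / 2 : ℝ) : 𝕜) (γ : 𝕜)
    ((1 / α : ℝ) : 𝕜) (fun i j => (β i j : 𝕜)) (H1 𝕜 d b) (TanH1 𝕜 d hb)
    (symGradL hb) (componentL hb) (partialL hb 0) (traceCompL hb) hc0 hc
    (divergenceL hb) (divergenceL_surjective hb)

end

end SlipStokes

theorem mainTheorem7 {𝕜 : Type*} [RCLike 𝕜] (d : ℕ) (hd : 1 ≤ d) (b : ℝ) (hb : 0 < b)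
    (μ α γ : ℝ) (hμ : 0 < μ) (hα : 0 < α)
    (β : Matrix (Fin (d + 1)) (Fin (d + 1)) ℝ)
    (hβ : ∀ w : Fin (d + 1) → ℝ, w ≠ 0 → 0 < w ⬝ᵥ β.mulVec w) :
    ∃ χ : (SlipStokes.TanH1 𝕜 d hb × SlipStokes.L2 𝕜 d b) ≃L[𝕜]
        ((SlipStokes.TanH1 𝕜 d hb →L⋆[𝕜] 𝕜) × SlipStokes.L2 𝕜 d b),
      ∀ (u : SlipStokes.TanH1 𝕜 d hb) (p : SlipStokes.L2 𝕜 d b),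
        (∀ v : SlipStokes.TanH1 𝕜 d hb,
          (χ (u, p)).1 v = SlipStokes.weakStokes hb μ α γ β u p v) ∧
        (χ (u, p)).2 = SlipStokes.divergence (u : SlipStokes.VecH1 𝕜 d b) := by
  obtain ⟨χ, hχ⟩ := SlipStokes.exists_stokes_equiv (𝕜 := 𝕜) hd hb γ hμ hα hβ
  exact ⟨χ, fun u p => ⟨fun v => ((hχ u p).1 v).trans
    (SlipStokes.weakStokes_eq_form hb μ α γ β u v p).symm,
    (hχ u p).2.trans (SlipStokes.divergenceL_apply hb u)⟩⟩
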